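/- Let $R$ be a commutative ring with unit and $G$ a (discrete) group. The cohomological dimension $\mathrm{cd}_R(G)\in\mathbb N\cup\{\infty\}$ is the infimum of all $n\ge 0$ such that $\mathrm{Ext}^i_{RG}(R,M)=0$ for all $i>n$ and all $RG$-modules $M$, where $R$ is the trivial $RG$-module. The group $G$ has no $R$-torsion if $|H|\cdot 1_R$ is invertible in $R$ for every finite subgroup $H\le G$. For an integer $k\ge 0$, $G$ has jump cohomology of height $k$ over $R$ if every subgroup $H\le G$ with $\mathrm{cd}_R(H)<\infty$ satisfies $\mathrm{cd}_R(H)\le k$. The class ${\sl H}\mathcal F$ is the smallest class of groups that contains all finite groups and contains a group $G$ whenever $G$ acts cellularly (by homeomorphisms permuting the open cells) on a finite-dimensional contractible CW-complex $X$ such that the isotropy group $G_\sigma=\{g\in G: g\sigma=\sigma\}$ of every cell $\sigma$ of $X$ is in the class. Theorem. Let $G$ be an ${\sl H}\mathcal F$-group and let $k\ge 0$ be an integer. 1. For every commutative ring $R$ with unit, if $G$ has no $R$-torsion and has jump cohomology of height $k$ over $R$, then $\mathrm{cd}_R(G)\le k$. 2. In particular, $G$ has jump cohomology of height $k$ over $\mathbb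 Q$ if and only if $\mathrm{cd}_{\mathbb Q}(G)\le k$. -/

import Mathlib

open scoped Pointwise

universe u v w

noncomputable section

/-- `G` is `R`-torsion-free: the order of every finite subgroup of `G` is invertible in `R`. -/
def IsRTorsionFree (R : Type v) [CommRing R] (G : Type u) [Group G] : Prop :=
  ∀ H : Subgroup G, Finite H → IsUnit ((Nat.card H : ℕ) : R)

/-- The ring `R` as a module over the group ring `R[G]`, with trivial action of `G`
(lifted to the universe in which the `R[G]`-modules are taken). -/
abbrev trivialGroupRingModule (R : Type v) [CommRing R] (G : Type u) [Group G] :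
    ModuleCat.{max u v} (MonoidAlgebra R G) :=
  ModuleCat.of (MonoidAlgebra R G) (Representation.trivial R G (ULift.{u} R)).asModule

/-- The cohomological dimension `cd_R(G)`: the infimum of all natural numbers `n` such that
`Ext^i_{RG}(R, M) = 0` for all `i > n` and all `RG`-modules `M`; it is `⊤` if there is no
such `n`. -/
def cohomologicalDimension (R : Type v) [CommRing R] (G : Type u) [Group G] : ℕ∞ :=
  ⨅ n ∈ {n : ℕ | ∀ i : ℕ, n < i → ∀ M : ModuleCat.{max u v} (MonoidAlgebra R G),
    Subsingleton (CategoryTheory.Abelian.Ext (trivialGroupRingModule R G) M i)}, (n : ℕ∞)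

/-- `G` has jump cohomology of height `k` over `R`: every subgroup of finite cohomological
dimension over `R` has cohomological dimension at most `k` over `R`. -/
def HasJumpCohomologyOfHeight (R : Type v) [CommRing R] (G : Type u) [Group G] (k : ℕ) : Prop :=
  ∀ H : Subgroup G, cohomologicalDimension R H < ⊤ → cohomologicalDimension R H ≤ k

/-- An action of `G` on a CW-complex `X` is cellular if each element of `G` maps each open cell
of `X` onto an open cell of `X`. -/
def IsCellularAction (G : Type u) [Group G] (X : Type w) [TopologicalSpace X]
    [Topology.CWComplex (Set.univ : Set X)] [MulAction G X] : Prop :=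
  ∀ (g : G) (n : ℕ) (e : Topology.RelCWComplex.cell (Set.univ : Set X) n),
    ∃ e' : Topology.RelCWComplex.cell (Set.univ : Set X) n,
      g • Topology.RelCWComplex.openCell n e = Topology.RelCWComplex.openCell n e'

/-- The isotropy group of a cell: the subgroup of all elements of `G` that map the open cell `e`
onto itself. -/
abbrev cellIsotropy (G : Type u) [Group G] {X : Type w} [TopologicalSpace X]
    [Topology.CWComplex (Set.univ : Set X)] [MulAction G X]
    {n : ℕ} (e : Topology.RelCWComplex.cell (Set.univ : Set X) n) : Subgroup G :=
  MulAction.stabilizer G (Topology.RelCWComplex.openCell n e : Set X)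

/-- The class `H𝒳`: the smallest class of groups that contains `𝒳` and that contains a group `G`
whenever `G` acts cellularly, by homeomorphisms, on a finite-dimensional contractible
CW-complex all of whose cells have isotropy group in the class. -/
inductive IsHGroup (𝒳 : ∀ (G : Type u) [Group G], Prop) : ∀ (G : Type u) [Group G], Prop
  | of_mem (G : Type u) [Group G] (hG : 𝒳 G) : IsHGroup 𝒳 G
  | of_action (G : Type u) [Group G] (X : Type w) [TopologicalSpace X] [T2Space X]
      [Topology.CWComplex (Set.univ : Set X)]
      [Topology.RelCWComplex.FiniteDimensional (Set.univ : Set X)]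
      [ContractibleSpace X] [MulAction G X] [ContinuousConstSMul G X]
      (hcell : IsCellularAction G X)
      (hiso : ∀ (n : ℕ) (e : Topology.RelCWComplex.cell (Set.univ : Set X) n),
        IsHGroup 𝒳 (cellIsotropy G e)) :
      IsHGroup 𝒳 G

/-- Kropholler's class `H𝓕`, where `𝓕` is the class of finite groups. -/
def IsHFGroup (G : Type u) [Group G] : Prop :=
  IsHGroup.{u, w} (fun K _ => Finite K) G

end

/-! The theorem is proved by induction over the class H𝓕. For a finite group whose order is
invertible in `R`, averaging makes the trivial module projective, so the cohomological dimension is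
0. Now let `G` act cellularly on a finite-dimensional contractible complex `X` with isotropy groups
in the class. Absence of torsion and jump cohomology of height `k` pass to subgroups, so by
induction every isotropy group has dimension at most `k`. The augmented cellular chain complex of
`X` is a finite exact sequence that ends in the trivial module. Each chain module is free over `R`
on the cells of one dimension, and `G` permutes this basis up to units, so the module is induced
from the isotropy groups and has projective dimension at most `k`. Hence the trivial module has
finite projective dimension, bounded by `k` plus the length of the sequence. The bound is weak, but
finiteness is all that is needed: jump cohomology, applied to `G` as a subgroup of itself, brings it
down to `k`. The carrying lemmas are `UnitCocycle.hasProjectiveDimensionLT_ind` (induced modules),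
`exists_relBasis_skelLT` (cellular chains are free on cells), `exists_singBd_eq_of_skelLT`
(exactness) and `cohomologicalDimension_lt_top_of_action`.

The cellular complex comes from singular homology, built here from scratch. Simplices are counted by
vertices, so degree `n` means dimension `n - 1`. The empty simplex is allowed, which makes every
complex augmented: a point has no homology, and the empty set has homology `R` in degree 0. Chains
of all degrees live in one module with a differential, and homology is handled through explicit
relative cycles (`RelBasis`); degrees are recovered afterwards with `singComp`. With `Zₙ` the
homology of the union of the cells of dimension less than `n`, and `Cₙ` the homology of the pair
formed by two successive such unions, there are short exact sequences `0 → Zₙ₊₁ → Cₙ → Zₙ → 0`, with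
`Z₀` trivial and `Z_N = 0` for large `N`. -/

noncomputable section

open CategoryTheory Limits

/-! ### Projective dimension under exact functors. -/

section ProjectiveDimension

universe v₁ v₂ u₁ u₂

variable {C : Type u₁} [Category.{v₁} C] [Abelian C] {D : Type u₂} [Category.{v₂} D] [Abelian D]

/-- An exact functor which preserves projective objects does not raise projective dimension. -/
lemma hasProjectiveDimensionLT_map (F : C ⥤ D) [F.Additive] [PreservesFiniteLimits F]
    [PreservesFiniteColimits F] [F.PreservesProjectiveObjects] [EnoughProjectives C]
    (n : ℕ) (X : C) (hX : HasProjectiveDimensionLT X n) :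
    HasProjectiveDimensionLT (F.obj X) n := by
  induction n generalizing X with
  | zero =>
    rw [hasProjectiveDimensionLT_zero_iff_isZero] at hX ⊢
    exact F.map_isZero hX
  | succ n ih =>
    -- Dimension shifting along a syzygy relates only the bounds `n + 2` and `n + 1`. The bounds 0
    -- (zero object) and 1 (projective object) are therefore both base cases.
    cases n with
    | zero =>
      rw [zero_add, ← projective_iff_hasProjectiveDimensionLT_one] at hX ⊢
      exact F.projective_obj_of_projective hX
    | succ n =>
      let P : ProjectivePresentation X := Classical.arbitrary _
      let S := ShortComplex.mk _ _ (kernel.condition P.f)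
      have hS : S.ShortExact := { exact := ShortComplex.exact_kernel P.f }
      have h2 : Projective (S.map F).X₂ := F.projective_obj_of_projective P.projective
      have h1 : HasProjectiveDimensionLT S.X₁ (n + 1) :=
        (hS.hasProjectiveDimensionLT_X₃_iff n P.projective).1 hX
      exact ((hS.map F).hasProjectiveDimensionLT_X₃_iff n h2).2 (ih _ h1)

/-- A fully faithful exact functor which preserves projective objects reflects projective
dimension. -/
lemma hasProjectiveDimensionLT_of_map (F : C ⥤ D) [F.Additive] [PreservesFiniteLimits F]
    [PreservesFiniteColimits F] [F.PreservesProjectiveObjects] [EnoughProjectives C]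
    [F.Full] [F.Faithful]
    (n : ℕ) (X : C) (hX : HasProjectiveDimensionLT (F.obj X) n) :
    HasProjectiveDimensionLT X n := by
  let := HasExt.standard C
  let := HasExt.standard D
  rw [hasProjectiveDimensionLT_iff] at hX ⊢
  intro i hi Y e
  -- A fully faithful exact functor preserving projectives is injective on Ext, so a class with zero
  -- image is zero.
  apply (F.mapExt_bijective_of_preservesProjectiveObjects X Y i).injective
  rw [hX i hi (F.mapExtAddHom X Y i e), map_zero]

end ProjectiveDimension

/-! ### Cohomological dimension as projective dimension of the trivial representation. -/

section CohomologicalDimension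

variable (R : Type v) [CommRing R] (G : Type u) [Group G]

instance Rep.enoughProjectives_max : EnoughProjectives (Rep.{max u v w} R G) :=
  Rep.equivalenceModuleMonoidAlgebra.enoughProjectives_iff.2
    (inferInstanceAs (EnoughProjectives (ModuleCat.{max u v w} (MonoidAlgebra R G))))

/-- Restriction is left adjoint to coinduction, and coinduction preserves epimorphisms. -/
lemma Rep.res_preservesProjectiveObjects (H : Subgroup G) :
    (Rep.resFunctor.{max u v w} (k := R) H.subtype).PreservesProjectiveObjects :=
  (Rep.resFunctor H.subtype).preservesProjectiveObjects_of_adjunction_of_preservesEpimorphisms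
    (Rep.resCoindAdjunction.{max v w} R H.subtype)

instance Rep.toModuleMonoidAlgebra_additive :
    (Rep.toModuleMonoidAlgebra.{w} (k := R) (G := G)).Additive where
  map_add := rfl

/-- The trivial representation of `G` on `R`, lifted to a large universe. -/
abbrev Rep.trivialLift : Rep.{max u v w} R G := Rep.trivial R G (ULift.{max u w} R)

lemma cohomologicalDimension_le_iff_ext (k : ℕ) :
    cohomologicalDimension R G ≤ k ↔ ∀ i : ℕ, k < i →
      ∀ M : ModuleCat.{max u v} (MonoidAlgebra R G),
        Subsingleton (Abelian.Ext (trivialGroupRingModule R G) M i) := by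
  constructor
  · intro h i hi M
    by_contra hM
    -- A nonvanishing Ext in degree `i > k` forces every admissible `n` to be at least `i`, hence at
    -- least `k + 1`.
    have : ((k + 1 : ℕ) : ℕ∞) ≤ cohomologicalDimension R G := by
      unfold cohomologicalDimension
      refine le_iInf₂ fun n hn => ?_
      by_contra hlt
      have hlt : n < k + 1 := by exact_mod_cast not_le.1 hlt
      exact hM (hn i (by lia) M)
    have := this.trans h
    norm_cast at this
    lia
  · intro h
    exact iInf₂_le_of_le k h le_rfl

lemma cohomologicalDimension_lt_top_iff :
    cohomologicalDimension R G < ⊤ ↔ ∃ k : ℕ, cohomologicalDimension R G ≤ k := by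
  constructor
  · intro h
    obtain ⟨k, hk⟩ := ENat.ne_top_iff_exists.1 h.ne
    exact ⟨k, hk.ge⟩
  · rintro ⟨k, hk⟩
    exact hk.trans_lt (by simp)

lemma cohomologicalDimension_le_iff_moduleCat (k : ℕ) :
    cohomologicalDimension R G ≤ k ↔
      HasProjectiveDimensionLT (trivialGroupRingModule R G) (k + 1) := by
  rw [cohomologicalDimension_le_iff_ext, hasProjectiveDimensionLT_iff]
  refine forall_congr' fun i => forall_congr' fun hi => ?_
  refine forall_congr' fun M => ⟨fun h e => Subsingleton.elim _ _, fun h => ⟨fun a b => ?_⟩⟩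
  rw [h a, h b]

/-- The trivial modules over the group ring in various universes correspond to each other. -/
def trivialGroupRingModuleLiftIso :
    (ModuleCat.uliftFunctor.{max u v w, max u v} (MonoidAlgebra R G)).obj
      (trivialGroupRingModule R G) ≅
    Rep.toModuleMonoidAlgebra.obj (Rep.trivialLift.{u, v, w} R G) :=
  LinearEquiv.toModuleIso
    { toFun := fun x => (Rep.trivialLift.{u, v, w} R G).ρ.asModuleEquiv.symm
          (ULift.up ((Representation.trivial R G (ULift.{u} R)).asModuleEquiv x.down).down)
      invFun := fun x => ULift.up ((Representation.trivial R G (ULift.{u} R)).asModuleEquiv.symm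
          (ULift.up ((Rep.trivialLift.{u, v, w} R G).ρ.asModuleEquiv x).down))
      left_inv := fun x => rfl
      right_inv := fun x => rfl
      map_add' := fun x y => rfl
      map_smul' := fun r x => by
        exact congrArg ULift.up (congrArg ULift.down (Rep.to_Module_monoidAlgebra_map_aux _ _
          (Representation.trivial R G (ULift.{u} R))
          (Representation.trivial R G (ULift.{max u w} R))
          (ULift.moduleEquiv.symm.toLinearMap ∘ₗ ULift.moduleEquiv.toLinearMap)
          (fun g => rfl) r
          ((Representation.trivial R G (ULift.{u} R)).asModuleEquiv x.down))) }

/-- The cellular chains of a space in universe `w` live in `max u v w`, whereas the definition uses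
modules in `max u v`. Both the universe lift of modules and the passage from representations to
modules are exact, fully faithful and preserve projectives, so the bound can be carried in either
direction. -/
lemma cohomologicalDimension_le_iff (k : ℕ) :
    cohomologicalDimension R G ≤ k ↔
      HasProjectiveDimensionLT (Rep.trivialLift.{u, v, w} R G) (k + 1) := by
  rw [cohomologicalDimension_le_iff_moduleCat]
  constructor
  · intro h
    have h1 := hasProjectiveDimensionLT_map
      (ModuleCat.uliftFunctor.{max u v w, max u v} (MonoidAlgebra R G)) _ _ h
    have h2 := hasProjectiveDimensionLT_of_iso (trivialGroupRingModuleLiftIso.{u, v, w} R G) (k + 1)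
    exact hasProjectiveDimensionLT_of_map Rep.toModuleMonoidAlgebra _ _ h2
  · intro h
    have h1 := hasProjectiveDimensionLT_map Rep.toModuleMonoidAlgebra _ _ h
    have h2 := hasProjectiveDimensionLT_of_iso
      (trivialGroupRingModuleLiftIso.{u, v, w} R G).symm (k + 1)
    exact hasProjectiveDimensionLT_of_map
      (ModuleCat.uliftFunctor.{max u v w, max u v} (MonoidAlgebra R G)) _ _ h2

lemma hasProjectiveDimensionLT_res (H : Subgroup G) (A : Rep.{max u v w} R G) (n : ℕ)
    (h : HasProjectiveDimensionLT A n) :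
    HasProjectiveDimensionLT (Rep.res H.subtype A) n := by
  have := Rep.res_preservesProjectiveObjects.{u, v, w} R G H
  exact hasProjectiveDimensionLT_map (Rep.resFunctor.{max u v w} (k := R) H.subtype) n A h

/-- This gives the easy implication of the second claim. With `H = ⊤` it also lets the jump
hypothesis be applied to the whole group. -/
lemma cohomologicalDimension_subgroup_le (H : Subgroup G) (k : ℕ)
    (h : cohomologicalDimension R G ≤ k) : cohomologicalDimension R H ≤ k := by
  rw [cohomologicalDimension_le_iff.{u, v, 0}] at h ⊢
  exact hasProjectiveDimensionLT_res.{u, v, 0} R G H _ _ h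

end CohomologicalDimension
end

noncomputable section

open CategoryTheory Limits

/-! ### Monomial representations: a group permutes coordinates up to units. -/

section Monomial

variable {R : Type v} [CommRing R] {G : Type u} [Group G]

/-- A short complex of representations is short exact if it is so on the underlying modules. -/
lemma Rep.shortExact_of_exact {A B C : Rep.{w} R G} (f : A ⟶ B) (g : B ⟶ C) (hfg : f ≫ g = 0)
    (hf : Function.Injective f.hom) (hg : Function.Surjective g.hom)
    (h : ∀ b, g.hom b = 0 → ∃ a, f.hom a = b) :
    (ShortComplex.mk f g hfg).ShortExact where
  exact := by
    rw [← ShortComplex.exact_map_iff_of_faithful _ (forget₂ (Rep.{w} R G) (ModuleCat.{w} R)),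
      ShortComplex.ShortExact.moduleCat_exact_iff_function_exact]
    intro b
    refine ⟨fun hb => h b hb, ?_⟩
    rintro ⟨a, rfl⟩
    exact congrArg (fun t : A ⟶ C => t.hom a) hfg
  mono_f := (Rep.mono_iff_injective _).2 hf
  epi_g := (Rep.epi_iff_surjective _).2 hg

variable {I : Type w} [MulAction G I]

/-- A multiplicative cocycle on a `G`-set with values in the units of `R`. -/
structure UnitCocycle (R : Type v) [CommRing R] (G : Type u) [Group G] (I : Type w)
    [MulAction G I] where
  /-- The values of the cocycle. -/
  toFun : G → I → Rˣ
  toFun_mul : ∀ g h i, toFun (g * h) i = toFun g (h • i) * toFun h i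

variable (χ : UnitCocycle R G I)

lemma UnitCocycle.toFun_one (i : I) : χ.toFun 1 i = 1 := by
  have := χ.toFun_mul 1 1 i
  simpa using this

universe t
variable {V : Type t} [AddCommGroup V] [Module R V]

/-- The monomial representation induced from `ρ` by a cocycle on a `G`-set. -/
def UnitCocycle.ind (ρ : Representation R G V) : Representation R G (I →₀ V) where
  toFun g := Finsupp.lsum R fun i =>
    (χ.toFun g i : R) • (Finsupp.lsingle (g • i) ∘ₗ ρ g)
  map_one' := by
    ext i v : 2
    simp [χ.toFun_one]
  map_mul' g h := by
    ext i v : 2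
    simp only [LinearMap.comp_apply, Finsupp.lsingle_apply, Finsupp.lsum_single, map_mul,
      χ.toFun_mul, LinearMap.smul_apply, Module.End.mul_apply, map_smul, Units.val_mul]
    rw [smul_smul, mul_smul g h, mul_comm]

@[simp]
lemma UnitCocycle.ind_single (ρ : Representation R G V) (g : G) (i : I) (v : V) :
    χ.ind ρ g (Finsupp.single i v) =
      Finsupp.single (g • i) ((χ.toFun g i : R) • ρ g v) := by
  simp [UnitCocycle.ind]

/-- The functoriality of the monomial representation. -/
def UnitCocycle.indMap {V' : Type t} [AddCommGroup V'] [Module R V']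
    {ρ : Representation R G V} {ρ' : Representation R G V'} (f : ρ.IntertwiningMap ρ') :
    (χ.ind ρ).IntertwiningMap (χ.ind ρ') where
  __ := Finsupp.mapRange.linearMap f.toLinearMap
  isIntertwining' g := by
    ext i v : 2
    have := congrArg (fun l : V →ₗ[R] V' => l v) (f.isIntertwining' g)
    simp at this
    simp [this]

/-- The twist of a representation of a stabilizer by a cocycle. -/
def UnitCocycle.twist (i : I) (ρ : Representation R G V) :
    Representation R (MulAction.stabilizer G i) V where
  -- The inverse is chosen so that `v ↦ Finsupp.single i v` is equivariant from the restriction of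
  -- `V` to the twist of the induced representation at `i`.
  toFun g := ((χ.toFun g i)⁻¹ : Rˣ).val • ρ g
  map_one' := by simp [χ.toFun_one]
  map_mul' g h := by
    have : (h : G) • i = i := h.2
    ext v
    simp only [Subgroup.coe_mul, χ.toFun_mul, this, map_mul, mul_inv_rev, Units.val_mul,
      LinearMap.smul_apply, Module.End.mul_apply, map_smul, smul_smul]

lemma UnitCocycle.twist_apply (i : I) (ρ : Representation R G V) (g : MulAction.stabilizer G i)
    (v : V) : χ.twist i ρ g v = ((χ.toFun g i)⁻¹ : Rˣ).val • ρ g v := rfl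

end Monomial

section

variable {R : Type v} [CommRing R] {G : Type u} [Group G] {I : Type w} [MulAction G I]
  (χ : UnitCocycle R G I)

/-- The induced representation splits over the orbits, and an equivariant map on an orbit is
determined by its value on one coordinate, which need only respect the stabilizer. The lifting
problem thus becomes one for `V` over stabilizers; the cocycle is moved into the targets `E` and `X`
by twisting. -/
lemma UnitCocycle.projective_ind (V : Rep.{max u v w} R G)
    (hV : ∀ i : I, Projective (Rep.res (MulAction.stabilizer G i).subtype V)) :
    Projective (Rep.of (χ.ind V.ρ)) where
  factors {E X} f e he := by
    have hlift : ∀ i : I, ∃ h : V →ₗ[R] E, (∀ v, e.hom (h v) = f.hom (Finsupp.single i v)) ∧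
        ∀ s ∈ MulAction.stabilizer G i, ∀ v, h (V.ρ s v) =
          ((χ.toFun s i)⁻¹ : Rˣ).val • E.ρ s (h v) := by
      intro i
      let fi : Rep.res (MulAction.stabilizer G i).subtype V ⟶ Rep.of (χ.twist i X.ρ) :=
        Rep.ofHom
          { __ := f.hom.toLinearMap ∘ₗ Finsupp.lsingle i
            isIntertwining' := fun g => by
              ext v
              have h1 := Rep.hom_comm_apply f (g : G) (Finsupp.single i v)
              have h2 : (g : G) • i = i := g.2
              simp only [χ.ind_single, h2] at h1
              simp only [LinearMap.comp_apply, Finsupp.lsingle_apply, χ.twist_apply]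
              erw [← h1]
              rw [← map_smul, Finsupp.smul_single, smul_smul]
              simp }
      let ei : Rep.of (χ.twist i E.ρ) ⟶ Rep.of (χ.twist i X.ρ) :=
        Rep.ofHom
          { __ := e.hom.toLinearMap
            isIntertwining' := fun g => by
              ext v
              have h1 := Rep.hom_comm_apply e (g : G) v
              simp only [LinearMap.comp_apply, χ.twist_apply, map_smul]
              erw [h1] 
              rfl }
      have : Epi ei := (Rep.epi_iff_surjective ei).2 ((Rep.epi_iff_surjective e).1 he)
      obtain ⟨h, hh⟩ := (hV i).factors fi ei
      refine ⟨h.hom.toLinearMap, fun v => ?_, fun s hs v => ?_⟩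
      · exact congrArg (fun t : _ ⟶ Rep.of (χ.twist i X.ρ) => t.hom v) hh
      · exact Rep.hom_comm_apply h (⟨s, hs⟩ : MulAction.stabilizer G i) v
    choose h he hs using hlift
    -- `r i` is the chosen representative of the orbit of `i`, and `γ i` below carries `r i` to `i`.
    let r : I → I := fun i => (Quotient.mk (MulAction.orbitRel G I) i).out
    have hr : ∀ i, ∃ g : G, g • r i = i := fun i => by
      have : (MulAction.orbitRel G I).r (r i) i := Quotient.exact (Quotient.out_eq _)
      obtain ⟨g, hg⟩ := this
      exact ⟨g⁻¹, by rw [← hg]; simp⟩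
    have hrg : ∀ (g : G) i, r (g • i) = r i := fun g i => by
      have : (Quotient.mk (MulAction.orbitRel G I) (g • i)) = Quotient.mk _ i :=
        Quotient.sound ⟨g, rfl⟩
      simp only [r, this]
    choose γ hγ using hr
    -- Equivariance forces this formula, because `single i v` is the translate by `γ i` of `single
    -- (r i) ((γ i)⁻¹ v)`, up to the unit `χ.toFun (γ i) (r i)`.
    let H : (I →₀ V) →ₗ[R] E := Finsupp.lsum R fun i =>
      ((χ.toFun (γ i) (r i))⁻¹ : Rˣ).val • (E.ρ (γ i) ∘ₗ h (r i) ∘ₗ V.ρ (γ i)⁻¹)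
    have H1 : ∀ i v, H (Finsupp.single i v) = ((χ.toFun (γ i) (r i))⁻¹ : Rˣ).val •
        E.ρ (γ i) (h (r i) (V.ρ (γ i)⁻¹ v)) := fun i v => by simp [H]
    refine ⟨Rep.ofHom { __ := H, isIntertwining' := fun g => ?_ }, ?_⟩
    · ext i v
      simp only [LinearMap.comp_apply, Finsupp.lsingle_apply]
      change H (χ.ind V.ρ g (Finsupp.single i v)) = E.ρ g (H (Finsupp.single i v))
      rw [χ.ind_single, H1, H1]
      have hi := hγ i
      have hi' := hγ (g • i)
      rw [hrg] at hi' ⊢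
      set i0 := r i
      set c := γ i
      set c' := γ (g • i)
      -- Both `g * c` and `c'` carry the representative to `g • i`. They differ by a stabilizer
      -- element, over which `h` is known to be equivariant; the scalars match by the cocycle
      -- identity in `e2`.
      have hst : c'⁻¹ * g * c ∈ MulAction.stabilizer G i0 := by
        rw [MulAction.mem_stabilizer_iff, mul_smul, mul_smul, hi, ← hi']
        simp
      have e1 : V.ρ c'⁻¹ (V.ρ g v) = V.ρ (c'⁻¹ * g * c) (V.ρ c⁻¹ v) := by
        rw [← Module.End.mul_apply, ← Module.End.mul_apply, ← map_mul, ← map_mul]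
        congr 2
        group
      have e2 : χ.toFun g i * χ.toFun c i0 =
          χ.toFun c' i0 * χ.toFun (c'⁻¹ * g * c) i0 := by
        have a1 := χ.toFun_mul g c i0
        have a2 := χ.toFun_mul c' (c'⁻¹ * g * c) i0
        rw [hi] at a1
        rw [MulAction.mem_stabilizer_iff.1 hst] at a2
        rw [← a1, ← a2]
        congr 1
        group
      simp only [map_smul]
      rw [e1, hs _ _ hst, map_smul, smul_smul, smul_smul, ← Module.End.mul_apply (E.ρ c'),
        ← map_mul, ← Module.End.mul_apply (E.ρ g), ← map_mul]
      have e3 : c' * (c'⁻¹ * g * c) = g * c := by group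
      rw [e3]
      congr 1
      rw [← Units.val_mul, ← Units.val_mul, Units.val_inj]
      rw [eq_inv_iff_mul_eq_one]
      generalize χ.toFun g i = a at e2 ⊢
      generalize χ.toFun c i0 = b at e2 ⊢
      generalize χ.toFun c' i0 = p at e2 ⊢
      generalize χ.toFun (c'⁻¹ * g * c) i0 = q at e2 ⊢
      calc p⁻¹ * a * q⁻¹ * b = (p * q)⁻¹ * (a * b) := by rw [mul_inv]; ac_rfl
        _ = 1 := by rw [e2, inv_mul_cancel]
    · ext i v
      change e.hom (H (Finsupp.single i v)) = f.hom (Finsupp.single i v)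
      have h1 := Rep.hom_comm_apply f (γ i) (Finsupp.single (r i) (V.ρ (γ i)⁻¹ v))
      have h2 : V.ρ (γ i) (V.ρ (γ i)⁻¹ v) = v := by
        rw [← Module.End.mul_apply, ← map_mul]
        simp
      erw [χ.ind_single] at h1
      rw [hγ, h2, ← Finsupp.smul_single, map_smul] at h1
      rw [H1, map_smul, Rep.hom_comm_apply, he, ← h1, smul_smul]
      simp

/-- The monomial representation on a short complex. -/
lemma UnitCocycle.hasProjectiveDimensionLT_ind (n : ℕ) (V : Rep.{max u v w} R G)
    (hV : ∀ i : I, HasProjectiveDimensionLT (Rep.res (MulAction.stabilizer G i).subtype V)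
      (n + 1)) : HasProjectiveDimensionLT (Rep.of (χ.ind V.ρ)) (n + 1) := by
  induction n generalizing V with
  | zero =>
    have := χ.projective_ind V fun i => projective_iff_hasProjectiveDimensionLT_one.2 (hV i)
    exact projective_iff_hasProjectiveDimensionLT_one.1 this
  | succ n ih =>
    let P : ProjectivePresentation V := Classical.arbitrary _
    let S := ShortComplex.mk _ _ (kernel.condition P.f)
    have hS : S.ShortExact := { exact := ShortComplex.exact_kernel P.f }
    have hP : Projective (Rep.of (χ.ind P.p.ρ)) := by
      refine χ.projective_ind _ fun i => ?_
      have := Rep.res_preservesProjectiveObjects.{u, v, w} R G (MulAction.stabilizer G i)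
      exact (Rep.resFunctor.{max u v w} (k := R)
        (MulAction.stabilizer G i).subtype).projective_obj_of_projective P.projective
    -- Restricting the presentation to a stabilizer keeps the middle term projective. The restricted
    -- kernel therefore satisfies the hypothesis with a bound one lower.
    have hK : HasProjectiveDimensionLT (Rep.of (χ.ind (kernel P.f).ρ)) (n + 1) := by
      refine ih _ fun i => ?_
      have := Rep.res_preservesProjectiveObjects.{u, v, w} R G (MulAction.stabilizer G i)
      have hS' := (Rep.shortExact_res (MulAction.stabilizer G i).subtype).2 hS
      have h2 := (Rep.resFunctor.{max u v w} (k := R)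
        (MulAction.stabilizer G i).subtype).projective_obj_of_projective P.projective
      exact (hS'.hasProjectiveDimensionLT_X₃_iff n h2).1 (hV i)
    have hinj : Function.Injective S.f.hom := (Rep.mono_iff_injective _).1 hS.mono_f
    have hsurj : Function.Surjective S.g.hom := (Rep.epi_iff_surjective _).1 hS.epi_g
    have hex : ∀ b, S.g.hom b = 0 → ∃ a, S.f.hom a = b := by
      have := hS.exact
      rw [← ShortComplex.exact_map_iff_of_faithful _ (forget₂ (Rep R G) (ModuleCat R)),
        ShortComplex.ShortExact.moduleCat_exact_iff_function_exact] at this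
      exact fun b hb => (this b).1 hb
    have hT := Rep.shortExact_of_exact (Rep.ofHom (χ.indMap S.f.hom))
      (Rep.ofHom (χ.indMap S.g.hom)) (by
        ext i v j
        have h0 : S.g.hom (S.f.hom v) = 0 := congrArg (fun t : S.X₁ ⟶ S.X₃ => t.hom v) S.zero
        change (Finsupp.mapRange.linearMap S.g.hom.toLinearMap) (Finsupp.mapRange.linearMap
          S.f.hom.toLinearMap (Finsupp.single i v)) j = 0
        simp [h0])
      (Finsupp.mapRange_injective _ (map_zero S.f.hom) hinj)
      (Finsupp.mapRange_surjective _ (map_zero S.g.hom) hsurj)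
      (by
        intro b hb
        choose s hs using fun x : {x : S.X₂ // S.g.hom x = 0} => hex x.1 x.2
        have hb' : ∀ i, S.g.hom (b i) = 0 := fun i => DFunLike.congr_fun hb i
        have : ∀ i, ∃ a, S.f.hom a = b i := fun i => hex _ (hb' i)
        choose a ha using this
        -- Preimages are chosen coordinatewise. Injectivity of `S.f` makes them vanish outside the
        -- support of `b`, so they form a finitely supported function.
        refine ⟨Finsupp.onFinset b.support a fun i hi => ?_, ?_⟩
        · rw [Finsupp.mem_support_iff]
          intro h0
          apply hi
          apply hinj
          rw [ha, h0, map_zero]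
        · ext i
          exact ha i)
    exact (hT.hasProjectiveDimensionLT_X₃_iff n hP).2 hK

end
end

noncomputable section

open CategoryTheory Limits

/-! ### Module-theoretic inputs: bases permuted up to scalars, towers of extensions, finite groups.
-/

section

variable {R : Type v} [CommRing R] {G : Type u} [Group G]

/-- The lift of a representation to a larger universe. -/
def Representation.ulift {C : Type w} [AddCommGroup C] [Module R C] (σ : Representation R G C) :
    Representation R G (ULift.{u} C) where
  toFun g := ULift.moduleEquiv.symm.toLinearMap ∘ₗ σ g ∘ₗ ULift.moduleEquiv.toLinearMap
  map_one' := by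
    ext x
    simp
  map_mul' g h := by
    ext x
    simp

lemma Representation.ulift_up {C : Type w} [AddCommGroup C] [Module R C]
    (σ : Representation R G C) (g : G) (c : C) :
    σ.ulift g (ULift.up c) = ULift.up (σ g c) := rfl

/-- The lift of an equivariant map to a larger universe. -/
def Representation.IntertwiningMap.ulift {C C' : Type w} [AddCommGroup C] [Module R C]
    [AddCommGroup C'] [Module R C'] {σ : Representation R G C} {σ' : Representation R G C'}
    (f : C →ₗ[R] C') (hf : ∀ g c, f (σ g c) = σ' g (f c)) :
    σ.ulift.IntertwiningMap σ'.ulift where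
  __ := ULift.moduleEquiv.symm.toLinearMap ∘ₗ f ∘ₗ ULift.moduleEquiv.toLinearMap
  isIntertwining' g := by
    ext x
    simp [Representation.ulift, hf]

lemma Representation.shortExact_ulift {A B C : Type (max v w)} [AddCommGroup A] [Module R A]
    [AddCommGroup B] [Module R B] [AddCommGroup C] [Module R C]
    {α : Representation R G A} {β : Representation R G B} {γ : Representation R G C}
    (f : A →ₗ[R] B) (hf : ∀ g c, f (α g c) = β g (f c))
    (g : B →ₗ[R] C) (hg : ∀ h c, g (β h c) = γ h (g c))
    (hinj : Function.Injective f) (hsurj : Function.Surjective g) (hfg : ∀ a, g (f a) = 0)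
    (hex : ∀ b, g b = 0 → ∃ a, f a = b) :
    ∃ h, (ShortComplex.mk (X₁ := Rep.of α.ulift) (X₂ := Rep.of β.ulift) (X₃ := Rep.of γ.ulift)
      (Rep.ofHom (Representation.IntertwiningMap.ulift f hf))
      (Rep.ofHom (Representation.IntertwiningMap.ulift g hg)) h).ShortExact := by
  refine ⟨?_, Rep.shortExact_of_exact _ _ _ ?_ ?_ ?_⟩
  · ext x
    exact hfg x.down
  · intro x y hxy
    exact ULift.ext _ _ (hinj (congrArg ULift.down hxy))
  · intro x
    obtain ⟨b, hb⟩ := hsurj x.down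
    exact ⟨ULift.up b, ULift.ext _ _ hb⟩
  · intro b hb
    obtain ⟨a, ha⟩ := hex b.down (congrArg ULift.down hb)
    exact ⟨ULift.up a, ULift.ext _ _ ha⟩

/-- Comparing coefficients in the basis shows that the scalars form a cocycle of units. This
identifies `C` with the representation induced from the trivial one, whose dimension is controlled
on stabilizers. -/
lemma hasProjectiveDimensionLT_of_monomial {I : Type w} [MulAction G I] {C : Type (max v w)}
    [AddCommGroup C] [Module R C] (σ : Representation R G C) (b : Module.Basis I R C)
    (hb : ∀ g i, ∃ r : R, σ g (b i) = r • b (g • i)) (n : ℕ)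
    (hI : ∀ i : I, HasProjectiveDimensionLT
      (Rep.trivialLift.{u, v, w} R (MulAction.stabilizer G i)) (n + 1)) :
    HasProjectiveDimensionLT (Rep.of (σ.ulift : Representation R G (ULift.{u} C))) (n + 1) := by
  choose r hr using hb
  have hr1 : ∀ i, r 1 i = 1 := fun i => by
    have := congrArg (fun x => b.repr x i) (hr 1 i)
    simpa using this.symm
  have hrm : ∀ g h i, r (g * h) i = r g (h • i) * r h i := fun g h i => by
    have h1 := hr (g * h) i
    rw [map_mul, Module.End.mul_apply, hr, map_smul, hr, mul_smul, smul_smul] at h1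
    have := congrArg (fun x => b.repr x (g • h • i)) h1
    simp at this
    rw [← this, mul_comm]
  let χ : UnitCocycle R G I :=
    -- The inverse of `r g i` comes from the cocycle relation for `g⁻¹ * g = 1`.
    { toFun := fun g i => ⟨r g i, r g⁻¹ (g • i), by
        rw [mul_comm, ← hrm, inv_mul_cancel, hr1], by
        rw [← hrm, inv_mul_cancel, hr1]⟩
      toFun_mul := fun g h i => Units.ext (hrm g h i) }
  have h := χ.hasProjectiveDimensionLT_ind n (Rep.trivialLift.{u, v, w} R G) fun i => hI i
  let e : C ≃ₗ[R] (I →₀ ULift.{max u w} R) :=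
    b.repr.trans (Finsupp.mapRange.linearEquiv ULift.moduleEquiv.symm)
  have he : ∀ i, e (b i) = Finsupp.single i (ULift.up 1) := fun i => by
    simp only [e, LinearEquiv.trans_apply, Module.Basis.repr_self]
    exact Finsupp.mapRange_single (hf := rfl)
  refine @hasProjectiveDimensionLT_of_iso _ _ _ _ _ (Rep.mkIso (Representation.Equiv.mk
    (ULift.moduleEquiv.trans e) fun g => ?_)).symm (n + 1) h
  refine LinearMap.ext fun x => ?_
  obtain ⟨x⟩ := x
  change e (σ g x) = χ.ind _ g (e x)
  suffices e.toLinearMap ∘ₗ σ g = χ.ind (Rep.trivialLift.{u, v, w} R G).ρ g ∘ₗ e.toLinearMap from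
    LinearMap.congr_fun this x
  refine b.ext fun i => ?_
  simp only [LinearMap.comp_apply, LinearEquiv.coe_coe, he, hr, map_smul]
  rw [χ.ind_single]
  simp only [Finsupp.smul_single]
  rfl

/-- Descending from `Z N = 0`, each extension costs at most one: the quotient `Z i` is bounded
through `C i` and by one more than `Z (i + 1)`. -/
lemma hasProjectiveDimensionLT_of_shortExact_tower (Z C : ℕ → Rep.{max u v w} R G) (n N : ℕ)
    (hC : ∀ i, HasProjectiveDimensionLT (C i) (n + 1)) (hN : IsZero (Z N))
    (h : ∀ i, ∃ (f : Z (i + 1) ⟶ C i) (g : C i ⟶ Z i) (w : f ≫ g = 0),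
      (ShortComplex.mk f g w).ShortExact) :
    HasProjectiveDimensionLT (Z 0) (n + 1 + N) := by
  suffices ∀ j ≤ N, HasProjectiveDimensionLT (Z (N - j)) (n + 1 + j) by
    simpa using this N le_rfl
  intro j hj
  induction j with
  | zero =>
    have := hN.hasProjectiveDimensionLT_zero
    exact hasProjectiveDimensionLT_of_ge _ 0 _ (by lia)
  | succ j ih =>
    obtain ⟨f, g, w, hfg⟩ := h (N - (j + 1))
    have e : N - (j + 1) + 1 = N - j := by lia
    have h1 := ih (by lia)
    rw [← e] at h1
    have h2 : HasProjectiveDimensionLT (C (N - (j + 1))) (n + 1 + j + 1) :=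
      have := hC (N - (j + 1))
      hasProjectiveDimensionLT_of_ge _ (n + 1) _ (by lia)
    exact hfg.hasProjectiveDimensionLT_X₃ _ h1 h2

/-- Averaging as in Maschke's theorem: any preimage of the image of 1 can be replaced by its mean
over `G`. The mean is invariant and has the same image, because that image is itself invariant. -/
lemma projective_trivialLift_of_finite [Finite G] (hG : IsUnit ((Nat.card G : ℕ) : R)) :
    Projective (Rep.trivialLift.{u, v, w} R G) where
  factors {E X} f e he := by
    obtain ⟨_⟩ := nonempty_fintype G
    obtain ⟨a, ha⟩ := hG.exists_left_inv
    obtain ⟨x, hx⟩ := (Rep.epi_iff_surjective e).1 he (f.hom (ULift.up 1))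
    let y : E := a • ∑ g : G, E.ρ g x
    have hy : ∀ g, E.ρ g y = y := fun g => by
      simp only [y, map_smul, map_sum, ← Module.End.mul_apply, ← map_mul]
      congr 1
      exact Fintype.sum_equiv (Equiv.mulLeft g) _ _ fun h => rfl
    refine ⟨Rep.ofHom
      { __ := (LinearMap.toSpanSingleton R E y) ∘ₗ ULift.moduleEquiv.toLinearMap
        isIntertwining' := fun g => ?_ }, ?_⟩
    · ext r
      change r.down • y = E.ρ g (r.down • y)
      rw [map_smul, hy]
    · ext r
      change e.hom (r.down • y) = f.hom r
      have h1 : e.hom y = f.hom (ULift.up 1) := by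
        simp only [y, map_smul, map_sum, Rep.hom_comm_apply, hx]
        have : ∀ g : G, X.ρ g (f.hom (ULift.up 1)) = f.hom (ULift.up 1) := fun g =>
          (Rep.hom_comm_apply f g (ULift.up 1)).symm
        simp only [this, Finset.sum_const, Finset.card_univ]
        rw [← Nat.cast_smul_eq_nsmul R, smul_smul, ← Nat.card_eq_fintype_card, ha, one_smul]
      rw [map_smul, h1, ← map_smul]
      congr 1
      ext
      simp

lemma cohomologicalDimension_le_zero_of_finite (R : Type v) [CommRing R] (G : Type u) [Group G]
    [Finite G] (hG : IsUnit ((Nat.card G : ℕ) : R)) :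
    cohomologicalDimension R G ≤ (0 : ℕ) := by
  rw [cohomologicalDimension_le_iff.{u, v, 0}, zero_add, ← projective_iff_hasProjectiveDimensionLT_one]
  exact projective_trivialLift_of_finite hG

end
end

noncomputable section

/-! ### Relative homology in a module with differential, described by explicit cycles. -/

section DifferentialModule

variable {R M : Type*} [CommRing R] [AddCommGroup M] [Module R M] (d : M →ₗ[R] M)

/-- The homology of `C` relative to `A` vanishes, where `A ≤ C` are subcomplexes of `(M, d)`. -/
def RelAcyclic (C A : Submodule R M) : Prop :=
  ∀ c ∈ C, d c ∈ A → ∃ e ∈ C, c - d e ∈ A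

/-- The classes of the relative cycles `z i` form a basis of the homology of `C` relative
to `A`. -/
structure RelBasis {ι : Type*} (C A : Submodule R M) (z : ι → M) : Prop where
  mem : ∀ i, z i ∈ C
  d_mem : ∀ i, d (z i) ∈ A
  span : ∀ c ∈ C, d c ∈ A → ∃ r : ι →₀ R, ∃ e ∈ C, c - Finsupp.linearCombination R z r - d e ∈ A
  indep : ∀ (r : ι →₀ R), ∀ e ∈ C, Finsupp.linearCombination R z r - d e ∈ A → r = 0

variable {d} {ι : Type*} {A B C D : Submodule R M} {z z' : ι → M}

lemma linearCombination_mem_of_forall (h : ∀ i, z i ∈ C) (r : ι →₀ R) :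
    Finsupp.linearCombination R z r ∈ C := by
  rw [Finsupp.linearCombination_apply]
  exact C.sum_mem fun i _ => C.smul_mem _ (h i)

lemma d_linearCombination_mem (h : ∀ i, d (z i) ∈ C) (r : ι →₀ R) :
    d (Finsupp.linearCombination R z r) ∈ C := by
  rw [Finsupp.linearCombination_apply, Finsupp.sum, map_sum]
  exact C.sum_mem fun i _ => by rw [map_smul]; exact C.smul_mem _ (h i)

lemma linearCombination_sub_mem (h : ∀ i, z i - z' i ∈ C) (r : ι →₀ R) :
    Finsupp.linearCombination R z r - Finsupp.linearCombination R z' r ∈ C := by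
  rw [Finsupp.linearCombination_apply, Finsupp.linearCombination_apply, Finsupp.sum, Finsupp.sum,
    ← Finset.sum_sub_distrib]
  exact C.sum_mem fun i _ => by rw [← smul_sub]; exact C.smul_mem _ (h i)

/-- Enlarging the total complex by an acyclic pair. -/
lemma RelBasis.enlarge_top (h : RelBasis d B A z) (hAB : A ≤ B) (hBC : B ≤ C)
    (hac : RelAcyclic d C B) (hdd : ∀ x, d (d x) = 0) :
    RelBasis d C A z where
  mem i := hBC (h.mem i)
  d_mem := h.d_mem
  span c hc hdc := by
    obtain ⟨e, he, hce⟩ := hac c hc (hAB hdc)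
    obtain ⟨r, e', he', h'⟩ := h.span _ hce (by rwa [map_sub, hdd, sub_zero])
    exact ⟨r, e + e', C.add_mem he (hBC he'), by
      convert h' using 1; rw [map_add]; abel⟩
  indep r e he hre := by
    have hl := linearCombination_mem_of_forall h.mem r
    have hde : d e ∈ B := by
      have := B.sub_mem hl (hAB hre)
      rwa [sub_sub_cancel] at this
    obtain ⟨f, hf, hef⟩ := hac e he hde
    refine h.indep r _ hef ?_
    rwa [map_sub, hdd, sub_zero]

/-- Shrinking the bottom complex by an acyclic pair. -/
lemma RelBasis.shrink_bot (h : RelBasis d C B z) (hBC : B ≤ C)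
    (hac : RelAcyclic d B A) (hAB : A ≤ B) (hdd : ∀ x, d (d x) = 0) (hmem : ∀ i, z' i ∈ C)
    (hdmem : ∀ i, d (z' i) ∈ A) (hz : ∀ i, z i - z' i ∈ B) : RelBasis d C A z' where
  mem := hmem
  d_mem := hdmem
  span c hc hdc := by
    obtain ⟨r, e, he, h'⟩ := h.span c hc (hAB hdc)
    have h1 : c - Finsupp.linearCombination R z' r - d e ∈ B := by
      have := B.add_mem h' (linearCombination_sub_mem hz r)
      convert this using 1
      abel
    obtain ⟨f, hf, hf'⟩ := hac _ h1 (by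
      rw [map_sub, map_sub, hdd, sub_zero]
      exact A.sub_mem hdc (d_linearCombination_mem hdmem r))
    exact ⟨r, e + f, C.add_mem he (hBC hf), by convert hf' using 1; rw [map_add]; abel⟩
  indep r e he hre := by
    refine h.indep r e he ?_
    have := B.add_mem (hAB hre) (linearCombination_sub_mem hz r)
    convert this using 1
    abel

/-- The connecting homomorphism of a triple is an isomorphism if the large pair is acyclic. -/
lemma RelBasis.of_boundary {y : ι → M} (h : RelBasis d B A y) (hBC : B ≤ C) (hAB : A ≤ B)
    (hac : RelAcyclic d C A) (hdd : ∀ x, d (d x) = 0)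
    (hmem : ∀ i, z i ∈ C) (hz : ∀ i, y i - d (z i) ∈ A) : RelBasis d C B z where
  mem := hmem
  d_mem i := by
    have := B.sub_mem (h.mem i) (hAB (hz i))
    rwa [sub_sub_cancel] at this
  span c hc hdc := by
    -- The boundary of `c` is a cycle of `B` modulo `A`, so it is expanded in the `y i`. Removing
    -- the same combination of the `z i`, together with `e`, leaves a cycle of `C` modulo `A`, which
    -- acyclicity kills.
    obtain ⟨r, e, he, h'⟩ := h.span (d c) hdc (by rw [hdd]; exact A.zero_mem)
    have h1 : d (c - Finsupp.linearCombination R z r - e) ∈ A := by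
      have := A.add_mem h' (linearCombination_sub_mem (z := y) (z' := d ∘ z) hz r)
      convert this using 1
      rw [map_sub, map_sub, Finsupp.apply_linearCombination]
      abel
    obtain ⟨f, hf, hf'⟩ := hac _ (C.sub_mem (C.sub_mem hc
      (linearCombination_mem_of_forall hmem r)) (hBC he)) h1
    refine ⟨r, f, hf, ?_⟩
    have := B.add_mem (hAB hf') he
    convert this using 1
    abel
  indep r e he hre := by
    -- A relation among the `z i` modulo `B` supplies a chain of `B` whose boundary is the same
    -- combination of the `y i`, modulo `A`.
    refine h.indep r (Finsupp.linearCombination R z r - d e) hre ?_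
    rw [map_sub, hdd, sub_zero, Finsupp.apply_linearCombination]
    exact linearCombination_sub_mem (z := y) (z' := d ∘ z) hz r

/-- Excision for a family of subcomplexes which are independent modulo `D`. -/
lemma RelBasis.iSup_sup {X : ι → Submodule R M}
    (h : ∀ i, RelBasis d (X i) (X i ⊓ D) (fun _ : Unit => z i))
    (hX : ∀ i, X i ≤ (X i).comap d) (hD : D ≤ D.comap d)
    (hind : ∀ c : ι → M, ∀ s : Finset ι, (∀ i, c i ∈ X i) → ∑ i ∈ s, c i ∈ D → ∀ i ∈ s, c i ∈ D) :
    RelBasis d ((⨆ i, X i) ⊔ D) D z where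
  mem i := Submodule.mem_sup_left (Submodule.mem_iSup_of_mem i ((h i).mem ()))
  d_mem i := ((h i).d_mem ()).2
  span c hc hdc := by
    obtain ⟨x, hx, y, hy, rfl⟩ := Submodule.mem_sup.1 hc
    obtain ⟨f, hf, rfl⟩ := (Submodule.mem_iSup_iff_exists_finsupp _ _).1 hx
    have h1 : ∑ i ∈ f.support, d (f i) ∈ D := by
      have := D.sub_mem hdc (hD hy)
      rwa [map_add, add_sub_cancel_right, Finsupp.sum, map_sum] at this
    -- Independence modulo `D` turns the condition on the sum of the boundaries into one for each
    -- index, so the problem splits over the family.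
    have h2 := hind _ _ (fun i => hX i (hf i)) h1
    have h3 : ∀ i, d (f i) ∈ X i ⊓ D := fun i => by
      refine ⟨hX i (hf i), ?_⟩
      by_cases hi : i ∈ f.support
      · exact h2 i hi
      · rw [Finsupp.notMem_support_iff.1 hi, map_zero]
        exact D.zero_mem
    have h4 : ∀ i, ∃ r : R, ∃ e ∈ X i, f i - r • z i - d e ∈ D := fun i => by
      obtain ⟨r, e, he, h'⟩ := (h i).span (f i) (hf i) (h3 i)
      refine ⟨r (), e, he, ?_⟩
      rw [Finsupp.linearCombination_unique] at h'
      exact h'.2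
    choose r e he h' using h4
    refine ⟨∑ i ∈ f.support, Finsupp.single i (r i), ∑ i ∈ f.support, e i,
      Submodule.mem_sup_left (Submodule.sum_mem _ fun i _ => Submodule.mem_iSup_of_mem i (he i)),
      ?_⟩
    have := D.add_mem (D.sum_mem (t := f.support) fun i _ => h' i) hy
    convert this using 1
    simp only [Finset.sum_sub_distrib, map_sum, Finsupp.linearCombination_single, Finsupp.sum]
    abel
  indep r e he hre := by
    classical
    obtain ⟨x, hx, y, hy, rfl⟩ := Submodule.mem_sup.1 he
    obtain ⟨f, hf, rfl⟩ := (Submodule.mem_iSup_iff_exists_finsupp _ _).1 hx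
    let s := r.support ∪ f.support
    have h1 : ∑ i ∈ s, (r i • z i - d (f i)) ∈ D := by
      have := D.add_mem hre (hD hy)
      convert this using 1
      rw [map_add, Finset.sum_sub_distrib, Finsupp.linearCombination_apply,
        Finsupp.sum_of_support_subset r (s := s) Finset.subset_union_left _ (by simp),
        Finsupp.sum_of_support_subset f (s := s) Finset.subset_union_right _ (by simp), map_sum]
      abel
    have h2 : ∀ i, r i • z i - d (f i) ∈ X i := fun i =>
      (X i).sub_mem ((X i).smul_mem _ ((h i).mem ())) (hX i (hf i))
    have h3 := hind _ _ h2 h1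
    ext i
    by_cases hi : i ∈ s
    · have := (h i).indep (Finsupp.single () (r i)) (f i) (hf i) (by
        rw [Finsupp.linearCombination_single]
        exact ⟨h2 i, h3 i hi⟩)
      simpa using this
    · simp only [s, Finset.mem_union, not_or] at hi
      simpa using hi.1

lemma Submodule.map_mem_map_iff {M' : Type*} [AddCommGroup M'] [Module R M'] {f : M →ₗ[R] M'}
    (hf : Function.Injective f) {x : M} : f x ∈ A.map f ↔ x ∈ A :=
  ⟨fun ⟨_, hy, e⟩ => hf e ▸ hy, Submodule.mem_map_of_mem⟩

lemma RelBasis.map {M' : Type*} [AddCommGroup M'] [Module R M'] {d' : M' →ₗ[R] M'}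
    (h : RelBasis d C A z) (f : M →ₗ[R] M') (hf : Function.Injective f)
    (hd : ∀ x, f (d x) = d' (f x)) :
    RelBasis d' (C.map f) (A.map f) (f ∘ z) where
  mem i := Submodule.mem_map_of_mem (h.mem i)
  d_mem i := by
    rw [Function.comp_apply, ← hd]
    exact Submodule.mem_map_of_mem (h.d_mem i)
  span := by
    rintro _ ⟨c, hc, rfl⟩ hdc
    rw [← hd, Submodule.map_mem_map_iff hf] at hdc
    obtain ⟨r, e, he, h'⟩ := h.span c hc hdc
    refine ⟨r, f e, Submodule.mem_map_of_mem he, ?_⟩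
    rw [← Finsupp.apply_linearCombination, ← hd, ← map_sub, ← map_sub]
    exact Submodule.mem_map_of_mem h'
  indep := by
    rintro r _ ⟨e, he, rfl⟩ hre
    rw [← Finsupp.apply_linearCombination, ← hd, ← map_sub,
      Submodule.map_mem_map_iff hf] at hre
    exact h.indep r e he hre

/-- Transport of a basis of homology along a deformation retract. -/
lemma RelBasis.of_retract {M' : Type*} [AddCommGroup M'] [Module R M'] {d' : M' →ₗ[R] M'}
    {C' : Submodule R M'} (h : RelBasis d C ⊥ z) (f : M →ₗ[R] M') (g : M' →ₗ[R] M)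
    (P : M' →ₗ[R] M') (hf : ∀ x, f (d x) = d' (f x)) (hg : ∀ x, g (d' x) = d (g x))
    (hgf : ∀ x ∈ C, g (f x) = x) (hP : ∀ x, d' (P x) + P (d' x) = x - f (g x))
    (hfC : C ≤ C'.comap f) (hgC : C' ≤ C.comap g) (hPC : C' ≤ C'.comap P) :
    RelBasis d' C' ⊥ (f ∘ z) where
  mem i := hfC (h.mem i)
  d_mem i := by
    have := h.d_mem i
    rw [Submodule.mem_bot] at this
    rw [Function.comp_apply, ← hf, this, map_zero]
    exact Submodule.zero_mem _
  span c hc hdc := by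
    rw [Submodule.mem_bot] at hdc
    obtain ⟨r, e, he, h'⟩ := h.span (g c) (hgC hc) (by rw [← hg, hdc, map_zero]; exact zero_mem _)
    -- `g c` is resolved in the retract and the result transported back by `f`; the homotopy term `P
    -- c` accounts for the difference between `c` and `f (g c)`.
    refine ⟨r, f e + P c, C'.add_mem (hfC he) (hPC hc), ?_⟩
    rw [Submodule.mem_bot] at h' ⊢
    have h1 := congrArg f h'
    have h2 := hP c
    rw [hdc, map_zero, add_zero] at h2
    rw [map_sub, map_sub, map_zero, hf, Finsupp.apply_linearCombination] at h1
    rw [map_add, h2, ← h1]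
    abel
  indep r e he hre := by
    refine h.indep r (g e) (hgC he) ?_
    rw [Submodule.mem_bot] at hre ⊢
    rw [← hg, sub_eq_zero, ← sub_eq_zero.1 hre, ← Finsupp.apply_linearCombination,
      hgf _ (linearCombination_mem_of_forall h.mem r)]

end DifferentialModule
end

/-! ### Affine simplices, indexed by their number of vertices. -/

noncomputable section

/-- The standard topological simplex with `n` vertices. -/
abbrev TopSimplex (n : ℕ) : Type := stdSimplex ℝ (Fin n)

/-- The affine map of simplices with prescribed images of the vertices. -/
def TopSimplex.comb {m n : ℕ} (v : Fin m → TopSimplex n) : C(TopSimplex m, TopSimplex n) where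
  toFun t := ⟨∑ i, t.1 i • (v i).1, (convex_stdSimplex ℝ (Fin n)).sum_mem
    (fun i _ => t.2.1 i) t.2.2 fun i _ => (v i).2⟩
  continuous_toFun := by
    refine Continuous.subtype_mk ?_ _
    refine continuous_finsetSum _ fun i _ => ?_
    exact ((continuous_apply i).comp continuous_subtype_val).smul continuous_const

lemma TopSimplex.comb_coe {m n : ℕ} (v : Fin m → TopSimplex n) (t : TopSimplex m) :
    (TopSimplex.comb v t).1 = ∑ i, t.1 i • (v i).1 := rfl

/-- Spaces in which affine simplices with given vertices make sense. -/
class HasAffineSimplices (K : Type*) [TopologicalSpace K] where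
  /-- The affine simplex with given vertices. -/
  comb {m : ℕ} (v : Fin m → K) : C(TopSimplex m, K)
  comb_vertex {m : ℕ} (v : Fin m → K) (i : Fin m) : comb v (stdSimplex.vertex i) = v i
  comb_comb {l m : ℕ} (v : Fin m → K) (w : Fin l → TopSimplex m) :
    (comb v).comp (TopSimplex.comb w) = comb (comb v ∘ w)

open HasAffineSimplices

instance (n : ℕ) : HasAffineSimplices (TopSimplex n) where
  comb := TopSimplex.comb
  comb_vertex v i := by
    apply Subtype.ext
    rw [TopSimplex.comb_coe]
    simp [Pi.single_apply, ite_smul]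
  comb_comb v w := by
    refine ContinuousMap.ext fun t => Subtype.ext (funext fun j => ?_)
    change (TopSimplex.comb v (TopSimplex.comb w t)).1 j = (TopSimplex.comb (_ ∘ w) t).1 j
    simp only [TopSimplex.comb_coe, Function.comp_apply, Finset.sum_apply, Pi.smul_apply,
      smul_eq_mul, Finset.sum_mul, Finset.mul_sum, mul_assoc]
    exact Finset.sum_comm

instance : HasAffineSimplices unitInterval where
  comb v :=
    { toFun := fun t => ⟨∑ i, t.1 i • (v i).1, (convex_Icc (0 : ℝ) 1).sum_mem
        (fun i _ => t.2.1 i) t.2.2 fun i _ => (v i).2⟩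
      continuous_toFun := by
        refine Continuous.subtype_mk ?_ _
        refine continuous_finsetSum _ fun i _ => ?_
        exact ((continuous_apply i).comp continuous_subtype_val).smul continuous_const }
  comb_vertex v i := by
    apply Subtype.ext
    simp [stdSimplex.vertex, Pi.single_apply]
  comb_comb v w := by
    ext t : 2
    simp only [ContinuousMap.comp_apply, TopSimplex.comb_coe, Function.comp_apply,
      ContinuousMap.coe_mk, Finset.sum_apply, Pi.smul_apply, Finset.sum_smul, Finset.smul_sum,
      smul_assoc]
    exact Finset.sum_comm

instance {K L : Type*} [TopologicalSpace K] [TopologicalSpace L] [HasAffineSimplices K]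
    [HasAffineSimplices L] : HasAffineSimplices (K × L) where
  comb v := (comb (Prod.fst ∘ v)).prodMk (comb (Prod.snd ∘ v))
  comb_vertex v i := by simp [comb_vertex]
  comb_comb v w := by
    have h1 := comb_comb (Prod.fst ∘ v) w
    have h2 := comb_comb (Prod.snd ∘ v) w
    refine ContinuousMap.ext fun t => Prod.ext ?_ ?_
    · exact congrArg (fun f => f t) h1
    · exact congrArg (fun f => f t) h2

lemma comb_vertices (n : ℕ) :
    comb (fun i : Fin n => (stdSimplex.vertex i : TopSimplex n)) = ContinuousMap.id _ := by
  ext t j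
  change (TopSimplex.comb _ t).1 j = t.1 j
  rw [TopSimplex.comb_coe]
  simp [Finset.sum_apply, Pi.single_apply]

/-- A singular simplex, with arbitrary number of vertices. -/
abbrev SingularSimplex (X : Type w) [TopologicalSpace X] : Type w := Σ n : ℕ, C(TopSimplex n, X)

/-- The total module of augmented singular chains. -/
abbrev SingularChain (R : Type v) [CommRing R] (X : Type w) [TopologicalSpace X] : Type (max v w) :=
  SingularSimplex X →₀ R

/-- The composition of a singular simplex with a continuous map. -/
def SingularSimplex.map {X Y : Type*} [TopologicalSpace X] [TopologicalSpace Y] (f : C(X, Y))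
    (s : SingularSimplex X) : SingularSimplex Y := ⟨s.1, f.comp s.2⟩

/-! ### Formal affine chains: lists of vertices, cones and boundaries. -/

section ListChains

variable (R : Type v) [CommRing R] {E F : Type*}

/-- Cone operator on formal affine chains. -/
def listCone (a : E) : (List E →₀ R) →ₗ[R] (List E →₀ R) := Finsupp.lmapDomain R R (List.cons a)

/-- Functoriality of formal affine chains. -/
def listMap (f : E → F) : (List E →₀ R) →ₗ[R] (List F →₀ R) :=
  Finsupp.lmapDomain R R (List.map f)

/-- The boundary of a list of vertices. -/
def listBdAux : List E → (List E →₀ R)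
  | [] => 0
  | a :: l => Finsupp.single l 1 - listCone R a (listBdAux l)

/-- The boundary operator on formal affine chains. -/
def listBd : (List E →₀ R) →ₗ[R] (List E →₀ R) := Finsupp.linearCombination R (listBdAux R)

@[simp] lemma listCone_single (a : E) (l : List E) (r : R) :
    listCone R a (Finsupp.single l r) = Finsupp.single (a :: l) r := by
  simp [listCone]

@[simp] lemma listMap_single (f : E → F) (l : List E) (r : R) :
    listMap R f (Finsupp.single l r) = Finsupp.single (l.map f) r := by
  simp [listMap]

@[simp] lemma listBd_nil : listBd R (Finsupp.single ([] : List E) 1) = 0 := by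
  simp [listBd, listBdAux]

@[simp] lemma listBd_cons (a : E) (l : List E) :
    listBd R (Finsupp.single (a :: l) 1) =
      Finsupp.single l 1 - listCone R a (listBd R (Finsupp.single l 1)) := by
  simp [listBd, listBdAux]

/-- Coning is a contracting homotopy. The empty list is a chain, so there is no exceptional low
degree. The chain homotopies for subdivision and the contraction over a point rest on this identity.
-/
lemma listBd_listCone (a : E) (x : List E →₀ R) :
    listBd R (listCone R a x) = x - listCone R a (listBd R x) := by
  suffices listBd R ∘ₗ listCone R a = LinearMap.id - listCone R a ∘ₗ listBd R from
    LinearMap.congr_fun this x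
  ext1 l
  ext1
  simp

lemma listMap_listCone (f : E → F) (a : E) (x : List E →₀ R) :
    listMap R f (listCone R a x) = listCone R (f a) (listMap R f x) := by
  suffices listMap R f ∘ₗ listCone R a = listCone R (f a) ∘ₗ listMap R f from
    LinearMap.congr_fun this x
  ext1 l
  ext1
  simp

lemma listMap_listBd (f : E → F) (x : List E →₀ R) :
    listMap R f (listBd R x) = listBd R (listMap R f x) := by
  suffices listMap R f ∘ₗ listBd R = listBd R ∘ₗ listMap R f from LinearMap.congr_fun this x
  ext1 l
  ext1
  induction l with
  | nil => simp
  | cons a l ih =>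
    simp at ih
    simp [listMap_listCone, ih]

lemma listBd_listBd (x : List E →₀ R) : listBd R (listBd R x) = 0 := by
  suffices listBd R ∘ₗ listBd R = (0 : (List E →₀ R) →ₗ[R] (List E →₀ R)) from
    LinearMap.congr_fun this x
  ext1 l
  ext1
  induction l with
  | nil => simp
  | cons a l ih =>
    simp at ih
    simp [listBd_listCone, ih]

variable (E) in
/-- Formal affine chains on `n` vertices. -/
def listDeg (n : ℕ) : Submodule R (List E →₀ R) := Finsupp.supported R R {l | l.length = n}

lemma single_mem_listDeg (l : List E) (r : R) : Finsupp.single l r ∈ listDeg R E l.length :=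
  Finsupp.single_mem_supported R r rfl

lemma listCone_mem_listDeg (a : E) {n : ℕ} {x : List E →₀ R} (hx : x ∈ listDeg R E n) :
    listCone R a x ∈ listDeg R E (n + 1) := by
  suffices listDeg R E n ≤ (listDeg R E (n + 1)).comap (listCone R a) from this hx
  rw [listDeg, Finsupp.supported_eq_span_single, Submodule.span_le]
  rintro _ ⟨l, hl, rfl⟩
  simp only [Set.mem_ofPred_eq] at hl
  simp only [SetLike.mem_coe, Submodule.mem_comap, listCone_single]
  rw [← hl]
  exact single_mem_listDeg R (a :: l) 1

lemma listBd_single_mem_listDeg (l : List E) :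
    listBd R (Finsupp.single l 1) ∈ listDeg R E (l.length - 1) := by
  induction l with
  | nil => simp
  | cons a l ih =>
    rw [listBd_cons]
    refine Submodule.sub_mem _ (single_mem_listDeg R l 1) ?_
    -- For `l = []` the degree `l.length - 1` is truncated to 0, but the boundary of `[]` vanishes,
    -- so only nonempty `l` needs the cone estimate.
    cases l with
    | nil => simp
    | cons b l => exact listCone_mem_listDeg R a ih

/-- Linear operators on formal affine chains defined by recursion on the number of vertices,
by coning off the value on the boundary. -/
def coneRecAux (b : E → List E → E) (γ : (List E →₀ R) →ₗ[R] (List E →₀ R))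
    (ε : List E →₀ R) (c : R) : ℕ → List E → (List E →₀ R)
  | 0, _ => ε
  | _ + 1, [] => ε
  | k + 1, a :: l => listCone R (b a l) (γ (Finsupp.single (a :: l) 1) + c •
      Finsupp.linearCombination R (coneRecAux b γ ε c k) (listBd R (Finsupp.single (a :: l) 1)))

/-- Linear operators on formal affine chains defined by recursion on the number of vertices,
by coning off the value on the boundary. -/
def coneRec (b : E → List E → E) (γ : (List E →₀ R) →ₗ[R] (List E →₀ R))
    (ε : List E →₀ R) (c : R) : (List E →₀ R) →ₗ[R] (List E →₀ R) :=
  Finsupp.linearCombination R fun l => coneRecAux R b γ ε c l.length l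

variable (b : E → List E → E) (γ : (List E →₀ R) →ₗ[R] (List E →₀ R)) (ε : List E →₀ R) (c : R)

@[simp] lemma coneRec_nil : coneRec R b γ ε c (Finsupp.single [] 1) = ε := by
  simp [coneRec, coneRecAux]

/-- The recursion counter of `coneRecAux` starts at the length of the list, and the boundary is
supported on lists one shorter. The counter therefore always equals the length and disappears from
the recursion formula. Barycentric subdivision and its homotopy to the identity are both instances.
-/
lemma coneRec_cons (a : E) (l : List E) : coneRec R b γ ε c (Finsupp.single (a :: l) 1) =
    listCone R (b a l) (γ (Finsupp.single (a :: l) 1) +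
      c • coneRec R b γ ε c (listBd R (Finsupp.single (a :: l) 1))) := by
  have key : ∀ n, ∀ x ∈ listDeg R E n,
      Finsupp.linearCombination R (coneRecAux R b γ ε c n) x = coneRec R b γ ε c x := by
    intro n x hx
    rw [coneRec, Finsupp.linearCombination_apply, Finsupp.linearCombination_apply]
    refine Finsupp.sum_congr fun l hl => ?_
    have : l.length = n := (Finsupp.mem_supported R x).1 hx hl
    rw [this]
  rw [← key _ _ (listBd_single_mem_listDeg R (a :: l))]
  conv_lhs => rw [coneRec, Finsupp.linearCombination_single, one_smul]
  rfl

lemma list_induction {P : List E → Prop} (h : ∀ l : List E, (∀ l' : List E,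
    l'.length < l.length → P l') → P l) (l : List E) : P l := by
  induction hn : l.length using Nat.strong_induction_on generalizing l with
  | _ n ih => exact h l fun l' hl' => ih l'.length (hn ▸ hl') l' rfl

/-- Two linear maps agreeing on the lists with `n` vertices agree on all chains on `n`
vertices. -/
lemma eq_of_mem_listDeg {M : Type*} [AddCommGroup M] [Module R M] {n : ℕ}
    (f g : (List E →₀ R) →ₗ[R] M)
    (h : ∀ l : List E, l.length = n → f (Finsupp.single l 1) = g (Finsupp.single l 1))
    {x : List E →₀ R} (hx : x ∈ listDeg R E n) : f x = g x := by
  suffices listDeg R E n ≤ LinearMap.eqLocus f g from this hx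
  rw [listDeg, Finsupp.supported_eq_span_single, Submodule.span_le]
  rintro _ ⟨l, hl, rfl⟩
  exact h l hl

lemma listMap_coneRec {b' : F → List F → F} {γ' : (List F →₀ R) →ₗ[R] (List F →₀ R)}
    {ε' : List F →₀ R} (f : E → F) (hb : ∀ a l, f (b a l) = b' (f a) (l.map f))
    (hγ : ∀ x, listMap R f (γ x) = γ' (listMap R f x)) (hε : listMap R f ε = ε')
    (x : List E →₀ R) :
    listMap R f (coneRec R b γ ε c x) = coneRec R b' γ' ε' c (listMap R f x) := by
  suffices listMap R f ∘ₗ coneRec R b γ ε c = coneRec R b' γ' ε' c ∘ₗ listMap R f from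
    LinearMap.congr_fun this x
  ext1 l
  ext1
  induction l using list_induction with
  | _ l ih =>
    cases l with
    | nil => simp [hε]
    | cons a l =>
      have h1 := eq_of_mem_listDeg R (n := l.length) (listMap R f ∘ₗ coneRec R b γ ε c)
        (coneRec R b' γ' ε' c ∘ₗ listMap R f)
        (fun l' hl' => by simpa using ih l' (by simp [hl'])) (listBd_single_mem_listDeg R (a :: l))
      simp only [LinearMap.comp_apply, Finsupp.lsingle_apply] at h1 ⊢
      rw [coneRec_cons, listMap_listCone, map_add, map_smul, h1, hγ, hb, listMap_listBd,
        listMap_single, List.map_cons, coneRec_cons]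

/-- The cone construction turns a chain map vanishing on the empty list into a null homotopy. -/
lemma listBd_coneRec_of_chain (hγ : ∀ x, listBd R (γ x) = γ (listBd R x))
    (hγ0 : γ (Finsupp.single [] 1) = 0) (x : List E →₀ R) :
    listBd R (coneRec R b γ 0 (-1) x) + coneRec R b γ 0 (-1) (listBd R x) = γ x := by
  suffices listBd R ∘ₗ coneRec R b γ 0 (-1) + coneRec R b γ 0 (-1) ∘ₗ listBd R = γ from
    LinearMap.congr_fun this x
  ext1 l
  ext1
  induction l using list_induction with
  | _ l ih =>
    cases l with
    | nil => simp [hγ0]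
    | cons a l =>
      -- On the boundary of the list the homotopy formula is known by induction, and `d² = 0`
      -- removes one of its terms. So `γ` minus the homotopy of the boundary is a cycle, and the
      -- boundary of its cone is that cycle.
      have h1 := eq_of_mem_listDeg R (n := l.length)
        (listBd R ∘ₗ coneRec R b γ 0 (-1) + coneRec R b γ 0 (-1) ∘ₗ listBd R) γ
        (fun l' hl' => by simpa using ih l' (by simp [hl'])) (listBd_single_mem_listDeg R (a :: l))
      simp only [LinearMap.comp_apply, Finsupp.lsingle_apply, LinearMap.add_apply,
        listBd_listBd, map_zero, add_zero] at h1 ⊢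
      rw [coneRec_cons, listBd_listCone]
      rw [map_add, map_smul, hγ, h1]
      simp only [neg_smul, one_smul, add_neg_cancel, map_zero, sub_zero, neg_add_cancel_right]

end ListChains
end

noncomputable section
open HasAffineSimplices

/-! ### Singular chains and natural operators on them. -/

section Singular

variable (R : Type v) [CommRing R] {K X Y Z : Type*} [TopologicalSpace K] [HasAffineSimplices K]
  [TopologicalSpace X] [TopologicalSpace Y] [TopologicalSpace Z]

/-- The affine singular simplex with a given list of vertices. -/
def listSimp (l : List K) : SingularSimplex K := ⟨l.length, comb l.get⟩

/-- Passing through `List.equivSigmaTuple` avoids a cast along the equality of `(List.ofFn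
v).length` with `m`. -/
lemma listSimp_ofFn {m : ℕ} (v : Fin m → K) : listSimp (List.ofFn v) = ⟨m, comb v⟩ := by
  have h : ∀ p : Σ n, Fin n → K,
      listSimp (List.equivSigmaTuple.symm p) = ⟨p.1, comb p.2⟩ := fun p => by
    obtain ⟨l, rfl⟩ := List.equivSigmaTuple.surjective p
    rw [Equiv.symm_apply_apply]
    rfl
  exact h ⟨m, v⟩

/-- The list of vertices of the standard simplex. -/
def stdVertices (n : ℕ) : List (TopSimplex n) := List.ofFn fun i => stdSimplex.vertex i

lemma listSimp_stdVertices (n : ℕ) :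
    listSimp (stdVertices n) = ⟨n, ContinuousMap.id (TopSimplex n)⟩ := by
  rw [stdVertices, listSimp_ofFn, comb_vertices]

lemma map_stdVertices {m : ℕ} (v : Fin m → K) : (stdVertices m).map (comb v) = List.ofFn v := by
  rw [stdVertices, List.map_ofFn]
  congr 1
  funext i
  exact comb_vertex v i

lemma map_listSimp {m : ℕ} (v : Fin m → K) (l : List (TopSimplex m)) :
    (listSimp l).map (comb v) = listSimp (l.map (comb v)) := by
  obtain ⟨⟨n, w⟩, rfl⟩ := List.equivSigmaTuple.symm.surjective l
  change (listSimp (List.ofFn w)).map (comb v) = listSimp ((List.ofFn w).map (comb v))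
  rw [List.map_ofFn, listSimp_ofFn, listSimp_ofFn, ← comb_comb]
  rfl

/-- The singular chain defined by a formal affine chain. -/
def realize : (List K →₀ R) →ₗ[R] SingularChain R K := Finsupp.lmapDomain R R listSimp

/-- The map of singular chains induced by a continuous map. -/
def push (f : C(X, Y)) : SingularChain R X →ₗ[R] SingularChain R Y :=
  Finsupp.lmapDomain R R (SingularSimplex.map f)

@[simp] lemma realize_single (l : List K) (r : R) :
    realize R (Finsupp.single l r) = Finsupp.single (listSimp l) r := by
  simp [realize]

@[simp] lemma push_single (f : C(X, Y)) (s : SingularSimplex X) (r : R) :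
    push R f (Finsupp.single s r) = Finsupp.single (s.map f) r := by
  simp [push]

lemma push_push (g : C(Y, Z)) (f : C(X, Y)) (x : SingularChain R X) :
    push R g (push R f x) = push R (g.comp f) x := by
  suffices push R g ∘ₗ push R f = push R (g.comp f) from LinearMap.congr_fun this x
  ext1 s
  ext1
  simp
  rfl

lemma push_id (x : SingularChain R X) : push R (ContinuousMap.id X) x = x := by
  suffices push R (ContinuousMap.id X) = LinearMap.id from LinearMap.congr_fun this x
  ext1 s
  ext1
  simp
  rfl

lemma push_injective {f : C(X, Y)} (hf : Function.Injective f) :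
    Function.Injective (push R f) := by
  refine Finsupp.mapDomain_injective ?_
  rintro ⟨n, σ⟩ ⟨m, τ⟩ h
  obtain rfl : n = m := congrArg Sigma.fst h
  have h2 : f.comp σ = f.comp τ := eq_of_heq (Sigma.mk.inj h).2
  congr 1
  ext t
  exact hf (congrArg (fun k => k t) h2)

lemma push_realize {m : ℕ} (v : Fin m → K) (x : List (TopSimplex m) →₀ R) :
    push R (comb v) (realize R x) = realize R (listMap R (comb v) x) := by
  suffices push R (comb v) ∘ₗ realize R = realize R ∘ₗ listMap R (comb v) from
    LinearMap.congr_fun this x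
  ext1 l
  ext1
  simp [map_listSimp]

/-- The operator on singular chains defined by operators on the formal affine chains of
the standard simplices. -/
def singOp (θ : ∀ n, (List (TopSimplex n) →₀ R) →ₗ[R] (List (TopSimplex n) →₀ R)) :
    SingularChain R X →ₗ[R] SingularChain R X :=
  Finsupp.linearCombination R fun s =>
    push R s.2 (realize R (θ s.1 (Finsupp.single (stdVertices s.1) 1)))

/-- Naturality of operators on formal affine chains with respect to affine maps of simplices. -/
def IsNaturalListOp (θ : ∀ n, (List (TopSimplex n) →₀ R) →ₗ[R] (List (TopSimplex n) →₀ R)) :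
    Prop :=
  ∀ (m n : ℕ) (v : Fin m → TopSimplex n) (x : List (TopSimplex m) →₀ R),
    listMap R (comb v) (θ m x) = θ n (listMap R (comb v) x)

variable {R} {θ φ : ∀ n, (List (TopSimplex n) →₀ R) →ₗ[R] (List (TopSimplex n) →₀ R)}

lemma singOp_single (s : SingularSimplex X) : singOp R θ (Finsupp.single s 1) =
    push R s.2 (realize R (θ s.1 (Finsupp.single (stdVertices s.1) 1))) := by
  simp [singOp]

lemma push_singOp (f : C(X, Y)) (x : SingularChain R X) :
    push R f (singOp R θ x) = singOp R θ (push R f x) := by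
  suffices push R f ∘ₗ singOp R θ = singOp R θ ∘ₗ push R f from LinearMap.congr_fun this x
  ext1 s
  ext1
  simp only [LinearMap.comp_apply, Finsupp.lsingle_apply, singOp_single, push_push, push_single]
  rfl

/-- An affine simplex is the image of the standard one under `comb`, so naturality lets the operator
be computed directly on its list of vertices. -/
lemma singOp_realize {θK : (List K →₀ R) →ₗ[R] (List K →₀ R)}
    (h : ∀ (m : ℕ) (v : Fin m → K) (x : List (TopSimplex m) →₀ R),
      listMap R (comb v) (θ m x) = θK (listMap R (comb v) x)) (x : List K →₀ R) :
    singOp R θ (realize R x) = realize R (θK x) := by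
  suffices singOp R θ ∘ₗ realize R = realize R ∘ₗ θK from LinearMap.congr_fun this x
  ext1 l
  ext1
  obtain ⟨⟨n, w⟩, rfl⟩ := List.equivSigmaTuple.symm.surjective l
  change singOp R θ (realize R (Finsupp.single (List.ofFn w) 1)) =
    realize R (θK (Finsupp.single (List.ofFn w) 1))
  rw [realize_single, listSimp_ofFn, singOp_single, push_realize, h, listMap_single,
    map_stdVertices]

/-- This transfers identities between natural operators, such as `d² = 0` and the subdivision
homotopy, from lists of vertices to singular chains. -/
lemma singOp_comp (hθ : IsNaturalListOp R θ) (x : SingularChain R X) :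
    singOp R θ (singOp R φ x) = singOp R (fun n => θ n ∘ₗ φ n) x := by
  suffices singOp R θ ∘ₗ singOp R φ = singOp R (fun n => θ n ∘ₗ φ n) from
    LinearMap.congr_fun this x
  ext1 s
  ext1
  simp only [LinearMap.comp_apply, Finsupp.lsingle_apply, singOp_single]
  rw [← push_singOp, singOp_realize (fun m v x => hθ m s.1 v x)]

lemma singOp_add (x : SingularChain R X) :
    singOp R (fun n => θ n + φ n) x = singOp R θ x + singOp R φ x := by
  suffices singOp R (fun n => θ n + φ n) = singOp R θ + singOp R φ from
    LinearMap.congr_fun this x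
  ext1 s
  ext1
  simp [singOp_single]

lemma singOp_sub (x : SingularChain R X) :
    singOp R (fun n => θ n - φ n) x = singOp R θ x - singOp R φ x := by
  suffices singOp R (fun n => θ n - φ n) = singOp R θ - singOp R φ from
    LinearMap.congr_fun this x
  ext1 s
  ext1
  simp [singOp_single]

lemma singOp_id (x : SingularChain R X) : singOp R (fun _ => LinearMap.id) x = x := by
  suffices singOp R (fun _ => LinearMap.id) = LinearMap.id from LinearMap.congr_fun this x
  ext1 s
  ext1
  simp only [LinearMap.comp_apply, Finsupp.lsingle_apply, singOp_single, LinearMap.id_apply,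
    realize_single, listSimp_stdVertices, push_single]
  rfl

lemma singOp_zero (x : SingularChain R X) : singOp R (fun _ => 0) x = 0 := by
  suffices singOp R (fun _ => 0) = 0 from LinearMap.congr_fun this x
  ext1 s
  ext1
  simp [singOp_single]

variable (R) in
/-- The boundary operator on singular chains. -/
def singBd : SingularChain R X →ₗ[R] SingularChain R X := singOp R fun _ => listBd R

lemma isNaturalListOp_listBd : IsNaturalListOp R fun _ => listBd R :=
  fun _ _ v x => listMap_listBd R (comb v) x

lemma singBd_singBd (x : SingularChain R X) : singBd R (singBd R x) = 0 := by
  rw [singBd, singOp_comp isNaturalListOp_listBd]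
  simp only [show ∀ n, listBd R ∘ₗ listBd R =
    (0 : (List (TopSimplex n) →₀ R) →ₗ[R] (List (TopSimplex n) →₀ R)) from
    fun n => LinearMap.ext fun x => listBd_listBd R x, singOp_zero]

lemma push_singBd (f : C(X, Y)) (x : SingularChain R X) :
    push R f (singBd R x) = singBd R (push R f x) := push_singOp f x

lemma singBd_realize (x : List K →₀ R) : singBd R (realize R x) = realize R (listBd R x) :=
  singOp_realize (fun _ v x => listMap_listBd R (comb v) x) x

/-! ### Chains in a subset -/

variable (R) in
/-- The singular chains with support in a subset. -/
def chainsIn (A : Set X) : Submodule R (SingularChain R X) :=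
  Finsupp.supported R R {s | Set.range s.2 ⊆ A}

lemma single_mem_chainsIn {A : Set X} {s : SingularSimplex X} (h : Set.range s.2 ⊆ A) (r : R) :
    Finsupp.single s r ∈ chainsIn R A := Finsupp.single_mem_supported R r h

lemma chainsIn_mono {A B : Set X} (h : A ⊆ B) : chainsIn R A ≤ chainsIn R B :=
  Finsupp.supported_mono fun _ hs => hs.trans h

lemma chainsIn_univ : chainsIn R (Set.univ : Set X) = ⊤ := by
  simp [chainsIn, Finsupp.supported_univ]

lemma chainsIn_inter (A B : Set X) : chainsIn R (A ∩ B) = chainsIn R A ⊓ chainsIn R B := by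
  rw [chainsIn, chainsIn, chainsIn, ← Finsupp.supported_inter]
  congr 1
  ext s
  exact Set.subset_inter_iff

lemma chainsIn_le_of_single {A : Set X} {S : Submodule R (SingularChain R X)}
    (h : ∀ s : SingularSimplex X, Set.range s.2 ⊆ A → Finsupp.single s 1 ∈ S) :
    chainsIn R A ≤ S := by
  rw [chainsIn, Finsupp.supported_eq_span_single, Submodule.span_le]
  rintro _ ⟨s, hs, rfl⟩
  exact h s hs

lemma push_mem_chainsIn {f : C(X, Y)} {A : Set X} {B : Set Y} (h : Set.MapsTo f A B)
    {x : SingularChain R X} (hx : x ∈ chainsIn R A) : push R f x ∈ chainsIn R B := by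
  suffices chainsIn R A ≤ (chainsIn R B).comap (push R f) from this hx
  refine chainsIn_le_of_single fun s hs => ?_
  rw [Submodule.mem_comap, push_single]
  refine single_mem_chainsIn ?_ 1
  rintro _ ⟨t, rfl⟩
  exact h (hs ⟨t, rfl⟩)

lemma singOp_mem_chainsIn {A : Set X} {x : SingularChain R X} (hx : x ∈ chainsIn R A) :
    singOp R θ x ∈ chainsIn R A := by
  suffices chainsIn R A ≤ (chainsIn R A).comap (singOp R θ) from this hx
  refine chainsIn_le_of_single fun s hs => ?_
  rw [Submodule.mem_comap, singOp_single]
  refine push_mem_chainsIn (A := Set.univ) (fun t _ => hs ⟨t, rfl⟩) ?_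
  rw [chainsIn_univ]
  trivial

lemma singBd_mem_chainsIn {A : Set X} {x : SingularChain R X} (hx : x ∈ chainsIn R A) :
    singBd R x ∈ chainsIn R A := singOp_mem_chainsIn hx

/-- Chains in the image of an embedding are images of chains. -/
lemma map_push_chainsIn {f : C(X, Y)} (hf : Topology.IsInducing f) (A : Set X) :
    (chainsIn R A).map (push R f) = chainsIn R (f '' A) := by
  refine le_antisymm ?_ (chainsIn_le_of_single fun s hs => ?_)
  · rintro _ ⟨x, hx, rfl⟩
    exact push_mem_chainsIn (Set.mapsTo_image f A) hx
  · choose σ hσA hσ using fun t => hs ⟨t, rfl⟩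
    have hc : Continuous σ := hf.continuous_iff.2 (by
      rw [show f ∘ σ = s.2 from funext hσ]
      exact s.2.continuous)
    refine ⟨Finsupp.single ⟨s.1, ⟨σ, hc⟩⟩ 1, single_mem_chainsIn ?_ 1, ?_⟩
    · rintro _ ⟨t, rfl⟩
      exact hσA t
    · rw [push_single]
      congr 1
      refine Sigma.ext rfl (heq_of_eq ?_)
      ext t
      exact hσ t

/-! ### The grading -/

variable (R) in
/-- The homogeneous component of a singular chain, on simplices with `n` vertices. -/
def singComp (n : ℕ) : SingularChain R X →ₗ[R] SingularChain R X :=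
  open Classical in
  Finsupp.linearCombination R fun s => if s.1 = n then Finsupp.single s 1 else 0

variable (R X) in
/-- The homogeneous singular chains, on simplices with `n` vertices. -/
def singDeg (n : ℕ) : Submodule R (SingularChain R X) := Finsupp.supported R R {s | s.1 = n}

lemma singDeg_le_of_single {n : ℕ} {S : Submodule R (SingularChain R X)}
    (h : ∀ s : SingularSimplex X, s.1 = n → Finsupp.single s 1 ∈ S) :
    singDeg R X n ≤ S := by
  rw [singDeg, Finsupp.supported_eq_span_single, Submodule.span_le]
  rintro _ ⟨s, hs, rfl⟩
  exact h s hs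

lemma singComp_single_of_eq {n : ℕ} {s : SingularSimplex X} (h : s.1 = n) :
    singComp R n (Finsupp.single s 1) = Finsupp.single s 1 := by
  simp [singComp, h]

lemma singComp_single_of_ne {n : ℕ} {s : SingularSimplex X} (h : s.1 ≠ n) :
    singComp R n (Finsupp.single s 1) = 0 := by
  simp [singComp, h]

lemma singComp_mem_singDeg (n : ℕ) (x : SingularChain R X) : singComp R n x ∈ singDeg R X n := by
  suffices (⊤ : Submodule R (SingularChain R X)) ≤ (singDeg R X n).comap (singComp R n) from
    this trivial
  rw [← chainsIn_univ]
  refine chainsIn_le_of_single fun s _ => ?_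
  rw [Submodule.mem_comap]
  by_cases h : s.1 = n
  · rw [singComp_single_of_eq h]
    exact Finsupp.single_mem_supported R 1 h
  · rw [singComp_single_of_ne h]
    exact zero_mem _

lemma singComp_of_mem {n : ℕ} {x : SingularChain R X} (hx : x ∈ singDeg R X n) :
    singComp R n x = x := by
  suffices singDeg R X n ≤ LinearMap.eqLocus (singComp R n) LinearMap.id from this hx
  exact singDeg_le_of_single fun s hs => singComp_single_of_eq hs

lemma singComp_of_mem_ne {n m : ℕ} (hnm : n ≠ m) {x : SingularChain R X}
    (hx : x ∈ singDeg R X n) : singComp R m x = 0 := by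
  suffices singDeg R X n ≤ LinearMap.ker (singComp R m) from this hx
  exact singDeg_le_of_single fun s hs => singComp_single_of_ne (hs ▸ hnm)

lemma singComp_mem_chainsIn (n : ℕ) {A : Set X} {x : SingularChain R X} (hx : x ∈ chainsIn R A) :
    singComp R n x ∈ chainsIn R A := by
  suffices chainsIn R A ≤ (chainsIn R A).comap (singComp R n) from this hx
  refine chainsIn_le_of_single fun s hs => ?_
  rw [Submodule.mem_comap]
  by_cases h : s.1 = n
  · rw [singComp_single_of_eq h]
    exact single_mem_chainsIn hs 1
  · rw [singComp_single_of_ne h]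
    exact zero_mem _

lemma realize_mem_singDeg {n : ℕ} {x : List K →₀ R} (hx : x ∈ listDeg R K n) :
    realize R x ∈ singDeg R K n := by
  suffices listDeg R K n ≤ (singDeg R K n).comap (realize R) from this hx
  rw [listDeg, Finsupp.supported_eq_span_single, Submodule.span_le]
  rintro _ ⟨l, hl, rfl⟩
  rw [SetLike.mem_coe, Submodule.mem_comap, realize_single]
  exact Finsupp.single_mem_supported R 1 hl

lemma push_mem_singDeg {f : C(X, Y)} {n : ℕ} {x : SingularChain R X}
    (hx : x ∈ singDeg R X n) : push R f x ∈ singDeg R Y n := by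
  suffices singDeg R X n ≤ (singDeg R Y n).comap (push R f) from this hx
  refine singDeg_le_of_single fun s hs => ?_
  rw [Submodule.mem_comap, push_single]
  exact Finsupp.single_mem_supported R 1 hs

lemma length_stdVertices (n : ℕ) : (stdVertices n).length = n := by simp [stdVertices]

lemma singBd_single_mem_singDeg (s : SingularSimplex X) :
    singBd R (Finsupp.single s 1) ∈ singDeg R X (s.1 - 1) := by
  rw [singBd, singOp_single]
  refine push_mem_singDeg (realize_mem_singDeg ?_)
  have := listBd_single_mem_listDeg R (stdVertices s.1)
  rwa [length_stdVertices] at this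

lemma singBd_single_of_zero {s : SingularSimplex X} (hs : s.1 = 0) :
    singBd R (Finsupp.single s 1) = 0 := by
  obtain ⟨n, σ⟩ := s
  obtain rfl : n = 0 := hs
  rw [singBd, singOp_single]
  simp [stdVertices]

lemma singBd_mem_singDeg {n : ℕ} {x : SingularChain R X} (hx : x ∈ singDeg R X n) :
    singBd R x ∈ singDeg R X (n - 1) := by
  suffices singDeg R X n ≤ (singDeg R X (n - 1)).comap (singBd R) from this hx
  exact singDeg_le_of_single fun s hs => hs ▸ singBd_single_mem_singDeg s

lemma singBd_singComp (n : ℕ) (x : SingularChain R X) :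
    singBd R (singComp R (n + 1) x) = singComp R n (singBd R x) := by
  suffices singBd R ∘ₗ singComp R (n + 1) = singComp R n ∘ₗ singBd R from
    LinearMap.congr_fun this x
  ext1 s
  ext1
  simp only [LinearMap.comp_apply, Finsupp.lsingle_apply]
  have h1 := singBd_single_mem_singDeg (R := R) s
  by_cases h : s.1 = n + 1
  · rw [singComp_single_of_eq h, singComp_of_mem]
    rwa [h] at h1
  · rw [singComp_single_of_ne h, map_zero]
    -- For `s.1 = 0` the truncated degree `s.1 - 1` is again 0 and may equal `n`; there the
    -- vanishing of the boundary is used in place of degree reasons.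
    by_cases h0 : s.1 = 0
    · rw [singBd_single_of_zero h0, map_zero]
    · rw [singComp_of_mem_ne _ h1]
      omega

lemma singBd_singComp_zero (x : SingularChain R X) : singBd R (singComp R 0 x) = 0 := by
  suffices singDeg R X 0 ≤ LinearMap.ker (singBd R) from this (singComp_mem_singDeg 0 x)
  exact singDeg_le_of_single fun s hs => singBd_single_of_zero hs

/-- A chain is the sum of its homogeneous components. -/
lemma exists_eq_sum_singComp (x : SingularChain R X) :
    ∃ s : Finset ℕ, x = ∑ n ∈ s, singComp R n x := by
  classical
  refine ⟨x.support.image Sigma.fst, ?_⟩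
  conv_lhs => rw [← Finsupp.sum_single x]
  have h : ∀ n, singComp R n x =
      x.sum fun s r => if s.1 = n then Finsupp.single s r else 0 := fun n => by
    rw [singComp, Finsupp.linearCombination_apply]
    refine Finsupp.sum_congr fun s _ => ?_
    split_ifs <;> simp
  simp only [h, Finsupp.sum]
  rw [Finset.sum_comm]
  refine Finset.sum_congr rfl fun s hs => ?_
  rw [Finset.sum_ite_eq, if_pos (Finset.mem_image_of_mem _ hs)]

/-- Subcomplexes which are sums of their homogeneous components. -/
def IsHomogeneousComplex (C : Submodule R (SingularChain R X)) : Prop :=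
  ∀ n, ∀ x ∈ C, singComp R n x ∈ C

lemma isHomogeneousComplex_chainsIn (A : Set X) : IsHomogeneousComplex (chainsIn R A) :=
  fun n _ hx => singComp_mem_chainsIn n hx

lemma isHomogeneousComplex_bot : IsHomogeneousComplex (⊥ : Submodule R (SingularChain R X)) := by
  rintro n x hx
  rw [Submodule.mem_bot] at hx ⊢
  rw [hx, map_zero]

/-- The homogeneous component of a bounding chain in the next degree still bounds. This recovers
graded statements from ungraded acyclicity. -/
lemma RelAcyclic.exists_mem_singDeg {C A : Submodule R (SingularChain R X)}
    (h : RelAcyclic (singBd R) C A) (hC : IsHomogeneousComplex C) (hA : IsHomogeneousComplex A)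
    {n : ℕ} {y : SingularChain R X} (hy : y ∈ singDeg R X n) (hyC : y ∈ C)
    (hyA : singBd R y ∈ A) : ∃ e ∈ C, e ∈ singDeg R X (n + 1) ∧ y - singBd R e ∈ A := by
  obtain ⟨e, he, h'⟩ := h y hyC hyA
  refine ⟨singComp R (n + 1) e, hC _ _ he, singComp_mem_singDeg _ _, ?_⟩
  have := hA n _ h'
  rwa [map_sub, singComp_of_mem hy, ← singBd_singComp] at this

end Singular
end

noncomputable section
open HasAffineSimplices

/-! ### The prism operator and homotopy invariance. -/

section Prism

variable (R : Type v) [CommRing R] {E F K X Y Z : Type*} [TopologicalSpace K]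
  [HasAffineSimplices K] [TopologicalSpace X] [TopologicalSpace Y] [TopologicalSpace Z]

/-- The prism over a list of vertices. -/
def listPrismAux : List E → (List (E × unitInterval) →₀ R)
  | [] => 0
  | a :: l => Finsupp.single ((a, 0) :: (a, 1) :: l.map fun x => (x, 1)) 1 -
      listCone R (a, 0) (listPrismAux l)

/-- The prism operator on formal affine chains. -/
def listPrism : (List E →₀ R) →ₗ[R] (List (E × unitInterval) →₀ R) :=
  Finsupp.linearCombination R (listPrismAux R)

@[simp] lemma listPrism_nil : listPrism R (Finsupp.single ([] : List E) 1) = 0 := by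
  simp [listPrism, listPrismAux]

@[simp] lemma listPrism_cons (a : E) (l : List E) :
    listPrism R (Finsupp.single (a :: l) 1) =
      Finsupp.single ((a, 0) :: (a, 1) :: l.map fun x => (x, 1)) 1 -
        listCone R (a, 0) (listPrism R (Finsupp.single l 1)) := by
  simp [listPrism, listPrismAux]

lemma listPrism_listCone (a : E) (x : List E →₀ R) :
    listPrism R (listCone R a x) = listCone R (a, 0) (listCone R (a, 1)
      (listMap R (fun x => (x, 1)) x)) - listCone R (a, 0) (listPrism R x) := by
  suffices listPrism R ∘ₗ listCone R a = listCone R (a, 0) ∘ₗ listCone R (a, 1) ∘ₗ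
      listMap R (fun x => (x, 1)) - listCone R (a, 0) ∘ₗ listPrism R from
    LinearMap.congr_fun this x
  ext1 l
  ext1
  simp

lemma listMap_listPrism (f : E → F) (x : List E →₀ R) :
    listMap R (Prod.map f id) (listPrism R x) = listPrism R (listMap R f x) := by
  suffices listMap R (Prod.map f id) ∘ₗ listPrism R = listPrism R ∘ₗ listMap R f from
    LinearMap.congr_fun this x
  ext1 l
  ext1
  induction l with
  | nil => simp
  | cons a l ih =>
    simp at ih
    simp [listMap_listCone, ih]
    rfl

/-- Induction on the list: a prism is defined by coning from the bottom vertex `(a, 0)`, so the cone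
formula reduces its boundary to the prism over the remaining vertices. -/
lemma listBd_listPrism (x : List E →₀ R) :
    listBd R (listPrism R x) + listPrism R (listBd R x) =
      listMap R (fun x => (x, 1)) x - listMap R (fun x => (x, 0)) x := by
  suffices listBd R ∘ₗ listPrism R + listPrism R ∘ₗ listBd R =
      listMap R (fun x => (x, 1)) - listMap R (fun x => (x, 0)) from LinearMap.congr_fun this x
  ext1 l
  ext1
  induction l with
  | nil => simp
  | cons a l ih =>
    simp only [LinearMap.comp_apply, Finsupp.lsingle_apply, LinearMap.add_apply,
      LinearMap.sub_apply, listMap_single, List.map_cons] at ih ⊢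
    rw [listPrism_cons, map_sub, listBd_listCone, eq_sub_of_add_eq ih, listBd_cons, listBd_cons,
      listBd_cons, map_sub (listPrism R), listPrism_listCone, listMap_listBd, listMap_single]
    simp only [map_sub, listCone_single]
    abel

/-- The prism operator on singular chains. -/
def singPrism : SingularChain R X →ₗ[R] SingularChain R (X × unitInterval) :=
  Finsupp.linearCombination R fun s => push R (s.2.prodMap (ContinuousMap.id _))
    (realize R (listPrism R (Finsupp.single (stdVertices s.1) 1)))

variable {R}

lemma singPrism_single (s : SingularSimplex X) : singPrism R (Finsupp.single s 1) =
    push R (s.2.prodMap (ContinuousMap.id _))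
      (realize R (listPrism R (Finsupp.single (stdVertices s.1) 1))) := by
  simp [singPrism]

lemma push_singPrism (f : C(X, Y)) (x : SingularChain R X) :
    push R (f.prodMap (ContinuousMap.id _)) (singPrism R x) = singPrism R (push R f x) := by
  suffices push R (f.prodMap (ContinuousMap.id _)) ∘ₗ singPrism R = singPrism R ∘ₗ push R f from
    LinearMap.congr_fun this x
  ext1 s
  ext1
  simp only [LinearMap.comp_apply, Finsupp.lsingle_apply, singPrism_single, push_push, push_single]
  rfl

lemma push_realize_prod {m : ℕ} (v : Fin m → K) (x : List (TopSimplex m × unitInterval) →₀ R) :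
    push R ((comb v).prodMap (ContinuousMap.id _)) (realize R x) =
      realize R (listMap R (Prod.map (comb v) id) x) := by
  suffices push R ((comb v).prodMap (ContinuousMap.id _)) ∘ₗ realize R =
      realize R ∘ₗ listMap R (Prod.map (comb v) id) from LinearMap.congr_fun this x
  ext1 l
  ext1
  simp only [LinearMap.comp_apply, Finsupp.lsingle_apply, realize_single, listMap_single,
    push_single]
  congr 1
  obtain ⟨⟨n, w⟩, rfl⟩ := List.equivSigmaTuple.symm.surjective l
  change (listSimp (List.ofFn w)).map _ = listSimp ((List.ofFn w).map _)
  rw [List.map_ofFn, listSimp_ofFn, listSimp_ofFn]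
  refine Sigma.ext rfl (heq_of_eq (ContinuousMap.ext fun t => Prod.ext ?_ rfl))
  exact congrArg (fun f => f t) (comb_comb v (Prod.fst ∘ w))

lemma singPrism_realize (x : List K →₀ R) :
    singPrism R (realize R x) = realize R (listPrism R x) := by
  suffices singPrism R ∘ₗ realize R = realize R ∘ₗ listPrism R from LinearMap.congr_fun this x
  ext1 l
  ext1
  obtain ⟨⟨n, w⟩, rfl⟩ := List.equivSigmaTuple.symm.surjective l
  change singPrism R (realize R (Finsupp.single (List.ofFn w) 1)) =
    realize R (listPrism R (Finsupp.single (List.ofFn w) 1))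
  rw [realize_single, listSimp_ofFn, singPrism_single, push_realize_prod, listMap_listPrism,
    listMap_single, map_stdVertices]

lemma comb_const_unitInterval {m : ℕ} (c : unitInterval) (t : TopSimplex m) :
    comb (fun _ => c) t = c := by
  apply Subtype.ext
  change ∑ i, t.1 i • c.1 = c.1
  rw [← Finset.sum_smul, t.2.2, one_smul]

lemma realize_listMap_prod (c : unitInterval) (x : List K →₀ R) :
    realize R (listMap R (fun x => (x, c)) x) =
      push R ((ContinuousMap.id K).prodMk (ContinuousMap.const K c)) (realize R x) := by
  suffices realize R ∘ₗ listMap R (fun x => (x, c)) =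
      push R ((ContinuousMap.id K).prodMk (ContinuousMap.const K c)) ∘ₗ realize R from
    LinearMap.congr_fun this x
  ext1 l
  ext1
  simp only [LinearMap.comp_apply, Finsupp.lsingle_apply, realize_single, listMap_single,
    push_single]
  congr 1
  obtain ⟨⟨n, w⟩, rfl⟩ := List.equivSigmaTuple.symm.surjective l
  change listSimp ((List.ofFn w).map _) = (listSimp (List.ofFn w)).map _
  rw [List.map_ofFn, listSimp_ofFn, listSimp_ofFn]
  exact Sigma.ext rfl (heq_of_eq (ContinuousMap.ext fun t =>
    Prod.ext rfl (comb_const_unitInterval c t)))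

lemma singBd_singPrism (x : SingularChain R X) :
    singBd R (singPrism R x) + singPrism R (singBd R x) =
      push R ((ContinuousMap.id X).prodMk (ContinuousMap.const X 1)) x -
        push R ((ContinuousMap.id X).prodMk (ContinuousMap.const X 0)) x := by
  suffices singBd R ∘ₗ singPrism R + singPrism R ∘ₗ singBd R =
      push R ((ContinuousMap.id X).prodMk (ContinuousMap.const X 1)) -
        push R ((ContinuousMap.id X).prodMk (ContinuousMap.const X 0)) from
    LinearMap.congr_fun this x
  ext1 s
  ext1
  simp only [LinearMap.comp_apply, Finsupp.lsingle_apply, LinearMap.add_apply,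
    LinearMap.sub_apply]
  rw [singPrism_single, ← push_singBd, singBd_realize, singBd, singOp_single, ← push_singPrism,
    singPrism_realize, ← map_add, ← map_add, listBd_listPrism, map_sub, map_sub,
    realize_listMap_prod, realize_listMap_prod, realize_single, listSimp_stdVertices,
    push_single, push_single, push_single, push_single, push_single, push_single]
  rfl

lemma singPrism_mem_chainsIn {A : Set X} {x : SingularChain R X} (hx : x ∈ chainsIn R A) :
    singPrism R x ∈ chainsIn R (A ×ˢ (Set.univ : Set unitInterval)) := by
  suffices chainsIn R A ≤ (chainsIn R (A ×ˢ (Set.univ : Set unitInterval))).comap (singPrism R)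
    from this hx
  refine chainsIn_le_of_single fun s hs => ?_
  rw [Submodule.mem_comap, singPrism_single]
  refine push_mem_chainsIn (A := Set.univ) (B := A ×ˢ Set.univ)
    (fun t _ => ⟨hs ⟨t.1, rfl⟩, trivial⟩) ?_
  rw [chainsIn_univ]
  trivial

/-- The chain homotopy induced by a homotopy. -/
def singHomotopy (H : C(X × unitInterval, Y)) : SingularChain R X →ₗ[R] SingularChain R Y :=
  push R H ∘ₗ singPrism R

lemma singBd_singHomotopy (H : C(X × unitInterval, Y)) {f g : C(X, Y)}
    (hf : ∀ x, H (x, 0) = f x) (hg : ∀ x, H (x, 1) = g x) (x : SingularChain R X) :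
    singBd R (singHomotopy H x) + singHomotopy H (singBd R x) = push R g x - push R f x := by
  rw [singHomotopy, LinearMap.comp_apply, LinearMap.comp_apply, ← push_singBd, ← map_add,
    singBd_singPrism, map_sub, push_push, push_push]
  congr 3 <;> ext x
  · exact hg x
  · exact hf x

lemma singHomotopy_mem_chainsIn {H : C(X × unitInterval, Y)} {A : Set X} {B : Set Y}
    (h : ∀ x ∈ A, ∀ t, H (x, t) ∈ B) {x : SingularChain R X} (hx : x ∈ chainsIn R A) :
    singHomotopy H x ∈ chainsIn R B :=
  push_mem_chainsIn (fun p hp => h p.1 hp.1 p.2) (singPrism_mem_chainsIn hx)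

lemma listSimp_injective [Subsingleton K] : Function.Injective (listSimp (K := K)) := by
  intro l l' h
  have h1 : l.length = l'.length := congrArg Sigma.fst h
  exact List.ext_get h1 fun _ _ _ => Subsingleton.elim _ _

lemma listSimp_surjective [Subsingleton K] [Nonempty K] :
    Function.Surjective (listSimp (K := K)) := by
  rintro ⟨n, σ⟩
  refine ⟨List.ofFn fun _ : Fin n => Classical.arbitrary K, ?_⟩
  rw [listSimp_ofFn]
  exact Sigma.ext rfl (heq_of_eq (ContinuousMap.ext fun t => Subsingleton.elim _ _))

/-- The augmented homology of a point vanishes. -/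
lemma exists_singBd_eq_of_subsingleton [Subsingleton K] [Nonempty K] {x : SingularChain R K}
    (hx : singBd R x = 0) : ∃ e, singBd R e = x := by
  obtain ⟨y, rfl⟩ : ∃ y, realize R y = x := Finsupp.mapDomain_surjective listSimp_surjective x
  have hinj : Function.Injective (realize (K := K) R) :=
    Finsupp.mapDomain_injective listSimp_injective
  rw [singBd_realize, ← map_zero (realize R)] at hx
  -- Over a point, singular chains and formal chains coincide, and the cone at the point contracts
  -- the complex.
  refine ⟨realize R (listCone R (Classical.arbitrary K) y), ?_⟩
  rw [singBd_realize, listBd_listCone, hinj hx, map_zero, sub_zero]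

/-- A subset which is contracted to one of its points has trivial augmented homology. -/
lemma relAcyclic_of_contraction (H : C(X × unitInterval, X)) {A : Set X} {p : X} (hp : p ∈ A)
    (h0 : ∀ x, H (x, 0) = x) (h1 : ∀ x, H (x, 1) = p) (hA : ∀ x ∈ A, ∀ t, H (x, t) ∈ A) :
    RelAcyclic (singBd R) (chainsIn R A) ⊥ := by
  intro c hc hdc
  rw [Submodule.mem_bot] at hdc
  let j : C(TopSimplex 1, X) := ContinuousMap.const _ p
  let q : C(X, TopSimplex 1) := ContinuousMap.const _ (stdSimplex.vertex 0)
  have h2 := singBd_singHomotopy H (f := ContinuousMap.id X) (g := j.comp q) h0 h1 c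
  rw [hdc, map_zero, add_zero, push_id, ← push_push] at h2
  have : Subsingleton (TopSimplex 1) := ⟨fun a b => Subtype.ext (funext fun i => by
    have h1 := a.2.2
    have h2 := b.2.2
    rw [Fin.sum_univ_one] at h1 h2
    rw [Subsingleton.elim i 0]
    exact h1.trans h2.symm)⟩
  have : Nonempty (TopSimplex 1) := ⟨stdSimplex.vertex 0⟩
  -- The end of the contraction factors through a one-point simplex, where the image of the cycle is
  -- a boundary.
  obtain ⟨e, he⟩ := exists_singBd_eq_of_subsingleton (R := R) (x := push R q c) (by
    rw [← push_singBd, hdc, map_zero])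
  rw [← he, push_singBd] at h2
  refine ⟨push R j e - singHomotopy H c, Submodule.sub_mem _ ?_ ?_, ?_⟩
  · refine push_mem_chainsIn (A := Set.univ) (fun t _ => hp) ?_
    rw [chainsIn_univ]
    trivial
  · exact singHomotopy_mem_chainsIn hA hc
  · rw [Submodule.mem_bot, map_sub, h2]
    abel

lemma relAcyclic_of_contractibleSpace [ContractibleSpace X] :
    RelAcyclic (singBd R) (chainsIn R (Set.univ : Set X)) ⊥ := by
  obtain ⟨p, ⟨H⟩⟩ := id_nullhomotopic X
  refine relAcyclic_of_contraction (p := p)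
    (H.toContinuousMap.comp ⟨Prod.swap, continuous_swap⟩) trivial ?_ ?_ fun _ _ _ => trivial
  · intro x
    simp
  · intro x
    simp

/-- A deformation retraction of a subset `U` onto a subset `A` (in the weak sense). -/
lemma relAcyclic_of_deformation {f : C(Y, X)} (hf : Topology.IsEmbedding f)
    (H : C(Y × unitInterval, X)) {A : Set X} (h0 : ∀ y, H (y, 0) = f y) (h1 : ∀ y, H (y, 1) ∈ A)
    (hA : ∀ y, f y ∈ A → ∀ t, H (y, t) ∈ A) (hU : ∀ y t, H (y, t) ∈ Set.range f) :
    RelAcyclic (singBd R) (chainsIn R (Set.range f)) (chainsIn R A) := by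
  intro c hc hdc
  rw [← Set.image_univ, ← map_push_chainsIn hf.isInducing] at hc
  obtain ⟨c, hc, rfl⟩ := hc
  rw [← push_singBd] at hdc
  have hdc' : singBd R c ∈ chainsIn R (f ⁻¹' A) := by
    have : push R f (singBd R c) ∈ chainsIn R (f '' (f ⁻¹' A)) := by
      rw [Set.image_preimage_eq_inter_range, chainsIn_inter]
      refine ⟨hdc, ?_⟩
      refine push_mem_chainsIn (A := Set.univ) (fun t _ => Set.mem_range_self t) ?_
      rw [chainsIn_univ]
      trivial
    rw [← map_push_chainsIn hf.isInducing] at this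
    exact (Submodule.map_mem_map_iff (push_injective R hf.injective)).1 this
  -- The homotopy compares `c` with its image under the end map `g`, which lies in `A`. The
  -- remaining term is the homotopy of the boundary, which stays in `A` because `A` is preserved
  -- throughout.
  let g : C(Y, X) := ⟨fun y => H (y, 1), by fun_prop⟩
  have h2 := singBd_singHomotopy (R := R) H (f := f) (g := g) h0 (fun _ => rfl) c
  refine ⟨-singHomotopy H c, Submodule.neg_mem _
    (singHomotopy_mem_chainsIn (fun y _ t => hU y t) hc), ?_⟩
  have h3 : push R g c ∈ chainsIn R A := push_mem_chainsIn (A := Set.univ) (fun y _ => h1 y) hc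
  have h4 : singHomotopy H (singBd R c) ∈ chainsIn R A :=
    singHomotopy_mem_chainsIn (fun y hy t => hA y hy t) hdc'
  have := Submodule.sub_mem _ h3 h4
  convert this using 1
  rw [map_neg, eq_sub_of_add_eq h2]
  abel

end Prism
end

noncomputable section
open HasAffineSimplices

/-! ### Barycentric subdivision and small simplices. -/

section Subdivision

variable (R : Type v) [CommRing R] {E F K X : Type*} [TopologicalSpace K]
  [HasAffineSimplices K] [TopologicalSpace X]

lemma isEmpty_topSimplex_zero : IsEmpty (TopSimplex 0) :=
  ⟨fun t => by simpa using t.2.2⟩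

/-- The barycenter of the standard simplex. -/
def stdBarycenter (n : ℕ) (h : n ≠ 0) : TopSimplex n :=
  ⟨fun _ => (n : ℝ)⁻¹, fun _ => by positivity, by simp [h]⟩

/-- The barycenter of a singular simplex, with a default value for the empty simplex. -/
def SingularSimplex.center (s : SingularSimplex X) (a : X) : X :=
  if h : s.1 = 0 then a else s.2 (stdBarycenter s.1 h)

lemma SingularSimplex.center_map {Y : Type*} [TopologicalSpace Y] (f : C(X, Y))
    (s : SingularSimplex X) (a : X) : (s.map f).center (f a) = f (s.center a) := by
  unfold SingularSimplex.center SingularSimplex.map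
  split_ifs <;> rfl

/-- The barycenter of a nonempty list of vertices. -/
def listCenter (a : K) (l : List K) : K := (listSimp (a :: l)).center a

lemma comb_listCenter {m : ℕ} (v : Fin m → K) (a : TopSimplex m) (l : List (TopSimplex m)) :
    comb v (listCenter a l) = listCenter (comb v a) (l.map (comb v)) := by
  rw [listCenter, listCenter, ← List.map_cons, ← map_listSimp, SingularSimplex.center_map]

/-- Barycentric subdivision of formal affine chains. -/
def listSd : (List K →₀ R) →ₗ[R] (List K →₀ R) :=
  coneRec R listCenter 0 (Finsupp.single [] 1) 1

/-- The homotopy between barycentric subdivision and the identity. -/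
def listSdHomotopy : (List K →₀ R) →ₗ[R] (List K →₀ R) :=
  coneRec R (fun a _ => a) (LinearMap.id - listSd R) 0 (-1)

@[simp] lemma listSd_nil : listSd R (Finsupp.single ([] : List K) 1) = Finsupp.single [] 1 := by
  simp [listSd]

lemma listSd_cons (a : K) (l : List K) : listSd R (Finsupp.single (a :: l) 1) =
    listCone R (listCenter a l) (listSd R (listBd R (Finsupp.single (a :: l) 1))) := by
  rw [listSd, coneRec_cons, LinearMap.zero_apply, one_smul, zero_add]

lemma listBd_listSd_single (l : List K) :
    listBd R (listSd R (Finsupp.single l 1)) = listSd R (listBd R (Finsupp.single l 1)) := by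
  induction l using list_induction with
  | _ l ih =>
    cases l with
    | nil => rw [listSd_nil, listBd_nil, map_zero]
    | cons a l =>
      have h1 := eq_of_mem_listDeg R (n := l.length) (listBd R ∘ₗ listSd R)
        (listSd R ∘ₗ listBd R) (fun l' hl' => by
          rw [LinearMap.comp_apply, LinearMap.comp_apply]
          exact ih l' (by rw [hl', List.length_cons]; omega))
        (listBd_single_mem_listDeg R (a :: l))
      rw [LinearMap.comp_apply, LinearMap.comp_apply, listBd_listBd, map_zero] at h1
      rw [listSd_cons, listBd_listCone, h1, map_zero, sub_zero]

lemma listBd_listSd (x : List K →₀ R) : listBd R (listSd R x) = listSd R (listBd R x) := by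
  induction x using Finsupp.induction_linear with
  | zero => simp only [map_zero]
  | add x y hx hy => simp only [map_add, hx, hy]
  | single l r =>
    rw [← mul_one r, ← smul_eq_mul, ← Finsupp.smul_single]
    simp only [map_smul, listBd_listSd_single]

lemma listMap_listSd {m : ℕ} (v : Fin m → K) (x : List (TopSimplex m) →₀ R) :
    listMap R (comb v) (listSd R x) = listSd R (listMap R (comb v) x) :=
  listMap_coneRec R listCenter 0 _ 1 (comb v) (comb_listCenter v) (γ' := 0) (fun _ => by
    rw [LinearMap.zero_apply, LinearMap.zero_apply, map_zero]) (by rw [listMap_single]; rfl) x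

lemma listBd_listSdHomotopy (x : List K →₀ R) :
    listBd R (listSdHomotopy R x) + listSdHomotopy R (listBd R x) = x - listSd R x :=
  listBd_coneRec_of_chain R _ (LinearMap.id - listSd R) (fun x => by
    rw [LinearMap.sub_apply, LinearMap.sub_apply, map_sub, listBd_listSd]; rfl) (by simp) x

lemma listMap_listSdHomotopy {m : ℕ} (v : Fin m → K) (x : List (TopSimplex m) →₀ R) :
    listMap R (comb v) (listSdHomotopy R x) = listSdHomotopy R (listMap R (comb v) x) :=
  listMap_coneRec R _ _ _ _ (comb v) (fun _ _ => rfl) (fun x => by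
    rw [LinearMap.sub_apply, LinearMap.sub_apply, map_sub, listMap_listSd]; rfl)
    (map_zero _) x

lemma isNaturalListOp_listSd : IsNaturalListOp R fun _ => listSd R :=
  fun _ _ v x => listMap_listSd R v x

lemma isNaturalListOp_listSdHomotopy : IsNaturalListOp R fun _ => listSdHomotopy R :=
  fun _ _ v x => listMap_listSdHomotopy R v x

/-- Barycentric subdivision of singular chains. -/
def singSd : SingularChain R X →ₗ[R] SingularChain R X := singOp R fun _ => listSd R

variable {R}

lemma singBd_singSd (x : SingularChain R X) : singBd R (singSd R x) = singSd R (singBd R x) := by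
  rw [singBd, singSd, singOp_comp isNaturalListOp_listBd, singOp_comp (isNaturalListOp_listSd R)]
  congr 2
  funext n
  exact LinearMap.ext fun x => listBd_listSd R x

/-- Telescoping: `1 - Sd^(N+1) = (1 - Sd^N) + Sd^N (1 - Sd)`. Since `Sd^N` commutes with the
boundary, the homotopy for one subdivision can be composed with it. -/
lemma exists_singSd_homotopy (N : ℕ) : ∃ T : SingularChain R X →ₗ[R] SingularChain R X,
    (∀ A, ∀ x ∈ chainsIn R A, T x ∈ chainsIn R A) ∧
      ∀ x, singBd R (T x) + T (singBd R x) = x - (singSd R ^ N) x := by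
  induction N with
  | zero => exact ⟨0, fun _ _ _ => zero_mem _, fun x => by simp⟩
  | succ N ih =>
    obtain ⟨T, hT, h⟩ := ih
    let D : SingularChain R X →ₗ[R] SingularChain R X := singOp R fun _ => listSdHomotopy R
    have hD : ∀ x : SingularChain R X, singBd R (D x) + D (singBd R x) = x - singSd R x := by
      intro x
      simp only [D]
      rw [singBd, singSd, singOp_comp isNaturalListOp_listBd,
        singOp_comp (isNaturalListOp_listSdHomotopy R), ← singOp_add]
      rw [show x - singOp R (fun _ => listSd R) x =
        singOp R (fun _ => LinearMap.id) x - singOp R (fun _ => listSd R) x by rw [singOp_id],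
        ← singOp_sub]
      congr 2
      funext n
      exact LinearMap.ext fun x => listBd_listSdHomotopy R x
    refine ⟨T + (singSd R ^ N : Module.End R (SingularChain R X)) ∘ₗ D, fun A x hx => Submodule.add_mem _ (hT A x hx) ?_, fun x => ?_⟩
    · have h1 : D x ∈ chainsIn R A := singOp_mem_chainsIn hx
      rw [LinearMap.comp_apply]
      generalize D x = y at h1
      clear h hT
      induction N with
      | zero => exact h1
      | succ N ih =>
        rw [pow_succ', Module.End.mul_apply]
        exact singOp_mem_chainsIn ih
    · have hc : ∀ y : SingularChain R X,
          singBd R ((singSd R ^ N) y) = (singSd R ^ N) (singBd R y) := by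
        intro y
        clear h hT
        induction N with
        | zero => rfl
        | succ N ih => rw [pow_succ', Module.End.mul_apply, Module.End.mul_apply, singBd_singSd, ih]
      have h1 := congrArg (singSd R ^ N) (hD x)
      rw [map_add, map_sub, ← hc] at h1
      have h2 : (singSd R ^ N) (singSd R x) = (singSd R ^ (N + 1)) x := by
        rw [pow_succ, Module.End.mul_apply]
      rw [h2] at h1
      have h3 := congrArg₂ (· + ·) (h x) h1
      simp only [LinearMap.add_apply, LinearMap.comp_apply, map_add] at h3 ⊢
      rw [sub_add_sub_cancel] at h3
      rw [← h3]
      abel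

/-! ### Mesh estimate -/

lemma supported_le_of_single {α M : Type*} [AddCommGroup M] [Module R M] {S : Set α}
    {Q : Submodule R M} (f : (α →₀ R) →ₗ[R] M) (h : ∀ a ∈ S, f (Finsupp.single a 1) ∈ Q)
    {x : α →₀ R} (hx : x ∈ Finsupp.supported R R S) : f x ∈ Q := by
  suffices Finsupp.supported R R S ≤ Q.comap f from this hx
  rw [Finsupp.supported_eq_span_single, Submodule.span_le]
  rintro _ ⟨s, hs, rfl⟩
  exact h s hs

lemma listBd_single_mem_supported (l : List E) : listBd R (Finsupp.single l 1) ∈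
    Finsupp.supported R R {l' : List E | l' ⊆ l ∧ l'.length = l.length - 1} := by
  induction l with
  | nil => simp
  | cons a l ih =>
    rw [listBd_cons]
    refine Submodule.sub_mem _ (Finsupp.single_mem_supported R 1 (by simp)) ?_
    cases l with
    | nil => simp
    | cons b l =>
      refine supported_le_of_single (listCone R a) (fun l' hl' => ?_) ih
      rw [listCone_single]
      refine Finsupp.single_mem_supported R 1 ⟨List.cons_subset_cons a hl'.1, ?_⟩
      simp [hl'.2]

lemma coe_listCenter {n : ℕ} (a : TopSimplex n) (l : List (TopSimplex n)) :
    (listCenter a l).1 = ∑ i : Fin (l.length + 1), ((l.length + 1 : ℕ) : ℝ)⁻¹ •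
      ((a :: l).get i).1 := by
  simp only [listCenter, SingularSimplex.center, listSimp, List.length_cons, Nat.succ_ne_zero]
  rfl

/-- In the average of the `m` differences between a vertex and all the vertices, the term of the
vertex itself is zero; this gives the factor `1 - 1/m`. Convexity of balls extends the bound to the
hull, and replacing `m` by `N ≥ m` makes it uniform over faces. -/
lemma dist_listCenter_le {n N : ℕ} (a : TopSimplex n) (l : List (TopSimplex n))
    (hN : l.length + 1 ≤ N) {δ : ℝ} (hδ : ∀ x ∈ a :: l, ∀ y ∈ a :: l, dist x y ≤ δ)
    {x : Fin n → ℝ} (hx : x ∈ convexHull ℝ (Subtype.val '' {y : TopSimplex n | y ∈ a :: l})) :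
    dist x (listCenter a l).1 ≤ (1 - (N : ℝ)⁻¹) * δ := by
  have hδ0 : 0 ≤ δ := dist_nonneg.trans (hδ a (by simp) a (by simp))
  suffices convexHull ℝ (Subtype.val '' {y : TopSimplex n | y ∈ a :: l}) ⊆
      Metric.closedBall (listCenter a l).1 ((1 - (N : ℝ)⁻¹) * δ) from this hx
  refine convexHull_min ?_ (convex_closedBall _ _)
  rintro _ ⟨y, hy, rfl⟩
  obtain ⟨j, hj⟩ := List.get_of_mem hy
  rw [Metric.mem_closedBall, dist_comm, dist_eq_norm, coe_listCenter]
  set m := l.length + 1 with hm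
  have hm0 : (0 : ℝ) < (m : ℕ) := by positivity
  have h1 : y.1 = ∑ i : Fin m, ((m : ℕ) : ℝ)⁻¹ • y.1 := by
    rw [Finset.sum_const, Finset.card_univ, Fintype.card_fin, ← Nat.cast_smul_eq_nsmul ℝ, smul_smul,
      mul_inv_cancel₀ hm0.ne', one_smul]
  conv_lhs => rw [h1]
  rw [← Finset.sum_sub_distrib]
  calc ‖∑ i : Fin m, (((m : ℕ) : ℝ)⁻¹ • ((a :: l).get i).1 - ((m : ℕ) : ℝ)⁻¹ • y.1)‖
      ≤ ∑ i : Fin m, if i = j then 0 else ((m : ℕ) : ℝ)⁻¹ * δ := by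
        refine norm_sum_le_of_le _ fun i _ => ?_
        split_ifs with h
        · rw [h]
          change ‖((m : ℕ) : ℝ)⁻¹ • ((a :: l).get j).1 - _‖ ≤ 0
          rw [hj, sub_self, norm_zero]
        · rw [← smul_sub, norm_smul, Real.norm_of_nonneg (by positivity)]
          gcongr
          have := hδ ((a :: l).get i) (List.get_mem _ _) y hy
          rwa [Subtype.dist_eq, dist_eq_norm] at this
    _ = (1 - ((m : ℕ) : ℝ)⁻¹) * δ := by
        rw [Finset.sum_ite, Finset.sum_const_zero, zero_add, Finset.sum_const,
          Finset.filter_not, Finset.filter_eq' , if_pos (Finset.mem_univ j),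
          Finset.card_sdiff_of_subset (by simp)]
        simp only [Finset.card_univ, Fintype.card_fin, Finset.card_singleton, nsmul_eq_mul]
        rw [Nat.cast_sub (by omega)]
        rw [Nat.cast_one, ← mul_assoc, sub_mul, mul_inv_cancel₀ hm0.ne', one_mul]
    _ ≤ (1 - (N : ℝ)⁻¹) * δ := by
        gcongr

/-- A simplex of the subdivision is the barycenter joined to a simplex of a subdivided face. Two of
its vertices either both lie on that face, where induction applies, or one is the barycenter.
Keeping vertices in the convex hull is what makes the barycenter estimate applicable. -/
lemma listSd_single_mem {n N : ℕ} (l : List (TopSimplex n)) (hN : l.length ≤ N) {δ : ℝ}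
    (hδ0 : 0 ≤ δ) (hδ : ∀ x ∈ l, ∀ y ∈ l, dist x y ≤ δ) :
    listSd R (Finsupp.single l 1) ∈ Finsupp.supported R R {l' : List (TopSimplex n) |
      l'.length = l.length ∧
      (∀ x ∈ l', x.1 ∈ convexHull ℝ (Subtype.val '' {y : TopSimplex n | y ∈ l})) ∧
      ∀ x ∈ l', ∀ y ∈ l', dist x y ≤ (1 - (N : ℝ)⁻¹) * δ} := by
  induction l using list_induction with
  | _ l ih =>
    cases l with
    | nil =>
      rw [listSd_nil]
      exact Finsupp.single_mem_supported R 1 (by simp)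
    | cons a l =>
      rw [listSd_cons]
      have hρ : 0 ≤ (1 - (N : ℝ)⁻¹) * δ := by
        refine mul_nonneg (sub_nonneg.2 (inv_le_one_of_one_le₀ ?_)) hδ0
        have : 1 ≤ N := le_trans (by simp) hN
        exact_mod_cast this
      suffices h : listSd R (listBd R (Finsupp.single (a :: l) 1)) ∈
          Finsupp.supported R R {l' : List (TopSimplex n) | l'.length = l.length ∧
            (∀ x ∈ l', x.1 ∈ convexHull ℝ (Subtype.val '' {y : TopSimplex n | y ∈ a :: l})) ∧
            ∀ x ∈ l', ∀ y ∈ l', dist x y ≤ (1 - (N : ℝ)⁻¹) * δ} by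
        refine supported_le_of_single (listCone R (listCenter a l)) (fun l' hl' => ?_) h
        rw [listCone_single]
        obtain ⟨h1, h2, h3⟩ := hl'
        have h4 : ∀ x ∈ l', dist x (listCenter a l) ≤ (1 - (N : ℝ)⁻¹) * δ := fun x hx =>
          dist_listCenter_le a l (by simpa using hN) hδ (h2 x hx)
        refine Finsupp.single_mem_supported R 1 ⟨by simp [h1], ?_, ?_⟩
        · intro x hx
          rcases List.mem_cons.1 hx with rfl | hx
          · rw [coe_listCenter]
            refine (convex_convexHull ℝ _).sum_mem (fun i _ => by positivity) ?_ fun i _ => ?_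
            · rw [Finset.sum_const, Finset.card_univ, Fintype.card_fin, nsmul_eq_mul,
                mul_inv_cancel₀ (by positivity)]
            · exact subset_convexHull ℝ _ ⟨_, List.get_mem _ _, rfl⟩
          · exact h2 x hx
        · intro x hx y hy
          rcases List.mem_cons.1 hx with rfl | hx <;> rcases List.mem_cons.1 hy with rfl | hy
          · rwa [dist_self]
          · rw [dist_comm]
            exact h4 y hy
          · exact h4 x hx
          · exact h3 x hx y hy
      refine supported_le_of_single (listSd R) (fun l' hl' => ?_)
        (listBd_single_mem_supported (a :: l))
      have hlen : l'.length = l.length := hl'.2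
      refine Finsupp.supported_mono ?_ (ih l' (by simp [hlen]) ?_ ?_)
      · rintro l'' ⟨h1, h2, h3⟩
        exact ⟨h1.trans hlen, fun x hx => convexHull_mono (Set.image_mono fun y hy =>
          hl'.1 hy) (h2 x hx), h3⟩
      · rw [hlen]
        exact le_trans (by simp) hN
      · exact fun x hx y hy => hδ x (hl'.1 hx) y (hl'.1 hy)

lemma listSd_pow_stdVertices_mem (n N : ℕ) :
    ((listSd R ^ N) (Finsupp.single (stdVertices n) 1) : List (TopSimplex n) →₀ R) ∈
      Finsupp.supported R R {l : List (TopSimplex n) | l.length = n ∧ ∀ x ∈ l, ∀ y ∈ l,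
        dist x y ≤ (1 - (n : ℝ)⁻¹) ^ N * Metric.diam (Set.univ : Set (TopSimplex n))} := by
  induction N with
  | zero =>
    refine Finsupp.single_mem_supported R 1 ⟨length_stdVertices n, fun x _ y _ => ?_⟩
    rw [pow_zero, one_mul]
    exact Metric.dist_le_diam_of_mem isCompact_univ.isBounded trivial trivial
  | succ N ih =>
    rw [pow_succ' (listSd R : Module.End R (List (TopSimplex n) →₀ R)), Module.End.mul_apply]
    refine supported_le_of_single (listSd R) (fun l hl => ?_) ih
    refine Finsupp.supported_mono ?_ (listSd_single_mem (N := n) l hl.1.le ?_ hl.2)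
    · rintro l' ⟨h1, -, h3⟩
      refine ⟨h1.trans hl.1, fun x hx y hy => (h3 x hx y hy).trans_eq ?_⟩
      ring
    · refine mul_nonneg (pow_nonneg (sub_nonneg.2 ?_) _) Metric.diam_nonneg
      exact Nat.cast_inv_le_one n

lemma singSd_pow_single (s : SingularSimplex X) (N : ℕ) :
    (singSd R ^ N) (Finsupp.single s 1) =
      push R s.2 (realize R ((listSd R ^ N) (Finsupp.single (stdVertices s.1) 1))) := by
  induction N with
  | zero =>
    rw [pow_zero, Module.End.one_apply, pow_zero, Module.End.one_apply, realize_single,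
      listSimp_stdVertices, push_single]
    rfl
  | succ N ih =>
    rw [pow_succ', Module.End.mul_apply, ih, singSd, ← push_singOp,
      singOp_realize (fun m v x => listMap_listSd R v x), pow_succ', Module.End.mul_apply]

lemma comb_mem_ball {n : ℕ} {l : List (TopSimplex n)} {x : TopSimplex n} {δ : ℝ}
    (h : ∀ y ∈ l, dist y x < δ) (t : TopSimplex l.length) : comb l.get t ∈ Metric.ball x δ := by
  have : (TopSimplex.comb l.get t).1 ∈ Metric.ball x.1 δ := by
    rw [TopSimplex.comb_coe]
    exact (convex_ball x.1 δ).sum_mem (fun i _ => t.2.1 i) t.2.2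
      fun i _ => h _ (List.get_mem l i)
  exact this

/-- A sufficiently fine subdivision of a chain is a sum of small chains. -/
lemma exists_singSd_pow_mem {C O U : Set X} (hO : IsOpen O) (hU : IsOpen U) (hC : C ⊆ O ∪ U)
    {x : SingularChain R X} (hx : x ∈ chainsIn R C) :
    ∃ N₀ : ℕ, ∀ N, N₀ ≤ N → (singSd R ^ N) x ∈ chainsIn R (C ∩ O) ⊔ chainsIn R (C ∩ U) := by
  rw [chainsIn, Finsupp.supported_eq_span_single] at hx
  induction hx using Submodule.span_induction with
  | zero => exact ⟨0, fun N _ => by rw [map_zero]; exact zero_mem _⟩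
  | add x y _ _ hx hy =>
    obtain ⟨N₁, h1⟩ := hx
    obtain ⟨N₂, h2⟩ := hy
    exact ⟨max N₁ N₂, fun N hN => by
      rw [map_add]
      exact Submodule.add_mem _ (h1 N (le_trans (le_max_left _ _) hN))
        (h2 N (le_trans (le_max_right _ _) hN))⟩
  | smul r x _ hx =>
    obtain ⟨N₁, h1⟩ := hx
    exact ⟨N₁, fun N hN => by
      rw [map_smul]
      exact Submodule.smul_mem _ _ (h1 N hN)⟩
  | mem x hx =>
    obtain ⟨s, hs, rfl⟩ := hx
    let c : Bool → Set (TopSimplex s.1) := fun b => s.2 ⁻¹' (if b then O else U)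
    -- A Lebesgue number of the cover of the standard simplex by the preimages of `O` and `U`.
    obtain ⟨δ, hδ, hc⟩ := lebesgue_number_lemma_of_metric (c := c)
      (isCompact_univ (X := TopSimplex s.1))
      (fun b => by
        cases b
        · exact hU.preimage s.2.continuous
        · exact hO.preimage s.2.continuous)
      (fun t _ => by
        rcases hC (hs ⟨t, rfl⟩) with h | h
        · exact Set.mem_iUnion.2 ⟨true, h⟩
        · exact Set.mem_iUnion.2 ⟨false, h⟩)
    -- For zero vertices the factor `1 - 0⁻¹` is 1 and does not shrink, hence the separate
    -- alternative; the empty simplex lies in every subset anyway.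
    have hlt : ∃ N₀ : ℕ, ∀ N, N₀ ≤ N → (1 - (s.1 : ℝ)⁻¹) ^ N *
        Metric.diam (Set.univ : Set (TopSimplex s.1)) < δ ∨ s.1 = 0 := by
      by_cases h0 : s.1 = 0
      · exact ⟨0, fun _ _ => Or.inr h0⟩
      · have h1 : (0 : ℝ) ≤ 1 - (s.1 : ℝ)⁻¹ := sub_nonneg.2 (Nat.cast_inv_le_one _)
        have h2 : 1 - (s.1 : ℝ)⁻¹ < 1 := by
          rw [sub_lt_self_iff]
          positivity
        have h3 := (tendsto_pow_atTop_nhds_zero_of_lt_one h1 h2).mul_const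
          (Metric.diam (Set.univ : Set (TopSimplex s.1)))
        rw [zero_mul] at h3
        obtain ⟨N₀, h⟩ := Filter.eventually_atTop.1 (h3.eventually_lt_const hδ)
        exact ⟨N₀, fun N hN => Or.inl (h N hN)⟩
    obtain ⟨N₀, hN₀⟩ := hlt
    refine ⟨N₀, fun N hN => ?_⟩
    rw [singSd_pow_single]
    refine supported_le_of_single (push R s.2 ∘ₗ realize R) (fun l hl => ?_)
      (listSd_pow_stdVertices_mem s.1 N)
    rw [LinearMap.comp_apply, realize_single, push_single]
    obtain ⟨hl1, hl2⟩ := hl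
    cases l with
    | nil =>
      refine Submodule.mem_sup_left (single_mem_chainsIn ?_ 1)
      rintro _ ⟨t, rfl⟩
      exact (isEmpty_topSimplex_zero.false t).elim
    | cons a l =>
      have hlt := (hN₀ N hN).resolve_right (by rw [← hl1]; simp)
      have hball : ∀ t, comb (a :: l).get t ∈ Metric.ball a δ := comb_mem_ball fun y hy =>
        (hl2 y hy a (by simp)).trans_lt hlt
      obtain ⟨b, hb⟩ := hc a trivial
      have hsub : Set.range ((listSimp (a :: l)).map s.2).2 ⊆ C ∩ (if b then O else U) := by
        rintro _ ⟨t, rfl⟩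
        exact ⟨hs ⟨_, rfl⟩, hb (hball t)⟩
      cases b
      · exact Submodule.mem_sup_right (single_mem_chainsIn hsub 1)
      · exact Submodule.mem_sup_left (single_mem_chainsIn hsub 1)

/-- The theorem of small simplices, for a cover by two open sets. -/
lemma relAcyclic_small {C O U : Set X} (hO : IsOpen O) (hU : IsOpen U) (hC : C ⊆ O ∪ U) :
    RelAcyclic (singBd R) (chainsIn R C) (chainsIn R (C ∩ O) ⊔ chainsIn R (C ∩ U)) := by
  intro c hc hdc
  obtain ⟨N, hN⟩ := exists_singSd_pow_mem hO hU hC hc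
  obtain ⟨T, hT, h⟩ := exists_singSd_homotopy (R := R) (X := X) N
  refine ⟨T c, hT C c hc, ?_⟩
  have h1 : T (singBd R c) ∈ chainsIn R (C ∩ O) ⊔ chainsIn R (C ∩ U) := by
    obtain ⟨y, hy, z, hz, e⟩ := Submodule.mem_sup.1 hdc
    rw [← e, map_add]
    exact Submodule.add_mem_sup (hT _ y hy) (hT _ z hz)
  have := Submodule.add_mem _ (hN N le_rfl) h1
  convert this using 1
  rw [eq_sub_of_add_eq (h c)]
  abel

end Subdivision
end

noncomputable section

/-! ### Homology of punctured Euclidean spaces. -/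

section Spheres

variable {R : Type v} [CommRing R] {X : Type*} [TopologicalSpace X]

variable (X) in
/-- The empty singular simplex. -/
def emptySimplex : SingularSimplex X :=
  ⟨0, ⟨fun t => (isEmpty_topSimplex_zero.false t).elim, by
    have := isEmpty_topSimplex_zero
    exact continuous_of_const fun t => isEmptyElim t⟩⟩

lemma eq_emptySimplex {s : SingularSimplex X} (h : s.1 = 0) : s = emptySimplex X := by
  obtain ⟨n, σ⟩ := s
  obtain rfl : n = 0 := h
  exact Sigma.ext rfl (heq_of_eq (ContinuousMap.ext fun t => (isEmpty_topSimplex_zero.false t).elim))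

lemma nonempty_topSimplex {n : ℕ} (h : n ≠ 0) : Nonempty (TopSimplex n) := ⟨stdBarycenter n h⟩

lemma range_emptySimplex (A : Set X) : Set.range (emptySimplex X).2 ⊆ A := by
  rintro _ ⟨t, rfl⟩
  exact (isEmpty_topSimplex_zero.false t).elim

lemma exists_eq_smul_of_mem_chainsIn_empty {c : SingularChain R X}
    (hc : c ∈ chainsIn R (∅ : Set X)) : ∃ r : R, c = r • Finsupp.single (emptySimplex X) 1 := by
  suffices chainsIn R (∅ : Set X) ≤ R ∙ Finsupp.single (emptySimplex X) (1 : R) by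
    obtain ⟨r, hr⟩ := Submodule.mem_span_singleton.1 (this hc)
    exact ⟨r, hr.symm⟩
  refine chainsIn_le_of_single fun s hs => ?_
  by_cases h : s.1 = 0
  · rw [eq_emptySimplex h]
    exact Submodule.mem_span_singleton_self _
  · obtain ⟨t⟩ := nonempty_topSimplex h
    exact (hs ⟨t, rfl⟩).elim

lemma singBd_of_mem_chainsIn_empty {c : SingularChain R X}
    (hc : c ∈ chainsIn R (∅ : Set X)) : singBd R c = 0 := by
  obtain ⟨r, rfl⟩ := exists_eq_smul_of_mem_chainsIn_empty hc
  rw [map_smul, singBd_single_of_zero rfl, smul_zero]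

variable (R X) in
-- The empty set plays the role of the sphere of dimension -1, with the empty simplex as generator.
-- It starts the computation for spheres and also identifies the bottom of the skeletal tower.
lemma relBasis_empty : RelBasis (singBd R) (chainsIn R (∅ : Set X)) ⊥
    (fun _ : Unit => Finsupp.single (emptySimplex X) (1 : R)) where
  mem _ := single_mem_chainsIn (range_emptySimplex _) 1
  d_mem _ := by
    rw [singBd_single_of_zero rfl]
    exact zero_mem _
  span c hc _ := by
    obtain ⟨r, rfl⟩ := exists_eq_smul_of_mem_chainsIn_empty hc
    refine ⟨Finsupp.single () r, 0, zero_mem _, ?_⟩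
    rw [Finsupp.linearCombination_single, map_zero, sub_zero, sub_self]
    exact zero_mem _
  indep r e he hre := by
    rw [singBd_of_mem_chainsIn_empty he, sub_zero, Submodule.mem_bot,
      Finsupp.linearCombination_unique, Finsupp.smul_single, smul_eq_mul, mul_one,
      Finsupp.single_eq_zero] at hre
    ext
    exact hre

/-- Homogeneous form of the isomorphism on homology given by a triple with an acyclic pair. -/
lemma RelBasis.exists_of_boundary {ι : Type*} {A B C : Submodule R (SingularChain R X)}
    {y : ι → SingularChain R X} (h : RelBasis (singBd R) B A y) (hBC : B ≤ C) (hAB : A ≤ B)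
    (hac : RelAcyclic (singBd R) C A) (hC : IsHomogeneousComplex C)
    (hA : IsHomogeneousComplex A) {n : ℕ} (hy : ∀ i, y i ∈ singDeg R X n) :
    ∃ z : ι → SingularChain R X, (∀ i, z i ∈ singDeg R X (n + 1)) ∧
      RelBasis (singBd R) C B z := by
  choose z hz hzn hzd using fun i =>
    hac.exists_mem_singDeg hC hA (hy i) (hBC (h.mem i)) (h.d_mem i)
  exact ⟨z, hzn, h.of_boundary hBC hAB hac singBd_singBd hz hzd⟩

/-- Homogeneous form of the isomorphism on homology given by shrinking the bottom complex. -/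
lemma RelBasis.exists_shrink_bot {ι : Type*} {A B C : Submodule R (SingularChain R X)}
    {z : ι → SingularChain R X} (h : RelBasis (singBd R) C B z) (hBC : B ≤ C) (hAB : A ≤ B)
    (hac : RelAcyclic (singBd R) B A) (hB : IsHomogeneousComplex B)
    (hA : IsHomogeneousComplex A) {n : ℕ} (hz : ∀ i, z i ∈ singDeg R X (n + 1)) :
    ∃ z' : ι → SingularChain R X, (∀ i, z' i ∈ singDeg R X (n + 1)) ∧
      RelBasis (singBd R) C A z' := by
  choose e he hen hed using fun i =>
    hac.exists_mem_singDeg hB hA (n := n) (singBd_mem_singDeg (hz i)) (h.d_mem i)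
      (by rw [singBd_singBd]; exact zero_mem _)
  refine ⟨fun i => z i - e i, fun i => Submodule.sub_mem _ (hz i) (hen i),
    h.shrink_bot hBC hac hAB singBd_singBd (fun i => C.sub_mem (h.mem i) (hBC (he i)))
      (fun i => ?_) (fun i => ?_)⟩
  · rw [map_sub]
    exact hed i
  · rw [sub_sub_cancel]
    exact he i

/-- The part of punctured Euclidean space which contains the half space with sign `a`. -/
def halfSphere (n : ℕ) (a : ℝ) : Set (Fin (n + 1) → ℝ) := {x | Fin.tail x ≠ 0 ∨ 0 < a * x 0}

lemma continuous_finTail (n : ℕ) :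
    Continuous (Fin.tail : (Fin (n + 1) → ℝ) → (Fin n → ℝ)) :=
  continuous_pi fun i => continuous_apply i.succ

lemma continuous_finCons {Y : Type*} [TopologicalSpace Y] {n : ℕ} {f : Y → ℝ}
    {g : Y → (Fin n → ℝ)} (hf : Continuous f) (hg : Continuous g) :
    Continuous fun y => (Fin.cons (f y) (g y) : Fin (n + 1) → ℝ) := by
  refine continuous_pi fun i => ?_
  refine Fin.cases ?_ (fun j => ?_) i
  · simpa using hf
  · simp only [Fin.cons_succ]
    exact (continuous_apply j).comp hg

lemma isOpen_halfSphere (n : ℕ) (a : ℝ) : IsOpen (halfSphere n a) :=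
  (isOpen_ne_fun (continuous_finTail n) continuous_const).union
    (isOpen_lt continuous_const (continuous_const.mul (continuous_apply 0)))

lemma eq_zero_of_tail {n : ℕ} {x : Fin (n + 1) → ℝ} (h0 : x 0 = 0) (h : Fin.tail x = 0) :
    x = 0 := by
  funext i
  refine Fin.cases h0 (fun j => ?_) i
  exact congrFun h j

/-- The set is the complement of a closed ray and is star-shaped about the point `(a, 0)`; the
contraction is along straight lines. -/
lemma relAcyclic_halfSphere (n : ℕ) {a : ℝ} (ha : a * a = 1) :
    RelAcyclic (singBd R) (chainsIn R (halfSphere n a)) ⊥ := by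
  refine relAcyclic_of_contraction (p := Fin.cons a 0)
    ⟨fun p => (1 - (p.2 : ℝ)) • p.1 + (p.2 : ℝ) • (Fin.cons a 0 : Fin (n + 1) → ℝ), by fun_prop⟩
    (Or.inr ?_) (fun x => ?_) (fun x => ?_) fun x hx t => ?_
  · simp [ha]
  · simp
  · simp
  · have ht0 := t.2.1
    have ht1 := t.2.2
    rcases ht1.lt_or_eq with ht | ht
    · by_cases h : Fin.tail x = 0
      · right
        have hx' := hx.resolve_left (not_not.2 h)
        have : a * ((1 - (t : ℝ)) * x 0 + t * a) = (1 - (t : ℝ)) * (a * x 0) + t := by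
          linear_combination (t : ℝ) * ha
        have h3 : 0 < (1 - (t : ℝ)) * (a * x 0) := mul_pos (sub_pos.2 ht) hx'
        simp only [ContinuousMap.coe_mk, Pi.add_apply, Pi.smul_apply, smul_eq_mul, Fin.cons_zero]
        rw [this]
        exact add_pos_of_pos_of_nonneg h3 ht0
      · left
        intro h'
        apply h
        funext i
        have := congrFun h' i
        simp only [ContinuousMap.coe_mk, Fin.tail, Pi.add_apply, Pi.smul_apply, smul_eq_mul,
          Fin.cons_succ, Pi.zero_apply, mul_zero, add_zero, mul_eq_zero] at this
        exact this.resolve_left (sub_pos.2 ht).ne'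
    · right
      simp [ht, ha]

/-- The augmented homology of a sphere, in the form of a punctured Euclidean space. -/
lemma exists_relBasis_punctured (n : ℕ) : ∃ y ∈ singDeg R (Fin n → ℝ) n,
    RelBasis (singBd R) (chainsIn R ({0}ᶜ : Set (Fin n → ℝ))) ⊥ (fun _ : Unit => y) := by
  induction n with
  | zero =>
    have h : ({0}ᶜ : Set (Fin 0 → ℝ)) = ∅ := by
      ext x
      simp [Subsingleton.elim x 0]
    rw [h]
    exact ⟨_, Finsupp.single_mem_supported R 1 rfl, relBasis_empty R _⟩
  | succ n ih =>
    obtain ⟨y, hy, hyb⟩ := ih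
    -- The complement of the first coordinate axis. Scaling the first coordinate to 0 retracts it
    -- onto the punctured space of one dimension less, and it is the intersection of the two half
    -- spheres.
    let W : Set (Fin (n + 1) → ℝ) := {x | Fin.tail x ≠ 0}
    let f : C(Fin n → ℝ, Fin (n + 1) → ℝ) :=
      ⟨fun x => Fin.cons 0 x, continuous_finCons continuous_const continuous_id⟩
    let g : C(Fin (n + 1) → ℝ, Fin n → ℝ) := ⟨Fin.tail, continuous_finTail n⟩
    let H : C((Fin (n + 1) → ℝ) × unitInterval, Fin (n + 1) → ℝ) :=
      ⟨fun p => Fin.cons ((p.2 : ℝ) * p.1 0) (Fin.tail p.1), continuous_finCons (by fun_prop)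
        ((continuous_finTail n).comp continuous_fst)⟩
    have hW : RelBasis (singBd R) (chainsIn R W) ⊥ (push R f ∘ fun _ : Unit => y) := by
      refine hyb.of_retract (push R f) (push R g) (singHomotopy H) (push_singBd f)
        (push_singBd g) (fun x _ => ?_) (fun x => ?_) (fun x hx => ?_) (fun x hx => ?_)
        (fun x hx => ?_)
      · rw [push_push]
        exact push_id R x
      · have := singBd_singHomotopy (R := R) H (f := f.comp g) (g := ContinuousMap.id _)
          (fun x => by
            simp only [H, f, g, ContinuousMap.coe_mk, ContinuousMap.comp_apply]
            simp) (fun x => by simp [H]) x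
        rwa [push_id, ← push_push] at this
      · refine push_mem_chainsIn (fun z hz => ?_) hx
        simpa [W, f] using hz
      · refine push_mem_chainsIn (fun z hz => ?_) hx
        exact hz
      · refine singHomotopy_mem_chainsIn (fun z hz t => ?_) hx
        simpa [W, H] using hz
    have hWU : chainsIn R W = chainsIn R (halfSphere n (-1)) ⊓ chainsIn R (halfSphere n 1) := by
      rw [← chainsIn_inter]
      congr 1
      ext x
      simp only [W, halfSphere, Set.mem_inter_iff, Set.mem_ofPred_eq]
      constructor
      · exact fun h => ⟨Or.inl h, Or.inl h⟩
      · rintro ⟨h | h, h' | h'⟩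
        · exact h
        · exact h
        · exact h'
        · linarith
    have hle : chainsIn R W ≤ chainsIn R (halfSphere n (-1)) := hWU ▸ inf_le_left
    -- One half sphere is acyclic, so its homology relative to `W` is that of `W` shifted up by one
    -- degree.
    obtain ⟨z, hz, hzb⟩ := hW.exists_of_boundary hle bot_le
      (relAcyclic_halfSphere n (by norm_num)) (isHomogeneousComplex_chainsIn _)
      isHomogeneousComplex_bot (fun _ => push_mem_singDeg hy)
    rw [hWU] at hzb
    -- Excision of the other half sphere, first for the algebraic sum of the two chain complexes;
    -- the theorem of small simplices then gives all chains of the punctured space.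
    have h1 := RelBasis.iSup_sup (ι := Unit) (d := singBd R)
      (X := fun _ => chainsIn R (halfSphere n (-1))) (D := chainsIn R (halfSphere n 1)) (z := z)
      (fun _ => hzb) (fun _ _ hx => singBd_mem_chainsIn hx) (fun _ hx => singBd_mem_chainsIn hx)
      (fun c s hc hs i hi => by
        have : s = {()} := Finset.eq_singleton_iff_unique_mem.2 ⟨hi, fun _ _ => rfl⟩
        rw [this, Finset.sum_singleton] at hs
        exact hs)
    rw [iSup_const] at h1
    have hsub : ∀ a : ℝ, a * a = 1 → halfSphere n a ⊆ {0}ᶜ := by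
      rintro a ha x hx rfl
      rcases hx with h | h
      · exact h rfl
      · simp at h
    have hcov : ({0}ᶜ : Set (Fin (n + 1) → ℝ)) ⊆ halfSphere n (-1) ∪ halfSphere n 1 := by
      intro x hx
      by_cases h : Fin.tail x = 0
      · rcases lt_trichotomy (x 0) 0 with h0 | h0 | h0
        · exact Or.inl (Or.inr (by linarith))
        · exact (hx (eq_zero_of_tail h0 h)).elim
        · exact Or.inr (Or.inr (by linarith))
      · exact Or.inl (Or.inl h)
    have hsm := relAcyclic_small (R := R) (isOpen_halfSphere n (-1)) (isOpen_halfSphere n 1) hcov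
    rw [Set.inter_eq_self_of_subset_right (hsub (-1) (by norm_num)),
      Set.inter_eq_self_of_subset_right (hsub 1 (by norm_num))] at hsm
    have h2 := h1.enlarge_top le_sup_right (sup_le (chainsIn_mono (hsub (-1) (by norm_num)))
      (chainsIn_mono (hsub 1 (by norm_num)))) hsm singBd_singBd
    -- The second half sphere is acyclic too, so relative homology becomes absolute.
    obtain ⟨z', hz', h3⟩ := h2.exists_shrink_bot (chainsIn_mono (hsub 1 (by norm_num))) bot_le
      (relAcyclic_halfSphere n (by norm_num)) (isHomogeneousComplex_chainsIn _)
      isHomogeneousComplex_bot hz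
    exact ⟨z' (), hz' (), h3⟩

/-- The homology of Euclidean space relative to a punctured Euclidean space. -/
lemma exists_relBasis_euclidean (n : ℕ) : ∃ z ∈ singDeg R (Fin n → ℝ) (n + 1),
    RelBasis (singBd R) (chainsIn R (Set.univ : Set (Fin n → ℝ)))
      (chainsIn R ({0}ᶜ : Set (Fin n → ℝ))) (fun _ : Unit => z) := by
  obtain ⟨y, hy, hyb⟩ := exists_relBasis_punctured (R := R) n
  obtain ⟨z, hz, h⟩ := hyb.exists_of_boundary (chainsIn_mono (Set.subset_univ _)) bot_le
    relAcyclic_of_contractibleSpace (isHomogeneousComplex_chainsIn _) isHomogeneousComplex_bot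
    (fun _ => hy)
  exact ⟨z (), hz (), h⟩

end Spheres
end

noncomputable section

/-! ### Skeleta, centers of cells and the radial deformation. -/

section CellComplex

open Topology RelCWComplex Set

variable {X : Type*} [TopologicalSpace X] [T2Space X] [CWComplex (univ : Set X)] {n : ℕ}

variable (X) in
/-- The union of all cells of dimension less than `n`. -/
def skelLT (n : ℕ) : Set X := skeletonLT (univ : Set X) (n : ℕ∞)

variable (X) in
/-- The centers of the `n`-cells. -/
def cellCenters (n : ℕ) : Set X := range fun j : cell (univ : Set X) n => map n j 0

lemma isClosed_skelLT (n : ℕ) : IsClosed (skelLT X n) := Subcomplex.closed _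

lemma cellFrontier_subset_skelLT (j : cell (univ : Set X) n) : cellFrontier n j ⊆ skelLT X n :=
  cellFrontier_subset_skeletonLT n j

lemma closedCell_subset_skelLT {m : ℕ} (h : m < n) (j : cell (univ : Set X) m) :
    closedCell m j ⊆ skelLT X n :=
  (closedCell_subset_skeletonLT m j).trans (skeletonLT_mono (by exact_mod_cast h))

lemma disjoint_skelLT_openCell {m : ℕ} (h : n ≤ m) (j : cell (univ : Set X) m) :
    Disjoint (skelLT X n) (openCell m j) :=
  disjoint_skeletonLT_openCell (by exact_mod_cast h)

lemma skelLT_zero : skelLT X 0 = ∅ := by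
  rw [skelLT, Nat.cast_zero]
  exact skeletonLT_zero_eq_base

lemma skelLT_succ (n : ℕ) :
    skelLT X (n + 1) = skelLT X n ∪ ⋃ j : cell (univ : Set X) n, openCell n j := by
  have h := skeletonLT_union_iUnion_closedCell_eq_skeletonLT_succ (C := (univ : Set X)) n
  rw [skelLT, Nat.cast_add, Nat.cast_one, ← h]
  refine Subset.antisymm (union_subset subset_union_left (iUnion_subset fun j => ?_))
    (union_subset_union_right _ (iUnion_mono fun j => openCell_subset_closedCell n j))
  rw [← cellFrontier_union_openCell_eq_closedCell]
  exact union_subset_union (cellFrontier_subset_skelLT j)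
    (subset_iUnion (fun j : cell (univ : Set X) n => openCell n j) j)

lemma skelLT_mono {m : ℕ} (h : m ≤ n) : skelLT X m ⊆ skelLT X n :=
  skeletonLT_mono (by exact_mod_cast h)

variable (X) in
lemma exists_skelLT_eq_univ [FiniteDimensional (univ : Set X)] :
    ∃ N : ℕ, ∀ n, N ≤ n → skelLT X n = univ := by
  have hfd : ∀ᶠ n in Filter.atTop, IsEmpty (cell (univ : Set X) n) :=
    FiniteDimensional.eventually_isEmpty_cell
  obtain ⟨N, hN⟩ := Filter.eventually_atTop.1 hfd
  refine ⟨N, fun n hn => eq_univ_of_forall fun x => ?_⟩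
  have hx : x ∈ ⋃ (n : ℕ) (j : cell (univ : Set X) n), openCell n j := by
    rw [CWComplex.iUnion_openCell_eq_complex]
    trivial
  obtain ⟨m, j, hj⟩ := mem_iUnion₂.1 hx
  refine closedCell_subset_skelLT ?_ j (openCell_subset_closedCell m j hj)
  by_contra h
  exact (hN m (hn.trans (not_lt.1 h))).false j

omit [T2Space X] in
lemma map_mem_openCell {j : cell (univ : Set X) n} {y : Fin n → ℝ} (hy : ‖y‖ < 1) :
    map n j y ∈ openCell n j := mem_image_of_mem _ (mem_ball_zero_iff.2 hy)

lemma map_mem_skelLT {j : cell (univ : Set X) n} {y : Fin n → ℝ} (hy : ‖y‖ = 1) :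
    map n j y ∈ skelLT X n :=
  cellFrontier_subset_skelLT j (mem_image_of_mem _ (mem_sphere_zero_iff_norm.2 hy))

omit [T2Space X] in
lemma map_injOn (j : cell (univ : Set X) n) : InjOn (map n j) (Metric.ball 0 1) := by
  have := (map n j).injOn
  rwa [source_eq] at this

lemma map_mem_cellCenters_iff {j : cell (univ : Set X) n} {y : Fin n → ℝ} (hy : ‖y‖ ≤ 1) :
    map n j y ∈ cellCenters X n ↔ y = 0 := by
  constructor
  · rintro ⟨j', hj'⟩
    have h0 : (map n j' 0 : X) ∈ openCell n j' := map_mem_openCell (by simp)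
    simp only at hj'
    rcases hy.lt_or_eq with h | h
    · have h1 : (map n j y : X) ∈ openCell n j := map_mem_openCell h
      obtain rfl : j' = j := by
        have := eq_of_not_disjoint_openCell (not_disjoint_iff.2 ⟨_, h0, hj' ▸ h1⟩)
        simpa using this
      exact (map_injOn j' (by simp) (by simpa using h) hj').symm
    · exact (disjoint_left.1 (disjoint_skelLT_openCell le_rfl j') (map_mem_skelLT h)
        (hj' ▸ h0)).elim
  · rintro rfl
    exact mem_range_self j

lemma disjoint_skelLT_cellCenters : Disjoint (skelLT X n) (cellCenters X n) := by
  rw [disjoint_right]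
  rintro _ ⟨j, rfl⟩ h
  exact disjoint_left.1 (disjoint_skelLT_openCell le_rfl j) h (map_mem_openCell (by simp))

lemma cellCenters_inter_openCell (j : cell (univ : Set X) n) :
    cellCenters X n ∩ openCell n j = {map n j 0} := by
  ext x
  constructor
  · rintro ⟨hx, y, hy, rfl⟩
    rw [map_mem_cellCenters_iff (by simpa using (mem_ball_zero_iff.1 hy).le)] at hx
    rw [hx]
    rfl
  · rintro rfl
    exact ⟨mem_range_self j, map_mem_openCell (by simp)⟩

omit [T2Space X] in
lemma disjoint_cellCenters_openCell {m : ℕ} (h : m ≠ n) (j : cell (univ : Set X) m) :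
    Disjoint (cellCenters X n) (openCell m j) := by
  rw [disjoint_left]
  rintro _ ⟨i, rfl⟩ hj
  refine disjoint_left.1 (disjoint_openCell_of_ne (C := (univ : Set X)) (i := i) (j := j) ?_)
    (map_mem_openCell (by simp)) hj
  exact fun e => h (congrArg Sigma.fst e).symm

variable (X) in
lemma isClosed_cellCenters (n : ℕ) : IsClosed (cellCenters X n) := by
  refine CWComplex.isClosed_of_isClosed_inter_openCell_or_isClosed_inter_closedCell
    (subset_univ _) fun m _ j => Or.inl ?_
  by_cases h : m = n
  · subst h
    rw [cellCenters_inter_openCell]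
    exact isClosed_singleton
  · rw [(disjoint_cellCenters_openCell h j).inter_eq]
    exact isClosed_empty

variable {ι : Type*} (c : ι → cell (univ : Set X) n)

/-- The union of the `n-1`-skeleton with some of the `n`-cells. -/
def cellUnion : Set X := skelLT X n ∪ ⋃ i, openCell n (c i)

/-- The union of the `n-1`-skeleton with some of the punctured `n`-cells. -/
def puncturedUnion : Set X := cellUnion c \ cellCenters X n

lemma disjoint_cellUnion_openCell {m : ℕ} (h : n ≤ m) {j : cell (univ : Set X) m}
    (hj : ∀ i, (⟨n, c i⟩ : Σ n, cell (univ : Set X) n) ≠ ⟨m, j⟩) :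
    Disjoint (cellUnion c) (openCell m j) :=
  disjoint_union_left.2 ⟨disjoint_skelLT_openCell h j,
    disjoint_iUnion_left.2 fun i => disjoint_openCell_of_ne (hj i)⟩

lemma closedCell_subset_cellUnion (i : ι) : closedCell n (c i) ⊆ cellUnion c := by
  rw [← cellFrontier_union_openCell_eq_closedCell]
  exact union_subset_union (cellFrontier_subset_skelLT _)
    (subset_iUnion (fun i => openCell n (c i)) i)

/-- Needed for the family of all `n`-cells but one: its closedness makes the remaining open cell
relatively open in the union of the cells. -/
lemma isClosed_cellUnion : IsClosed (cellUnion c) := by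
  refine CWComplex.isClosed_of_isClosed_inter_openCell_or_isClosed_inter_closedCell
    (subset_univ _) fun m _ j => ?_
  by_cases h : m < n
  · right
    rw [inter_eq_self_of_subset_right (show closedCell m j ⊆ cellUnion c from
      (closedCell_subset_skelLT h j).trans subset_union_left)]
    exact isClosed_closedCell
  · by_cases hj : ∃ i, (⟨n, c i⟩ : Σ n, cell (univ : Set X) n) = ⟨m, j⟩
    · right
      obtain ⟨i, hi⟩ := hj
      obtain rfl : n = m := congrArg Sigma.fst hi
      obtain rfl : c i = j := by simpa using hi
      rw [inter_eq_self_of_subset_right (closedCell_subset_cellUnion c i)]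
      exact isClosed_closedCell
    · left
      rw [(disjoint_cellUnion_openCell c (not_lt.1 h) (not_exists.1 hj)).inter_eq]
      exact isClosed_empty

variable {c}

lemma map_mem_cellUnion {i : ι} {y : Fin n → ℝ} (hy : ‖y‖ ≤ 1) :
    map n (c i) y ∈ cellUnion c :=
  closedCell_subset_cellUnion c i (mem_image_of_mem _ (mem_closedBall_zero_iff.2 hy))

lemma map_mem_puncturedUnion {i : ι} {y : Fin n → ℝ} (hy : ‖y‖ ≤ 1) (h0 : y ≠ 0) :
    map n (c i) y ∈ puncturedUnion c :=
  ⟨map_mem_cellUnion hy, by rwa [map_mem_cellCenters_iff hy]⟩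

lemma skelLT_subset_puncturedUnion : skelLT X n ⊆ puncturedUnion c :=
  fun _ hx => ⟨Or.inl hx, disjoint_left.1 disjoint_skelLT_cellCenters hx⟩

/-- Points of the punctured union lie in the skeleton or in a punctured open cell. -/
lemma mem_puncturedUnion_cases {x : X} (hx : x ∈ puncturedUnion c) : x ∈ skelLT X n ∨
    ∃ i, ∃ y : Fin n → ℝ, ‖y‖ < 1 ∧ y ≠ 0 ∧ map n (c i) y = x := by
  obtain ⟨hx | hx, hx'⟩ := hx
  · exact Or.inl hx
  · obtain ⟨i, y, hy, rfl⟩ := mem_iUnion.1 hx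
    rw [mem_ball_zero_iff] at hy
    exact Or.inr ⟨i, y, hy, fun h => hx' ((map_mem_cellCenters_iff hy.le).2 h), rfl⟩

/-! ### Radial deformation -/

/-- The radial deformation of the punctured ball onto the sphere. -/
def pushOut (y : Fin n → ℝ) (t : ℝ) : Fin n → ℝ := ((1 - t) + t * ‖y‖⁻¹) • y

lemma norm_pushOut {y : Fin n → ℝ} (hy : y ≠ 0) {t : ℝ} (h0 : 0 ≤ t) (h1 : t ≤ 1) :
    ‖pushOut y t‖ = (1 - t) * ‖y‖ + t := by
  have : 0 < ‖y‖ := norm_pos_iff.2 hy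
  rw [pushOut, norm_smul, Real.norm_of_nonneg
    (add_nonneg (sub_nonneg.2 h1) (mul_nonneg h0 (by positivity))), add_mul, mul_assoc,
    inv_mul_cancel₀ this.ne', mul_one]

lemma norm_pushOut_le {y : Fin n → ℝ} (hy : ‖y‖ ≤ 1) (t : unitInterval) :
    ‖pushOut y t‖ ≤ 1 := by
  by_cases h : y = 0
  · simp [h, pushOut]
  · rw [norm_pushOut h t.2.1 t.2.2]
    have := mul_le_mul_of_nonneg_left hy (sub_nonneg.2 t.2.2)
    linarith

lemma pushOut_ne_zero {y : Fin n → ℝ} (hy : y ≠ 0) (t : unitInterval) : pushOut y t ≠ 0 := by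
  rw [← norm_pos_iff, norm_pushOut hy t.2.1 t.2.2]
  have h1 : 0 < ‖y‖ := norm_pos_iff.2 hy
  have h2 := t.2.1
  have h3 := t.2.2
  rcases h3.lt_or_eq with h | h
  · have := mul_pos (sub_pos.2 h) h1
    linarith
  · rw [h]
    norm_num

lemma pushOut_of_norm_eq_one {y : Fin n → ℝ} (hy : ‖y‖ = 1) (t : ℝ) : pushOut y t = y := by
  simp [pushOut, hy]

open Classical in
/-- The radial deformation of the punctured cells onto their boundary. -/
def cellFlow (c : ι → cell (univ : Set X) n) (x : X) (t : ℝ) : X :=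
  if h : ∃ i, x ∈ openCell n (c i) then
    map n (c h.choose) (pushOut ((map n (c h.choose)).symm x) t)
  else x

lemma cellFlow_of_mem_skelLT {x : X} (hx : x ∈ skelLT X n) (t : ℝ) : cellFlow c x t = x := by
  rw [cellFlow, dif_neg]
  rintro ⟨i, hi⟩
  exact disjoint_left.1 (disjoint_skelLT_openCell le_rfl (c i)) hx hi

/-- The radial deformation fixes the unit sphere, so one formula covers the whole closed ball even
though `cellFlow` is defined by cases. -/
lemma cellFlow_map (i : ι) {y : Fin n → ℝ} (hy : ‖y‖ ≤ 1) (t : ℝ) :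
    cellFlow c (map n (c i) y) t = map n (c i) (pushOut y t) := by
  rcases hy.lt_or_eq with h | h
  · have hx : (map n (c i) y : X) ∈ openCell n (c i) := map_mem_openCell h
    have hex : ∃ i', (map n (c i) y : X) ∈ openCell n (c i') := ⟨i, hx⟩
    rw [cellFlow, dif_pos hex]
    have : c hex.choose = c i := by
      have := eq_of_not_disjoint_openCell (not_disjoint_iff.2 ⟨_, hex.choose_spec, hx⟩)
      simpa using this
    rw [this, (map n (c i)).left_inv]
    rw [source_eq]
    exact mem_ball_zero_iff.2 h
  · rw [pushOut_of_norm_eq_one h, cellFlow_of_mem_skelLT (map_mem_skelLT h)]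

/-- The trajectory of a point of the closed ball under the radial deformation. -/
def pushOutPath (j : cell (univ : Set X) n) (y : Fin n → ℝ) (hy : ‖y‖ ≤ 1) :
    C(unitInterval, X) where
  toFun t := map n j (pushOut y t)
  continuous_toFun := by
    refine (RelCWComplex.continuousOn n j).comp_continuous ?_ fun t =>
      mem_closedBall_zero_iff.2 (norm_pushOut_le hy t)
    unfold pushOut
    fun_prop

omit [T2Space X] in
lemma continuous_pushOutPath (j : cell (univ : Set X) n) :
    Continuous fun y : {y : Fin n → ℝ // ‖y‖ ≤ 1 ∧ y ≠ 0} => pushOutPath j y.1 y.2.1 := by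
  refine ContinuousMap.continuous_of_continuous_uncurry _ ?_
  change Continuous fun p : {y : Fin n → ℝ // ‖y‖ ≤ 1 ∧ y ≠ 0} × unitInterval =>
    map n j (pushOut p.1.1 p.2)
  refine (RelCWComplex.continuousOn n j).comp_continuous ?_ fun p =>
      mem_closedBall_zero_iff.2 (norm_pushOut_le p.1.2.1 p.2)
  unfold pushOut
  have h : Continuous fun p : {y : Fin n → ℝ // ‖y‖ ≤ 1 ∧ y ≠ 0} × unitInterval => ‖p.1.1‖⁻¹ :=
    Continuous.inv₀ (by fun_prop) fun p => norm_ne_zero_iff.2 p.1.2.2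
  fun_prop

/-- The trajectory of a point of the punctured union under the radial deformation. -/
def cellFlowPath (c : ι → cell (univ : Set X) n) (x : puncturedUnion c) : C(unitInterval, X) where
  toFun t := cellFlow c x t
  continuous_toFun := by
    obtain ⟨x, hx⟩ := x
    rcases mem_puncturedUnion_cases hx with h | ⟨i, y, hy, h0, rfl⟩
    · simp only [cellFlow_of_mem_skelLT h]
      exact continuous_const
    · simp only [cellFlow_map i hy.le]
      exact (pushOutPath (c i) y hy.le).continuous

/-- Closedness can be tested cell by cell in `X`, but not directly in a product with the interval.
The homotopy is therefore curried and treated as a map from the punctured union to a space of paths.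
-/
lemma continuous_cellFlowPath : Continuous (cellFlowPath c) := by
  rw [continuous_iff_isClosed]
  intro K hK
  -- The punctured union need not be closed in `X`. Adding the centers repairs this, and they
  -- disappear again on restriction to the punctured union.
  suffices h : IsClosed (Subtype.val '' (cellFlowPath c ⁻¹' K) ∪ cellCenters X n) by
    have h2 : cellFlowPath c ⁻¹' K = Subtype.val ⁻¹'
        (Subtype.val '' (cellFlowPath c ⁻¹' K) ∪ cellCenters X n) := by
      rw [preimage_union, preimage_image_eq _ Subtype.val_injective]
      refine (union_eq_self_of_subset_right fun x hx => ?_).symm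
      exact (x.2.2 hx).elim
    rw [h2]
    exact h.preimage continuous_subtype_val
  have hsub : Subtype.val '' (cellFlowPath c ⁻¹' K) ⊆ cellUnion c := by
    rintro _ ⟨x, _, rfl⟩
    exact x.2.1
  refine CWComplex.isClosed_of_isClosed_inter_openCell_or_isClosed_inter_closedCell
    (subset_univ _) fun m _ j => ?_
  by_cases h : m < n
  · right
    have h1 := closedCell_subset_skelLT h j
    have h2 : (Subtype.val '' (cellFlowPath c ⁻¹' K) ∪ cellCenters X n) ∩ closedCell m j =
        (ContinuousMap.const unitInterval ⁻¹' K) ∩ closedCell m j := by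
      ext x
      have key : ∀ hx : x ∈ closedCell m j,
          cellFlowPath c ⟨x, skelLT_subset_puncturedUnion (h1 hx)⟩ =
            ContinuousMap.const unitInterval x := fun hx => by
        ext t
        exact cellFlow_of_mem_skelLT (h1 hx) t
      constructor
      · rintro ⟨⟨x, hx, rfl⟩ | hx, hj⟩
        · refine ⟨?_, hj⟩
          rw [mem_preimage, ← key hj]
          exact hx
        · exact (disjoint_left.1 disjoint_skelLT_cellCenters (h1 hj) hx).elim
      · rintro ⟨hx, hj⟩
        refine ⟨Or.inl ⟨⟨x, skelLT_subset_puncturedUnion (h1 hj)⟩, ?_, rfl⟩, hj⟩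
        rw [mem_preimage, key hj]
        exact hx
    rw [h2]
    exact (hK.preimage ContinuousMap.continuous_const').inter isClosed_closedCell
  · by_cases hj : ∃ i, (⟨n, c i⟩ : Σ n, cell (univ : Set X) n) = ⟨m, j⟩
    · right
      obtain ⟨i, hi⟩ := hj
      obtain rfl : n = m := congrArg Sigma.fst hi
      obtain rfl : c i = j := by simpa using hi
      -- On the punctured closed ball the preimage is the trace of a closed set `T`. With the origin
      -- added it becomes compact within the closed ball, so its image in the Hausdorff space is
      -- closed.
      obtain ⟨T, hT, hTK⟩ := isClosed_induced_iff.1 (hK.preimage (continuous_pushOutPath (c i)))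
      have h2 : (Subtype.val '' (cellFlowPath c ⁻¹' K) ∪ cellCenters X n) ∩ closedCell n (c i) =
          map n (c i) '' (({0} ∪ T) ∩ Metric.closedBall 0 1) := by
        have key : ∀ y : Fin n → ℝ, ∀ hy : ‖y‖ ≤ 1, ∀ h0 : y ≠ 0,
            (cellFlowPath c ⟨_, map_mem_puncturedUnion (i := i) hy h0⟩ ∈ K ↔ y ∈ T) := by
          intro y hy h0
          have h3 : cellFlowPath c ⟨_, map_mem_puncturedUnion (i := i) hy h0⟩ =
              pushOutPath (c i) y hy := by
            ext t
            exact cellFlow_map i hy t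
          rw [h3]
          exact (Set.ext_iff.1 hTK ⟨y, hy, h0⟩).symm
        ext x
        constructor
        · rintro ⟨hx, y, hy, rfl⟩
          refine ⟨y, ⟨?_, hy⟩, rfl⟩
          rw [mem_closedBall_zero_iff] at hy
          by_cases h0 : y = 0
          · exact Or.inl h0
          · right
            rcases hx with ⟨x, hx, hxy⟩ | hx
            · refine (key y hy h0).1 ?_
              obtain ⟨x, hx'⟩ := x
              obtain rfl : x = map n (c i) y := hxy
              exact hx
            · exact (h0 ((map_mem_cellCenters_iff hy).1 hx)).elim
        · rintro ⟨y, ⟨hyT, hy⟩, rfl⟩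
          refine ⟨?_, mem_image_of_mem _ hy⟩
          rw [mem_closedBall_zero_iff] at hy
          by_cases h0 : y = 0
          · exact Or.inr ((map_mem_cellCenters_iff hy).2 h0)
          · exact Or.inl ⟨_, (key y hy h0).2 (hyT.resolve_left h0), rfl⟩
      rw [h2]
      refine (IsCompact.image_of_continuousOn ?_ ((RelCWComplex.continuousOn n (c i)).mono
        inter_subset_right)).isClosed
      exact (isCompact_closedBall 0 1).inter_left (isClosed_singleton.union hT)
    · left
      have h3 : Disjoint (Subtype.val '' (cellFlowPath c ⁻¹' K)) (openCell m j) :=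
        (disjoint_cellUnion_openCell c (not_lt.1 h) (not_exists.1 hj)).mono_left hsub
      rw [union_inter_distrib_right, h3.inter_eq, empty_union]
      by_cases hm : m = n
      · subst hm
        rw [cellCenters_inter_openCell]
        exact isClosed_singleton
      · rw [(disjoint_cellCenters_openCell hm j).inter_eq]
        exact isClosed_empty

/-- The radial deformation as a homotopy. -/
def cellFlowHomotopy (c : ι → cell (univ : Set X) n) :
    C(puncturedUnion c × unitInterval, X) where
  toFun p := cellFlow c p.1 p.2
  continuous_toFun := ContinuousMap.continuous_uncurry_of_continuous
    ⟨cellFlowPath c, continuous_cellFlowPath⟩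

lemma relAcyclic_puncturedUnion {R : Type*} [CommRing R] (c : ι → cell (univ : Set X) n) :
    RelAcyclic (singBd R) (chainsIn R (puncturedUnion c)) (chainsIn R (skelLT X n)) := by
  have h := relAcyclic_of_deformation (R := R)
    (f := (⟨Subtype.val, continuous_subtype_val⟩ : C(puncturedUnion c, X)))
    Topology.IsEmbedding.subtypeVal (cellFlowHomotopy c) (A := skelLT X n) ?_ ?_ ?_ ?_
  · rwa [show range (⟨Subtype.val, continuous_subtype_val⟩ : C(puncturedUnion c, X)) =
      puncturedUnion c from Subtype.range_coe] at h
  · rintro ⟨x, hx⟩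
    change cellFlow c x 0 = x
    rcases mem_puncturedUnion_cases hx with h | ⟨i, y, hy, h0, rfl⟩
    · exact cellFlow_of_mem_skelLT h _
    · rw [cellFlow_map i hy.le]
      simp [pushOut]
  · rintro ⟨x, hx⟩
    change cellFlow c x 1 ∈ _
    rcases mem_puncturedUnion_cases hx with h | ⟨i, y, hy, h0, rfl⟩
    · rwa [cellFlow_of_mem_skelLT h]
    · rw [cellFlow_map i hy.le]
      refine map_mem_skelLT ?_
      rw [norm_pushOut h0 zero_le_one le_rfl]
      simp
  · rintro ⟨x, hx⟩ hx' t
    change x ∈ _ at hx'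
    change cellFlow c x t ∈ _
    rwa [cellFlow_of_mem_skelLT hx']
  · rintro ⟨x, hx⟩ t
    rw [show range (⟨Subtype.val, continuous_subtype_val⟩ : C(puncturedUnion c, X)) =
      puncturedUnion c from Subtype.range_coe]
    change cellFlow c x t ∈ _
    rcases mem_puncturedUnion_cases hx with h | ⟨i, y, hy, h0, rfl⟩
    · rwa [cellFlow_of_mem_skelLT h]
    · rw [cellFlow_map i hy.le]
      exact map_mem_puncturedUnion (norm_pushOut_le hy.le t) (pushOut_ne_zero h0 t)

end CellComplex
end

noncomputable section

/-! ### Homology of successive skeleta is free on the cells. -/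

section CellularHomology

open Topology RelCWComplex Set

variable {R : Type v} [CommRing R] {X : Type w} [TopologicalSpace X] [T2Space X]
  [CWComplex (univ : Set X)] {n : ℕ}

/-- Euclidean space as an open cell. -/
def cellChart (j : cell (univ : Set X) n) : C(Fin n → ℝ, X) where
  toFun x := map n j (OpenPartialHomeomorph.univUnitBall x)
  continuous_toFun :=
    ((RelCWComplex.continuousOn n j).mono Metric.ball_subset_closedBall).comp_continuous
      (continuousOn_univ.1 OpenPartialHomeomorph.univUnitBall.continuousOn_toFun)
      fun x => OpenPartialHomeomorph.univUnitBall.map_source (mem_univ x)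

lemma univUnitBall_mem (x : Fin n → ℝ) :
    OpenPartialHomeomorph.univUnitBall x ∈ Metric.ball (0 : Fin n → ℝ) 1 :=
  OpenPartialHomeomorph.univUnitBall.map_source (mem_univ x)

omit [T2Space X] in
lemma range_cellChart (j : cell (univ : Set X) n) : range (cellChart j) = openCell n j := by
  refine Subset.antisymm ?_ ?_
  · rintro _ ⟨x, rfl⟩
    exact mem_image_of_mem _ (univUnitBall_mem x)
  · rintro _ ⟨y, hy, rfl⟩
    refine ⟨OpenPartialHomeomorph.univUnitBall.symm y, ?_⟩
    change map n j (OpenPartialHomeomorph.univUnitBall _) = _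
    rw [OpenPartialHomeomorph.univUnitBall.right_inv hy]

lemma cellChart_mem_cellCenters_iff {j : cell (univ : Set X) n} {x : Fin n → ℝ} :
    cellChart j x ∈ cellCenters X n ↔ x = 0 := by
  change map n j (OpenPartialHomeomorph.univUnitBall x) ∈ _ ↔ _
  rw [map_mem_cellCenters_iff (mem_ball_zero_iff.1 (univUnitBall_mem x)).le]
  constructor
  · intro h
    rw [← OpenPartialHomeomorph.univUnitBall_apply_zero] at h
    exact OpenPartialHomeomorph.univUnitBall.injOn (mem_univ _) (mem_univ _) h
  · rintro rfl
    exact OpenPartialHomeomorph.univUnitBall_apply_zero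

/-- A function with a left inverse which is continuous on the range is inducing. -/
lemma isInducing_of_leftInverse {Y Z : Type*} [TopologicalSpace Y] [TopologicalSpace Z] {f : Y → Z}
    (hf : Continuous f) {g : Z → Y} (hgf : Function.LeftInverse g f)
    (hg : ContinuousOn g (range f)) : IsInducing f := by
  rw [isInducing_iff_nhds]
  refine fun x => le_antisymm hf.continuousAt.tendsto.le_comap ?_
  rw [← comap_nhdsWithin_range]
  have h := (hg (f x) (mem_range_self x)).tendsto.comp
    (Filter.tendsto_comap (f := f) (x := nhdsWithin (f x) (range f)))
  rw [hgf.comp_eq_id, hgf x] at h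
  exact Filter.tendsto_id'.1 h

omit [T2Space X] in
lemma isInducing_cellChart (j : cell (univ : Set X) n) : IsInducing (cellChart j) := by
  have hmem : ∀ x : Fin n → ℝ, OpenPartialHomeomorph.univUnitBall x ∈ (map n j).source := by
    intro x
    rw [source_eq]
    exact univUnitBall_mem x
  refine isInducing_of_leftInverse (cellChart j).continuous
    (g := fun x => OpenPartialHomeomorph.univUnitBall.symm ((map n j).symm x)) (fun x => ?_) ?_
  · change OpenPartialHomeomorph.univUnitBall.symm ((map n j).symm (map n j _)) = _
    rw [(map n j).left_inv (hmem x)]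
    exact OpenPartialHomeomorph.univUnitBall.left_inv (mem_univ x)
  · refine OpenPartialHomeomorph.univUnitBall.continuousOn_invFun.comp
      ((RelCWComplex.continuousOn_symm n j).mono ?_) ?_
    · rintro _ ⟨x, rfl⟩
      exact (map n j).map_source (hmem x)
    · rintro _ ⟨x, rfl⟩
      change (map n j).symm (map n j _) ∈ _
      rw [(map n j).left_inv (hmem x)]
      exact univUnitBall_mem x

omit [T2Space X] in
lemma cellChart_injective (j : cell (univ : Set X) n) : Function.Injective (cellChart j) :=
  fun _ _ h => OpenPartialHomeomorph.univUnitBall.injOn (mem_univ _) (mem_univ _)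
    (map_injOn j (univUnitBall_mem _) (univUnitBall_mem _) h)

lemma exists_relBasis_openCell (j : cell (univ : Set X) n) : ∃ z ∈ singDeg R X (n + 1),
    RelBasis (singBd R) (chainsIn R (openCell n j))
      (chainsIn R (openCell n j \ cellCenters X n)) (fun _ : Unit => z) := by
  obtain ⟨z, hz, h⟩ := exists_relBasis_euclidean (R := R) n
  refine ⟨push R (cellChart j) z, push_mem_singDeg hz, ?_⟩
  have h2 := h.map (push R (cellChart j)) (push_injective R (cellChart_injective j))
    (push_singBd (cellChart j))
  rw [map_push_chainsIn (isInducing_cellChart j), map_push_chainsIn (isInducing_cellChart j),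
    image_univ, range_cellChart] at h2
  have h3 : cellChart j '' {0}ᶜ = openCell n j \ cellCenters X n := by
    rw [← range_cellChart]
    ext x
    constructor
    · rintro ⟨y, hy, rfl⟩
      exact ⟨mem_range_self y, fun hc => hy (cellChart_mem_cellCenters_iff.1 hc)⟩
    · rintro ⟨⟨y, rfl⟩, hy⟩
      exact ⟨y, fun h0 => hy (cellChart_mem_cellCenters_iff.2 h0), rfl⟩
  rw [h3] at h2
  exact h2

variable {ι : Type*} {c : ι → cell (univ : Set X) n}

lemma openCell_inter_puncturedUnion (i : ι) :
    openCell n (c i) ∩ puncturedUnion c = openCell n (c i) \ cellCenters X n := by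
  ext x
  exact ⟨fun h => ⟨h.1, h.2.2⟩, fun h => ⟨h.1, Or.inr (mem_iUnion.2 ⟨i, h.1⟩), h.2⟩⟩

omit [T2Space X] in
lemma disjoint_openCell_of_injective (hc : Function.Injective c) {i j : ι} (h : i ≠ j) :
    Disjoint (openCell n (c i)) (openCell n (c j)) :=
  disjoint_openCell_of_ne fun e => h (hc (by simpa using e))

/-- A nonempty simplex in a disjoint union of open cells lies in one of them. -/
lemma range_subset_openCell (hc : Function.Injective c) {s : SingularSimplex X}
    (hs : range s.2 ⊆ ⋃ i, openCell n (c i)) (h0 : s.1 ≠ 0) :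
    ∃ i, range s.2 ⊆ openCell n (c i) := by
  -- Within the image of the simplex, an open cell is the complement of the closed union of the
  -- skeleton and the other cells. The preimages thus partition the connected simplex into open
  -- sets.
  have hopen : ∀ i, IsOpen (s.2 ⁻¹' openCell n (c i)) := by
    intro i
    have h1 : s.2 ⁻¹' openCell n (c i) =
        (s.2 ⁻¹' cellUnion fun j : {j : ι // j ≠ i} => c j)ᶜ := by
      ext t
      obtain ⟨i', hi'⟩ := mem_iUnion.1 (hs (mem_range_self t))
      constructor
      · intro ht ht'
        refine disjoint_left.1 (disjoint_cellUnion_openCell (fun j : {j : ι // j ≠ i} => c j)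
          (le_refl n) (j := c i) fun j hj => j.2 (hc (by simpa using hj))) ht' ht
      · intro ht
        by_cases h : i' = i
        · exact h ▸ hi'
        · exact (ht (Or.inr (mem_iUnion.2 ⟨⟨i', h⟩, hi'⟩))).elim
    rw [h1]
    exact ((isClosed_cellUnion _).preimage s.2.continuous).isOpen_compl
  have : PreconnectedSpace (TopSimplex s.1) :=
    Subtype.preconnectedSpace (convex_stdSimplex ℝ (Fin s.1)).isPreconnected
  obtain ⟨t⟩ := nonempty_topSimplex h0
  obtain ⟨i, hi⟩ := mem_iUnion.1 (hs (mem_range_self t))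
  refine ⟨i, ?_⟩
  have hclopen : IsClopen (s.2 ⁻¹' openCell n (c i)) := by
    refine ⟨⟨?_⟩, hopen i⟩
    have h2 : (s.2 ⁻¹' openCell n (c i))ᶜ =
        ⋃ j : {j : ι // j ≠ i}, s.2 ⁻¹' openCell n (c j) := by
      ext t
      obtain ⟨i', hi'⟩ := mem_iUnion.1 (hs (mem_range_self t))
      rw [mem_iUnion]
      constructor
      · intro ht
        exact ⟨⟨i', fun h => ht (h ▸ hi')⟩, hi'⟩
      · rintro ⟨j, hj⟩ ht
        exact disjoint_left.1 (disjoint_openCell_of_injective hc j.2) hj ht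
    rw [h2]
    exact isOpen_iUnion fun j => hopen j
  have huniv := hclopen.eq_univ ⟨t, hi⟩
  rintro _ ⟨t, rfl⟩
  exact huniv.symm.subset (mem_univ t)

/-- Away from the lower skeleton the union consists of disjoint open cells, and connectedness puts
every nonempty simplex in one of them. The sum is thus the complex of chains small for two open
sets: the complements of the skeleton and of the centers. -/
lemma iSup_chainsIn_openCell (hc : Function.Injective c) :
    (⨆ i, chainsIn R (openCell n (c i))) ⊔ chainsIn R (puncturedUnion c) =
      chainsIn R (cellUnion c ∩ (skelLT X n)ᶜ) ⊔
        chainsIn R (cellUnion c ∩ (cellCenters X n)ᶜ) := by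
  have hle : ∀ i, openCell n (c i) ⊆ cellUnion c ∩ (skelLT X n)ᶜ := fun i x hx =>
    ⟨Or.inr (mem_iUnion.2 ⟨i, hx⟩),
      fun h => disjoint_left.1 (disjoint_skelLT_openCell le_rfl (c i)) h hx⟩
  refine le_antisymm (sup_le_sup_right (iSup_le fun i => chainsIn_mono (hle i)) _)
    (sup_le (chainsIn_le_of_single fun s hs => ?_) le_sup_right)
  · by_cases h0 : s.1 = 0
    · rw [eq_emptySimplex h0]
      exact Submodule.mem_sup_right (single_mem_chainsIn (range_emptySimplex _) 1)
    · obtain ⟨i, hi⟩ := range_subset_openCell hc (s := s)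
        (fun x hx => (hs hx).1.resolve_left (hs hx).2) h0
      exact Submodule.mem_sup_left (Submodule.mem_iSup_of_mem i (single_mem_chainsIn hi 1))

omit [T2Space X] [CWComplex (univ : Set X)] in
/-- Chains in disjoint sets are independent modulo chains in a further set. -/
lemma chainsIn_independent {A : ι → Set X} {D : Set X}
    (hA : ∀ i j, i ≠ j → Disjoint (A i) (A j)) (f : ι → SingularChain R X) (s : Finset ι)
    (hf : ∀ i, f i ∈ chainsIn R (A i)) (h : ∑ i ∈ s, f i ∈ chainsIn R D) (i : ι) (hi : i ∈ s) :
    f i ∈ chainsIn R D := by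
  refine (Finsupp.mem_supported R _).2 fun σ hσ => ?_
  by_cases h0 : σ.1 = 0
  · rw [mem_ofPred_eq, eq_emptySimplex h0]
    exact range_emptySimplex D
  · refine (Finsupp.mem_supported R _).1 h (Finsupp.mem_support_iff.2 ?_)
    rw [Finsupp.finsetSum_apply, Finset.sum_eq_single_of_mem i hi]
    · exact Finsupp.mem_support_iff.1 hσ
    · intro j _ hji
      by_contra hne
      obtain ⟨t⟩ := nonempty_topSimplex h0
      have h1 := (Finsupp.mem_supported R _).1 (hf j) (Finsupp.mem_support_iff.2 hne)
      have h2 := (Finsupp.mem_supported R _).1 (hf i) hσ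
      exact disjoint_left.1 (hA j i hji) (h1 (mem_range_self t)) (h2 (mem_range_self t))

/-- Excision assembles the local classes of the single cells, and small simplices replace the
resulting sum by all chains. -/
lemma relBasis_cellUnion_of_openCell (hc : Function.Injective c) {z : ι → SingularChain R X}
    (hz : ∀ i, RelBasis (singBd R) (chainsIn R (openCell n (c i)))
      (chainsIn R (openCell n (c i) \ cellCenters X n)) (fun _ : Unit => z i)) :
    RelBasis (singBd R) (chainsIn R (cellUnion c)) (chainsIn R (puncturedUnion c)) z := by
  have h1 : RelBasis (singBd R) ((⨆ i, chainsIn R (openCell n (c i))) ⊔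
      chainsIn R (puncturedUnion c)) (chainsIn R (puncturedUnion c)) z := by
    refine RelBasis.iSup_sup (fun i => ?_) (fun i x hx => singBd_mem_chainsIn hx)
      (fun x hx => singBd_mem_chainsIn hx) fun f s hf h i hi =>
        chainsIn_independent (fun i j h => disjoint_openCell_of_injective hc h) f s hf h i hi
    rw [← chainsIn_inter, openCell_inter_puncturedUnion]
    exact hz i
  refine h1.enlarge_top le_sup_right ?_ ?_ singBd_singBd
  · rw [iSup_chainsIn_openCell hc]
    exact sup_le (chainsIn_mono inter_subset_left) (chainsIn_mono inter_subset_left)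
  · rw [iSup_chainsIn_openCell hc]
    refine relAcyclic_small (isClosed_skelLT n).isOpen_compl
      (isClosed_cellCenters X n).isOpen_compl ?_
    rw [← compl_inter, disjoint_skelLT_cellCenters.inter_eq, compl_empty]
    exact subset_univ _

lemma chainsIn_skelLT_le (c : ι → cell (univ : Set X) n) :
    chainsIn R (skelLT X n) ≤ chainsIn R (puncturedUnion c) :=
  chainsIn_mono skelLT_subset_puncturedUnion

lemma chainsIn_puncturedUnion_le (c : ι → cell (univ : Set X) n) :
    chainsIn R (puncturedUnion c) ≤ chainsIn R (cellUnion c) :=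
  chainsIn_mono sdiff_subset

variable (R X n) in
/-- The homology of a skeleton relative to the preceding one is free on the cells. -/
theorem exists_relBasis_skelLT : ∃ z : cell (univ : Set X) n → SingularChain R X,
    (∀ j, z j ∈ singDeg R X (n + 1)) ∧
    RelBasis (singBd R) (chainsIn R (skelLT X (n + 1))) (chainsIn R (skelLT X n)) z ∧
    ∀ j, RelBasis (singBd R) (chainsIn R (skelLT X n ∪ openCell n j)) (chainsIn R (skelLT X n))
      (fun _ : Unit => z j) := by
  choose z hzn hz using fun j : cell (univ : Set X) n => exists_relBasis_openCell (R := R) j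
  have h1 : ∀ j : cell (univ : Set X) n, cellUnion (fun _ : Unit => j) =
      skelLT X n ∪ openCell n j := fun j => by
    rw [cellUnion, iUnion_const]
  have hall : cellUnion (fun j : cell (univ : Set X) n => j) = skelLT X (n + 1) := by
    rw [skelLT_succ, cellUnion]
  have hsingle := fun j => relBasis_cellUnion_of_openCell (R := R) (c := fun _ : Unit => j)
    (fun _ _ _ => rfl) (z := fun _ => z j) (fun _ => hz j)
  -- The local cycle has boundary in the punctured union, and `e j` corrects it so that the boundary
  -- lies in the skeleton. Since `e j` is taken in the union with the single cell `j`, the same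
  -- corrected cycle serves both for that cell and for all cells together.
  choose e he hen hed using fun j : cell (univ : Set X) n =>
    (relAcyclic_puncturedUnion (R := R) fun _ : Unit => j).exists_mem_singDeg
      (isHomogeneousComplex_chainsIn _) (isHomogeneousComplex_chainsIn _) (n := n)
      (singBd_mem_singDeg (hzn j)) ((hsingle j).d_mem ⟨⟩)
      (by rw [singBd_singBd]; exact zero_mem _)
  have hsub : ∀ j, chainsIn R (puncturedUnion fun _ : Unit => j) ≤
      chainsIn R (puncturedUnion fun j : cell (univ : Set X) n => j) := fun j =>
    chainsIn_mono (sdiff_subset_sdiff_left (union_subset_union_right _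
      (iUnion_subset fun _ => subset_iUnion (fun j : cell (univ : Set X) n => openCell n j) j)))
  have hall' := relBasis_cellUnion_of_openCell (R := R) (c := fun j : cell (univ : Set X) n => j)
    (fun _ _ h => h) hz
  refine ⟨fun j => z j - e j, fun j => Submodule.sub_mem _ (hzn j) (hen j), ?_, fun j => ?_⟩
  · rw [← hall]
    refine hall'.shrink_bot (chainsIn_puncturedUnion_le _) (relAcyclic_puncturedUnion _) (chainsIn_skelLT_le _) singBd_singBd
      (fun j => Submodule.sub_mem _ (hall'.mem j) (chainsIn_puncturedUnion_le _ (hsub j (he j)))) (fun j => ?_)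
      fun j => ?_
    · rw [map_sub]
      exact hed j
    · rw [sub_sub_cancel]
      exact hsub j (he j)
  · have h3 := (hsingle j).shrink_bot (z' := fun _ => z j - e j) (chainsIn_puncturedUnion_le _)
      (relAcyclic_puncturedUnion _) (chainsIn_skelLT_le _) singBd_singBd
      (fun _ => Submodule.sub_mem _ ((hsingle j).mem ⟨⟩) (chainsIn_puncturedUnion_le _ (he j))) (fun _ => ?_)
      fun _ => ?_
    · rw [cellUnion, iUnion_const] at h3
      exact h3
    · rw [map_sub]
      exact hed j
    · rw [sub_sub_cancel]
      exact he j

end CellularHomology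
end

noncomputable section

/-! ### Relative homology as a module with group action. -/

section RelativeHomology

variable {R M : Type*} [CommRing R] [AddCommGroup M] [Module R M] (d : M →ₗ[R] M)

/-- The relative cycles of `C` modulo `A`. -/
def relCycles (C A : Submodule R M) : Submodule R M := C ⊓ A.comap d

/-- The relative boundaries of `C` modulo `A`. -/
def relBoundaries (C A : Submodule R M) : Submodule R (relCycles d C A) :=
  (A ⊔ C.map d).comap (relCycles d C A).subtype

/-- The homology of the subcomplex `C` relative to the subcomplex `A`. -/
abbrev RelHomology (C A : Submodule R M) : Type _ := relCycles d C A ⧸ relBoundaries d C A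

variable {d} {A B C A' C' : Submodule R M}

lemma mem_relCycles {x : M} : x ∈ relCycles d C A ↔ x ∈ C ∧ d x ∈ A := Iff.rfl

/-- The class of a relative cycle. -/
def RelHomology.cls : relCycles d C A →ₗ[R] RelHomology d C A := Submodule.mkQ _

lemma RelHomology.cls_surjective : Function.Surjective (RelHomology.cls : _ →ₗ[R] RelHomology d C A) :=
  Submodule.mkQ_surjective _

lemma RelHomology.cls_eq_zero_iff {x : relCycles d C A} :
    RelHomology.cls x = 0 ↔ ∃ e ∈ C, x.1 - d e ∈ A := by
  rw [RelHomology.cls, Submodule.mkQ_apply, Submodule.Quotient.mk_eq_zero]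
  change x.1 ∈ A ⊔ C.map d ↔ _
  constructor
  · intro h
    obtain ⟨a, ha, _, ⟨e, he, rfl⟩, h'⟩ := Submodule.mem_sup.1 h
    exact ⟨e, he, by rwa [← h', add_sub_cancel_right]⟩
  · rintro ⟨e, he, h⟩
    rw [← sub_add_cancel x.1 (d e)]
    exact Submodule.add_mem_sup h (Submodule.mem_map_of_mem he)

/-- Functoriality of relative homology. -/
def RelHomology.map (f : M →ₗ[R] M) (hf : ∀ x, f (d x) = d (f x)) (hC : C ≤ C'.comap f)
    (hA : A ≤ A'.comap f) : RelHomology d C A →ₗ[R] RelHomology d C' A' :=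
  Submodule.mapQ _ _ (f.restrict (p := relCycles d C A) (q := relCycles d C' A') fun x hx =>
    ⟨hC hx.1, by
      have := hA hx.2
      rw [Submodule.mem_comap, hf] at this
      exact this⟩) fun x hx => by
    obtain ⟨a, ha, _, ⟨e, he, rfl⟩, h'⟩ := Submodule.mem_sup.1 hx
    change f x.1 ∈ A' ⊔ C'.map d
    change _ = x.1 at h'
    rw [← h', map_add, hf]
    exact Submodule.add_mem_sup (hA ha) (Submodule.mem_map_of_mem (hC he))

lemma RelHomology.map_cls (f : M →ₗ[R] M) (hf : ∀ x, f (d x) = d (f x)) (hC : C ≤ C'.comap f)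
    (hA : A ≤ A'.comap f) (x : relCycles d C A) (y : relCycles d C' A') (h : f x.1 = y.1) :
    RelHomology.map f hf hC hA (RelHomology.cls x) = RelHomology.cls y := by
  change RelHomology.cls _ = _
  congr 1
  exact Subtype.ext h

/-- The connecting homomorphism in the homology of a triple. -/
def RelHomology.connecting (hdd : ∀ x, d (d x) = 0) :
    RelHomology d C B →ₗ[R] RelHomology d B A :=
  Submodule.mapQ _ _ (d.restrict (p := relCycles d C B) (q := relCycles d B A) fun x hx =>
    ⟨hx.2, by
      change d (d x) ∈ A
      rw [hdd]
      exact zero_mem _⟩) fun x hx => by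
    obtain ⟨a, ha, _, ⟨e, he, rfl⟩, h'⟩ := Submodule.mem_sup.1 hx
    change d x.1 ∈ A ⊔ B.map d
    change _ = x.1 at h'
    rw [← h', map_add, hdd, add_zero]
    exact Submodule.mem_sup_right (Submodule.mem_map_of_mem ha)

lemma RelHomology.connecting_cls (hdd : ∀ x, d (d x) = 0) (x : relCycles d C B)
    (y : relCycles d B A) (h : d x.1 = y.1) :
    RelHomology.connecting hdd (RelHomology.cls x) = RelHomology.cls y := by
  change RelHomology.cls _ = _
  congr 1
  exact Subtype.ext h

/-- The relative cycles underlying a basis of relative homology. -/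
def RelBasis.cycle {ι : Type*} {z : ι → M} (h : RelBasis d C A z) (i : ι) : relCycles d C A :=
  ⟨z i, mem_relCycles.2 ⟨h.mem i, h.d_mem i⟩⟩

lemma RelBasis.coe_linearCombination_cycle {ι : Type*} {z : ι → M} (h : RelBasis d C A z)
    (r : ι →₀ R) : (Finsupp.linearCombination R h.cycle r).1 = Finsupp.linearCombination R z r :=
  Finsupp.apply_linearCombination R (relCycles d C A).subtype h.cycle r

/-- The basis of relative homology given by relative cycles. -/
def RelBasis.basis {ι : Type*} {z : ι → M} (h : RelBasis d C A z) :
    Module.Basis ι R (RelHomology d C A) :=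
  Module.Basis.mk (v := RelHomology.cls ∘ h.cycle)
    (by
      rw [linearIndependent_iff]
      intro r hr
      rw [← Finsupp.apply_linearCombination R RelHomology.cls, RelHomology.cls_eq_zero_iff,
        h.coe_linearCombination_cycle] at hr
      obtain ⟨e, he, hre⟩ := hr
      exact h.indep r e he hre)
    (by
      intro x _
      obtain ⟨c, rfl⟩ := RelHomology.cls_surjective x
      obtain ⟨r, e, he, h'⟩ := h.span c.1 c.2.1 c.2.2
      rw [Finsupp.mem_span_range_iff_exists_finsupp]
      refine ⟨r, ?_⟩
      rw [← Finsupp.linearCombination_apply, ← Finsupp.apply_linearCombination R RelHomology.cls,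
        eq_comm, ← sub_eq_zero, ← map_sub, RelHomology.cls_eq_zero_iff]
      refine ⟨e, he, ?_⟩
      rwa [AddSubgroupClass.coe_sub, h.coe_linearCombination_cycle])

lemma RelBasis.basis_apply {ι : Type*} {z : ι → M} (h : RelBasis d C A z) (i : ι) :
    h.basis i = RelHomology.cls (h.cycle i) := by
  rw [RelBasis.basis, Module.Basis.mk_apply]
  rfl

variable {G : Type*} [Group G] {ρ : Representation R G M}

/-- The group action on relative homology. -/
def relHomologyRep (hρ : ∀ g x, ρ g (d x) = d (ρ g x)) (hC : ∀ g, C ≤ C.comap (ρ g))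
    (hA : ∀ g, A ≤ A.comap (ρ g)) : Representation R G (RelHomology d C A) where
  toFun g := RelHomology.map (ρ g) (hρ g) (hC g) (hA g)
  map_one' := by
    refine LinearMap.ext fun x => ?_
    obtain ⟨c, rfl⟩ := RelHomology.cls_surjective x
    rw [RelHomology.map_cls _ _ _ _ c c (by rw [map_one]; rfl)]
    rfl
  map_mul' g h := by
    refine LinearMap.ext fun x => ?_
    obtain ⟨c, rfl⟩ := RelHomology.cls_surjective x
    have hmem : ∀ g, ∀ x ∈ relCycles d C A, ρ g x ∈ relCycles d C A := fun g x hx =>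
      mem_relCycles.2 ⟨hC g hx.1, by
        rw [← hρ]
        exact hA g hx.2⟩
    rw [Module.End.mul_apply, RelHomology.map_cls (ρ h) _ _ _ c ⟨_, hmem h _ c.2⟩ rfl,
      RelHomology.map_cls (ρ g) _ _ _ _ ⟨_, hmem g _ (hmem h _ c.2)⟩ rfl,
      RelHomology.map_cls (ρ (g * h)) _ _ _ c ⟨_, hmem g _ (hmem h _ c.2)⟩ (by
        rw [map_mul, Module.End.mul_apply])]

lemma relHomologyRep_cls (hρ : ∀ g x, ρ g (d x) = d (ρ g x)) (hC : ∀ g, C ≤ C.comap (ρ g))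
    (hA : ∀ g, A ≤ A.comap (ρ g)) (g : G) (x y : relCycles d C A) (h : ρ g x.1 = y.1) :
    relHomologyRep hρ hC hA g (RelHomology.cls x) = RelHomology.cls y :=
  RelHomology.map_cls (ρ g) (hρ g) (hC g) (hA g) x y h

end RelativeHomology

/-! ### Short exact sequences from the homology of a pair. -/

section Tower

open CategoryTheory Limits

variable {R : Type v} {M : Type (max v w)} [CommRing R] [AddCommGroup M] [Module R M]
  {d : M →ₗ[R] M} {G : Type u} [Group G] {ρ : Representation R G M}

/-- The short exact sequence of homology of a pair, if the homology of the smaller complex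
vanishes in the larger one. -/
lemma exists_shortExact_relHomology {C A : Submodule R M} (hdd : ∀ x, d (d x) = 0)
    (hρ : ∀ g x, ρ g (d x) = d (ρ g x)) (hC : ∀ g, C ≤ C.comap (ρ g))
    (hA : ∀ g, A ≤ A.comap (ρ g)) (hbot : ∀ g, (⊥ : Submodule R M) ≤ (⊥ : Submodule R M).comap (ρ g))
    (hAC : A ≤ C)
    (hzero : ∀ a ∈ A, d a = 0 → ∃ e ∈ C, d e = a) :
    ∃ (f : Rep.of (relHomologyRep hρ hC hbot).ulift ⟶
        Rep.of ((relHomologyRep hρ hC hA).ulift : Representation R G (ULift.{u} _)))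
      (g : Rep.of (relHomologyRep hρ hC hA).ulift ⟶ Rep.of (relHomologyRep hρ hA hbot).ulift)
      (w : f ≫ g = 0), (ShortComplex.mk f g w).ShortExact := by
  have hmem : ∀ {C A : Submodule R M}, (∀ g, C ≤ C.comap (ρ g)) → (∀ g, A ≤ A.comap (ρ g)) →
      ∀ g, ∀ x ∈ relCycles d C A, ρ g x ∈ relCycles d C A := fun hC hA g x hx =>
    mem_relCycles.2 ⟨hC g hx.1, by
      rw [← hρ]
      exact hA g hx.2⟩
  have hcyc : ∀ x : relCycles d C ⊥, x.1 ∈ relCycles d C A := fun x =>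
    mem_relCycles.2 ⟨x.2.1, (bot_le : (⊥ : Submodule R M) ≤ A) x.2.2⟩
  have hconn : ∀ x : relCycles d C A, d x.1 ∈ relCycles d A ⊥ := fun x =>
    mem_relCycles.2 ⟨x.2.2, by
      rw [hdd]
      exact zero_mem _⟩
  have h := Representation.shortExact_ulift.{u, v, w} (α := relHomologyRep hρ hC hbot)
    (β := relHomologyRep hρ hC hA) (γ := relHomologyRep hρ hA hbot)
    (RelHomology.map LinearMap.id (fun _ => rfl) le_rfl bot_le) (fun g x => ?_)
    (RelHomology.connecting hdd) (fun g x => ?_) ?_ ?_ ?_ ?_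
  · exact ⟨_, _, h⟩
  · obtain ⟨c, rfl⟩ := RelHomology.cls_surjective x
    rw [relHomologyRep_cls hρ hC hbot g c ⟨_, hmem hC hbot g _ c.2⟩ rfl,
      RelHomology.map_cls LinearMap.id _ _ _ _ ⟨_, hcyc ⟨_, hmem hC hbot g _ c.2⟩⟩ rfl,
      RelHomology.map_cls LinearMap.id _ _ _ _ ⟨_, hcyc c⟩ rfl,
      relHomologyRep_cls hρ hC hA g ⟨_, hcyc c⟩ ⟨_, hcyc ⟨_, hmem hC hbot g _ c.2⟩⟩ rfl]
  · obtain ⟨c, rfl⟩ := RelHomology.cls_surjective x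
    rw [relHomologyRep_cls hρ hC hA g c ⟨_, hmem hC hA g _ c.2⟩ rfl,
      RelHomology.connecting_cls hdd _ ⟨_, hconn ⟨_, hmem hC hA g _ c.2⟩⟩ rfl,
      RelHomology.connecting_cls hdd c ⟨_, hconn c⟩ rfl,
      relHomologyRep_cls hρ hA hbot g ⟨_, hconn c⟩ ⟨_, hconn ⟨_, hmem hC hA g _ c.2⟩⟩ (hρ g _)]
  · rw [← LinearMap.ker_eq_bot, LinearMap.ker_eq_bot']
    intro x hx
    obtain ⟨c, rfl⟩ := RelHomology.cls_surjective x
    rw [RelHomology.map_cls LinearMap.id _ _ _ _ ⟨_, hcyc c⟩ rfl, RelHomology.cls_eq_zero_iff] at hx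
    obtain ⟨e, he, h⟩ := hx
    have hdc : d c.1 = 0 := c.2.2
    obtain ⟨e', he', h'⟩ := hzero _ h (by rw [map_sub, hdd, sub_zero, hdc])
    rw [RelHomology.cls_eq_zero_iff]
    refine ⟨e + e', C.add_mem he he', ?_⟩
    rw [Submodule.mem_bot, map_add, h']
    simp
  · intro x
    obtain ⟨c, rfl⟩ := RelHomology.cls_surjective x
    obtain ⟨e, he, h⟩ := hzero c.1 c.2.1 c.2.2
    exact ⟨RelHomology.cls ⟨e, mem_relCycles.2 ⟨he, h.symm ▸ c.2.1⟩⟩, RelHomology.connecting_cls hdd _ c h⟩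
  · intro x
    obtain ⟨c, rfl⟩ := RelHomology.cls_surjective x
    rw [RelHomology.map_cls LinearMap.id _ _ _ _ ⟨_, hcyc c⟩ rfl,
      RelHomology.connecting_cls hdd _ ⟨_, hconn ⟨_, hcyc c⟩⟩ rfl, RelHomology.cls_eq_zero_iff]
    refine ⟨0, zero_mem _, ?_⟩
    rw [map_zero, sub_zero]
    exact c.2.2
  · intro x hx
    obtain ⟨c, rfl⟩ := RelHomology.cls_surjective x
    rw [RelHomology.connecting_cls hdd _ ⟨_, hconn c⟩ rfl, RelHomology.cls_eq_zero_iff] at hx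
    obtain ⟨a, ha, h⟩ := hx
    have hc' : c.1 - a ∈ relCycles d C ⊥ := mem_relCycles.2 ⟨C.sub_mem c.2.1 (hAC ha), by
      rw [map_sub]
      exact h⟩
    refine ⟨RelHomology.cls ⟨_, hc'⟩, ?_⟩
    rw [RelHomology.map_cls LinearMap.id _ _ _ _ ⟨_, hcyc ⟨_, hc'⟩⟩ rfl, ← sub_eq_zero, ← map_sub,
      RelHomology.cls_eq_zero_iff]
    refine ⟨0, zero_mem _, ?_⟩
    rw [map_zero, sub_zero]
    change c.1 - a - c.1 ∈ A
    rw [sub_sub_cancel_left]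
    exact A.neg_mem ha

end Tower
end

noncomputable section
open scoped Pointwise

/-! ### Inclusions of successive skeleta vanish on homology. -/

section SkeletalFiltration

open Topology RelCWComplex Set

variable {R : Type v} [CommRing R] {X : Type w} [TopologicalSpace X] [T2Space X]
  [CWComplex (univ : Set X)]

omit [T2Space X] [CWComplex (univ : Set X)] in
lemma singBd_singComp_of_cycle {c : SingularChain R X} (hdc : singBd R c = 0) (m : ℕ) :
    singBd R (singComp R m c) = 0 := by
  cases m with
  | zero => exact singBd_singComp_zero c
  | succ m => rw [singBd_singComp, hdc, map_zero]

omit [T2Space X] [CWComplex (univ : Set X)] in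
/-- The linear combination of relative cycles of degree `n` has no component in other degrees. -/
lemma singComp_linearCombination {ι : Type*} {z : ι → SingularChain R X} {n m : ℕ}
    (hz : ∀ i, z i ∈ singDeg R X n) (hnm : n ≠ m) (r : ι →₀ R) :
    singComp R m (Finsupp.linearCombination R z r) = 0 :=
  singComp_of_mem_ne hnm (linearCombination_mem_of_forall hz r)

/-- The homology of the skeleton of dimension less than `n` vanishes above dimension `n - 1`. -/
lemma exists_singBd_eq_of_lt (n : ℕ) : ∀ m, n < m → ∀ c ∈ chainsIn R (skelLT X n),
    c ∈ singDeg R X m → singBd R c = 0 → ∃ e ∈ chainsIn R (skelLT X n), singBd R e = c := by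
  induction n with
  | zero =>
    intro m hm c hc hcm _
    rw [skelLT_zero] at hc
    obtain ⟨r, rfl⟩ := exists_eq_smul_of_mem_chainsIn_empty hc
    refine ⟨0, zero_mem _, ?_⟩
    rw [map_zero, ← singComp_of_mem hcm, singComp_of_mem_ne hm.ne]
    exact Submodule.smul_mem _ _ (Finsupp.single_mem_supported R 1 rfl)
  | succ n ih =>
    intro m hm c hc hcm hdc
    obtain ⟨z, hz, hb, -⟩ := exists_relBasis_skelLT R X n
    obtain ⟨r, e, he, h⟩ := hb.span c hc (by rw [hdc]; exact zero_mem _)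
    have h1 := singComp_mem_chainsIn m h
    -- The basis cycles have `n + 1 < m` vertices, so they do not contribute in degree `m`: the
    -- cycle is homologous to one in the smaller skeleton.
    rw [map_sub, map_sub, singComp_of_mem hcm, singComp_linearCombination hz hm.ne, sub_zero,
      ← singBd_singComp] at h1
    have hm' : c - singBd R (singComp R (m + 1) e) ∈ singDeg R X m :=
      Submodule.sub_mem _ hcm (singBd_mem_singDeg (singComp_mem_singDeg (m + 1) e))
    obtain ⟨e', he', h'⟩ := ih m (by omega) _ h1 hm' (by
      rw [map_sub, hdc, singBd_singBd, sub_zero])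
    refine ⟨e' + singComp R (m + 1) e, Submodule.add_mem _
      (chainsIn_mono (skelLT_mono n.le_succ) he') (singComp_mem_chainsIn _ he), ?_⟩
    rw [map_add, h', sub_add_cancel]

/-- The homology of a skeleton vanishes below its dimension if the space is contractible. -/
lemma exists_singBd_eq_of_gt [ContractibleSpace X] [FiniteDimensional (univ : Set X)] (n : ℕ) :
    ∀ m, m < n → ∀ c ∈ chainsIn R (skelLT X n),
    c ∈ singDeg R X m → singBd R c = 0 → ∃ e ∈ chainsIn R (skelLT X n), singBd R e = c := by
  obtain ⟨N, hN⟩ := exists_skelLT_eq_univ X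
  by_cases hn : N ≤ n
  · intro m _ c hc _ hdc
    rw [hN n hn] at hc ⊢
    obtain ⟨e, he, h⟩ := relAcyclic_of_contractibleSpace (R := R) c hc
      (by rw [hdc]; exact zero_mem _)
    rw [Submodule.mem_bot, sub_eq_zero] at h
    exact ⟨e, he, h.symm⟩
  -- Descending induction from the whole space, where contractibility supplies a bounding chain.
  · obtain ⟨k, rfl⟩ : ∃ k, n = N - k := ⟨N - n, by omega⟩
    induction k with
    | zero => exact (hn (by omega)).elim
    | succ k ih =>
      intro m hm c hc hcm hdc
      have hlt : N - (k + 1) + 1 = N - k := by omega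
      have ih' : ∀ c ∈ chainsIn R (skelLT X (N - k)), c ∈ singDeg R X m → singBd R c = 0 →
          ∃ e ∈ chainsIn R (skelLT X (N - k)), singBd R e = c := by
        by_cases h : N ≤ N - k
        · intro c hc _ hdc
          rw [hN _ h] at hc ⊢
          obtain ⟨e, he, h⟩ := relAcyclic_of_contractibleSpace (R := R) c hc
            (by rw [hdc]; exact zero_mem _)
          rw [Submodule.mem_bot, sub_eq_zero] at h
          exact ⟨e, he, h.symm⟩
        · exact ih h m (by omega)
      rw [← hlt] at ih'
      obtain ⟨e, he, hde⟩ := ih' c (chainsIn_mono (skelLT_mono (Nat.le_succ _)) hc) hcm hdc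
      obtain ⟨z, hz, hb, -⟩ := exists_relBasis_skelLT R X (N - (k + 1))
      obtain ⟨r, f, hf, h⟩ := hb.span e he (by rw [hde]; exact hc)
      -- The chain bounding in the next skeleton has degree `m + 1`, below the degree of the
      -- relative basis cycles. Up to a boundary it can therefore be moved into the smaller
      -- skeleton.
      have h1 := singComp_mem_chainsIn (m + 1) h
      rw [map_sub, map_sub, singComp_linearCombination hz (by omega), sub_zero,
        ← singBd_singComp] at h1
      refine ⟨_, h1, ?_⟩
      rw [map_sub, singBd_singBd, sub_zero, singBd_singComp, hde, singComp_of_mem hcm]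

/-- The map in homology induced by the inclusion of a skeleton in the next one is zero. -/
lemma exists_singBd_eq_of_skelLT [ContractibleSpace X] [FiniteDimensional (univ : Set X)] {n : ℕ}
    {c : SingularChain R X} (hc : c ∈ chainsIn R (skelLT X n)) (hdc : singBd R c = 0) :
    ∃ e ∈ chainsIn R (skelLT X (n + 1)), singBd R e = c := by
  have hle : chainsIn R (skelLT X n) ≤ chainsIn R (skelLT X (n + 1)) :=
    chainsIn_mono (skelLT_mono n.le_succ)
  have h : ∀ m, ∃ e ∈ chainsIn R (skelLT X (n + 1)), singBd R e = singComp R m c := by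
    intro m
    have h1 := singComp_mem_chainsIn m hc
    have h2 := singComp_mem_singDeg m c
    have h3 := singBd_singComp_of_cycle hdc m
    -- In degrees above `n` a cycle already bounds in the same skeleton; in degrees at most `n` it
    -- lies below the degree of the next skeleton and bounds there.
    rcases lt_or_ge n m with hm | hm
    · obtain ⟨e, he, h⟩ := exists_singBd_eq_of_lt n m hm _ h1 h2 h3
      exact ⟨e, hle he, h⟩
    · exact exists_singBd_eq_of_gt (n + 1) m (by omega) _ (hle h1) h2 h3
  choose e he hde using h
  obtain ⟨s, hs⟩ := exists_eq_sum_singComp c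
  refine ⟨∑ m ∈ s, e m, Submodule.sum_mem _ fun m _ => he m, ?_⟩
  rw [map_sum, hs, ← hs]
  exact (Finset.sum_congr rfl fun m _ => hde m).trans hs.symm

end SkeletalFiltration

/-! ### The action on chains and on cells. -/

section Action

open Topology RelCWComplex Set

variable (R : Type v) [CommRing R] (G : Type u) [Group G] (X : Type w) [TopologicalSpace X]

/-- The translation by a group element. -/
def smulMap {G : Type u} [Group G] {X : Type w} [TopologicalSpace X] [MulAction G X]
    [ContinuousConstSMul G X] (g : G) : C(X, X) :=
  ⟨fun x => g • x, continuous_const_smul g⟩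

/-- The group action on singular chains. -/
def chainRep [MulAction G X] [ContinuousConstSMul G X] : Representation R G (SingularChain R X) where
  toFun g := push R (smulMap g)
  map_one' := by
    refine LinearMap.ext fun x => ?_
    have : smulMap (1 : G) = ContinuousMap.id X := by
      ext x
      exact one_smul G x
    rw [this, push_id]
    rfl
  map_mul' g h := by
    refine LinearMap.ext fun x => ?_
    rw [Module.End.mul_apply, push_push]
    congr 2
    ext x
    exact mul_smul g h x

variable {R G X}

lemma chainsIn_le_comap_chainRep [MulAction G X] [ContinuousConstSMul G X] {A B : Set X} {g : G}
    (h : MapsTo (g • ·) A B) : chainsIn R A ≤ (chainsIn R B).comap (chainRep R G X g) :=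
  fun _ hx => push_mem_chainsIn (f := smulMap g) h hx

variable [CWComplex (univ : Set X)] [MulAction G X]

/-- The action of the group on the cells. -/
abbrev cellMulAction (h : IsCellularAction G X) (n : ℕ) : MulAction G (cell (univ : Set X) n) where
  smul g e := (h g n e).choose
  -- A cell is determined by its open cell, so the chosen image is unique and the laws of an action
  -- follow from those for sets.
  one_smul e := openCell_congr n (by
    rw [← (h 1 n e).choose_spec.trans rfl, one_smul])
  mul_smul g g' e := openCell_congr n (by
    refine Eq.trans (h (g * g') n e).choose_spec.symm ?_
    refine Eq.trans ?_ (h g n _).choose_spec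
    rw [mul_smul]
    congr 1
    exact (h g' n e).choose_spec)

lemma smul_openCell (h : IsCellularAction G X) {n : ℕ} (g : G) (e : cell (univ : Set X) n) :
    g • openCell n e = openCell n ((cellMulAction h n).smul g e) := (h g n e).choose_spec

lemma stabilizer_cell (h : IsCellularAction G X) {n : ℕ} (e : cell (univ : Set X) n) :
    @MulAction.stabilizer G _ _ (cellMulAction h n) e = cellIsotropy G e := by
  ext g
  let := cellMulAction h n
  rw [MulAction.mem_stabilizer_iff, MulAction.mem_stabilizer_iff, smul_openCell h]
  exact ⟨fun he => congrArg (openCell n) he, fun he => openCell_congr n he⟩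

lemma mapsTo_skelLT [T2Space X] (h : IsCellularAction G X) (g : G) (n : ℕ) :
    MapsTo (g • ·) (skelLT X n) (skelLT X n) := by
  intro x hx
  obtain ⟨m, hm, j, hj⟩ := CWComplex.mem_skeletonLT_iff.1 hx
  refine CWComplex.mem_skeletonLT_iff.2 ⟨m, hm, (cellMulAction h m).smul g j, ?_⟩
  rw [← smul_openCell h]
  exact smul_mem_smul_set hj

end Action

/-! ### Finiteness of cohomological dimension for a cellular action. -/

section CohomologicalDimension

open Topology RelCWComplex Set CategoryTheory Limits

variable {R : Type v} [CommRing R] {G : Type u} [Group G] {X : Type w} [TopologicalSpace X]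
  [T2Space X] [CWComplex (univ : Set X)] [MulAction G X] [ContinuousConstSMul G X]

omit [T2Space X] [CWComplex (univ : Set X)] in
lemma singBd_chainRep (g : G) (x : SingularChain R X) :
    chainRep R G X g (singBd R x) = singBd R (chainRep R G X g x) := push_singBd _ x

omit [T2Space X] [CWComplex (univ : Set X)] in
lemma bot_le_comap_chainRep (g : G) : (⊥ : Submodule R (SingularChain R X)) ≤
    (⊥ : Submodule R (SingularChain R X)).comap (chainRep R G X g) := bot_le

/-- The homology of a skeleton as a representation. -/
def skeletalCycles (h : IsCellularAction G X) (n : ℕ) :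
    Representation R G (RelHomology (singBd R) (chainsIn R (skelLT X n)) ⊥) :=
  relHomologyRep singBd_chainRep (fun g => chainsIn_le_comap_chainRep (mapsTo_skelLT h g n))
    bot_le_comap_chainRep

/-- The cellular chains as a representation. -/
def cellularChains (h : IsCellularAction G X) (n : ℕ) : Representation R G
    (RelHomology (singBd R) (chainsIn R (skelLT X (n + 1))) (chainsIn R (skelLT X n))) :=
  relHomologyRep singBd_chainRep (fun g => chainsIn_le_comap_chainRep (mapsTo_skelLT h g (n + 1)))
    (fun g => chainsIn_le_comap_chainRep (mapsTo_skelLT h g n))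

/-- The group permutes the cellular basis up to scalars, and the stabilizers are the isotropy
groups. Isotropy elements may reverse the orientation of a cell; the cocycle absorbs this, so they
need not fix the cell pointwise. -/
lemma hasProjectiveDimensionLT_cellularChains (h : IsCellularAction G X) (n k : ℕ)
    (hk : ∀ e : cell (univ : Set X) n, cohomologicalDimension R (cellIsotropy G e) ≤ k) :
    HasProjectiveDimensionLT (Rep.of ((cellularChains (R := R) h n).ulift :
      Representation R G (ULift.{u} _))) (k + 1) := by
  let := cellMulAction h n
  obtain ⟨z, hz, hb, hb'⟩ := exists_relBasis_skelLT R X n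
  refine hasProjectiveDimensionLT_of_monomial.{u, v, w} (cellularChains h n) hb.basis
    (fun g e => ?_) k fun e => ?_
  · have hmaps : MapsTo (g • ·) (skelLT X n ∪ openCell n e) (skelLT X n ∪ openCell n (g • e)) := by
      rintro x (hx | hx)
      · exact Or.inl (mapsTo_skelLT h g n hx)
      · refine Or.inr ?_
        have := smul_openCell h g e
        exact this ▸ smul_mem_smul_set hx
    have hsub : skelLT X n ∪ openCell n (g • e) ⊆ skelLT X (n + 1) := by
      rw [skelLT_succ]
      exact union_subset_union_right _
        (subset_iUnion (fun e : cell (univ : Set X) n => openCell n e) _)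
    have h1 := chainsIn_le_comap_chainRep (R := R) hmaps ((hb' e).mem ())
    have h2 := chainsIn_le_comap_chainRep (R := R) (mapsTo_skelLT h g n) ((hb' e).d_mem ())
    rw [Submodule.mem_comap, singBd_chainRep] at h2
    -- The translate of the cycle of `e` is supported on the skeleton and the single cell `g • e`,
    -- whose relative homology has rank one. Only that basis element can occur.
    obtain ⟨r, f, hf, hr⟩ := (hb' (g • e)).span _ h1 h2
    refine ⟨r (), ?_⟩
    rw [hb.basis_apply, hb.basis_apply, cellularChains, relHomologyRep_cls _ _ _ g _
      ⟨_, mem_relCycles.2 ⟨chainsIn_mono hsub h1, h2⟩⟩ rfl, ← map_smul, ← sub_eq_zero, ← map_sub,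
      RelHomology.cls_eq_zero_iff]
    refine ⟨f, chainsIn_mono hsub hf, ?_⟩
    rw [Finsupp.linearCombination_unique] at hr
    exact hr
  · rw [stabilizer_cell h e]
    exact (cohomologicalDimension_le_iff.{u, v, w} R _ k).1 (hk e)

/-- The bottom homology module is the trivial representation. -/
def skeletalCyclesZeroIso (h : IsCellularAction G X) :
    Rep.of ((skeletalCycles (R := R) h 0).ulift : Representation R G (ULift.{u} _)) ≅
      Rep.trivialLift.{u, v, w} R G :=
  have hb : RelBasis (singBd R) (chainsIn R (skelLT X 0)) ⊥
      (fun _ : Unit => Finsupp.single (emptySimplex X) (1 : R)) := by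
    rw [skelLT_zero]
    exact relBasis_empty R X
  Rep.mkIso (Representation.Equiv.mk
    (ULift.moduleEquiv.trans (hb.basis.repr.trans
      ((Finsupp.uniqueLinearEquiv R R ()).trans ULift.moduleEquiv.symm))) fun g => by
    refine LinearMap.ext fun x => ?_
    obtain ⟨x⟩ := x
    have key : skeletalCycles h 0 g x = x := by
      suffices skeletalCycles h 0 g = LinearMap.id from LinearMap.congr_fun this x
      refine hb.basis.ext fun i => ?_
      rw [LinearMap.id_apply, hb.basis_apply, skeletalCycles]
      refine relHomologyRep_cls _ _ _ g _ _ ?_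
      change push R (smulMap g) (Finsupp.single (emptySimplex X) 1) =
        Finsupp.single (emptySimplex X) 1
      rw [push_single]
      congr 1
      exact eq_emptySimplex rfl
    change _ = (Rep.trivialLift.{u, v, w} R G).ρ g _
    rw [LinearMap.comp_apply, Representation.ulift_up, key]
    rfl)

lemma isZero_skeletalCycles [ContractibleSpace X] (h : IsCellularAction G X) {N : ℕ}
    (hN : skelLT X N = univ) :
    IsZero (Rep.of ((skeletalCycles (R := R) h N).ulift : Representation R G (ULift.{u} _))) := by
  have hsub : ∀ x : RelHomology (singBd R) (chainsIn R (skelLT X N)) ⊥, x = 0 := by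
    intro x
    obtain ⟨c, rfl⟩ := RelHomology.cls_surjective x
    rw [RelHomology.cls_eq_zero_iff]
    have := relAcyclic_of_contractibleSpace (R := R) (X := X)
    rw [← hN] at this
    exact this c.1 c.2.1 c.2.2
  rw [IsZero.iff_id_eq_zero]
  ext x
  exact (hsub _).trans (hsub _).symm

lemma exists_shortExact_skeletalCycles [FiniteDimensional (univ : Set X)] [ContractibleSpace X]
    (h : IsCellularAction G X) (n : ℕ) :
    ∃ (f : Rep.of (skeletalCycles (R := R) h (n + 1)).ulift ⟶
        Rep.of ((cellularChains (R := R) h n).ulift : Representation R G (ULift.{u} _)))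
      (g : Rep.of (cellularChains (R := R) h n).ulift ⟶ Rep.of (skeletalCycles (R := R) h n).ulift)
      (w : f ≫ g = 0), (ShortComplex.mk f g w).ShortExact :=
  exists_shortExact_relHomology.{u, v, w} (M := SingularChain R X) (d := singBd R)
    (ρ := chainRep R G X) (C := chainsIn R (skelLT X (n + 1))) (A := chainsIn R (skelLT X n))
    (fun x => singBd_singBd x) (fun g x => singBd_chainRep g x)
    (fun g => chainsIn_le_comap_chainRep (mapsTo_skelLT h g (n + 1)))
    (fun g => chainsIn_le_comap_chainRep (mapsTo_skelLT h g n)) (fun g => bot_le_comap_chainRep g)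
    (chainsIn_mono (skelLT_mono n.le_succ)) (fun _ ha hda => exists_singBd_eq_of_skelLT ha hda)

/-- A group acting cellularly on a finite-dimensional contractible CW-complex with isotropy groups
of bounded cohomological dimension has finite cohomological dimension. -/
theorem cohomologicalDimension_lt_top_of_action [FiniteDimensional (univ : Set X)]
    [ContractibleSpace X] (h : IsCellularAction G X) (k : ℕ)
    (hk : ∀ (n : ℕ) (e : cell (univ : Set X) n),
      cohomologicalDimension R (cellIsotropy G e) ≤ k) :
    cohomologicalDimension R G < ⊤ := by
  obtain ⟨N, hN⟩ := exists_skelLT_eq_univ X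
  let Z : ℕ → Rep.{max u v w} R G := fun n => Rep.of (skeletalCycles (R := R) h n).ulift
  let C : ℕ → Rep.{max u v w} R G := fun n => Rep.of (cellularChains (R := R) h n).ulift
  have h1 : HasProjectiveDimensionLT (Z 0) (k + 1 + N) :=
    hasProjectiveDimensionLT_of_shortExact_tower.{u, v, w} Z C k N
      (fun n => hasProjectiveDimensionLT_cellularChains h n k (hk n))
      (isZero_skeletalCycles h (hN N le_rfl)) fun n => exists_shortExact_skeletalCycles h n
  refine (cohomologicalDimension_lt_top_iff R G).2 ⟨k + N,
    (cohomologicalDimension_le_iff.{u, v, w} R G (k + N)).2 ?_⟩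
  rw [show k + N + 1 = k + 1 + N by omega]
  exact @hasProjectiveDimensionLT_of_iso _ _ _ _ _ (skeletalCyclesZeroIso h) _ h1

end CohomologicalDimension
end

noncomputable section

/-! ### Invariance under isomorphism of groups. -/

section Isomorphism

open CategoryTheory Limits

variable (R : Type v) [CommRing R]

/-- Restriction along a group isomorphism is left adjoint to restriction along its inverse. -/
def Rep.resMulEquivAdjunction {G G' : Type u} [Group G] [Group G'] (e : G ≃* G') :
    Rep.resFunctor.{max u v w} (k := R) (e.symm : G' →* G) ⊣
      Rep.resFunctor.{max u v w} (k := R) (e : G →* G') :=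
  Adjunction.mkOfHomEquiv
    { homEquiv := fun X Y =>
        { toFun := fun f => Rep.ofHom
            ⟨f.hom.toLinearMap, fun g => by
              have := f.hom.isIntertwining' (e g)
              simpa using this⟩
          invFun := fun f => Rep.ofHom
            ⟨f.hom.toLinearMap, fun g => by
              have := f.hom.isIntertwining' (e.symm g)
              simpa using this⟩
          left_inv := fun f => rfl
          right_inv := fun f => rfl }
      homEquiv_naturality_left_symm := by intros; rfl
      homEquiv_naturality_right := by intros; rfl }

lemma cohomologicalDimension_le_of_mulEquiv {G G' : Type u} [Group G] [Group G'] (e : G ≃* G')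
    {k : ℕ} (h : cohomologicalDimension R G ≤ k) : cohomologicalDimension R G' ≤ k := by
  rw [cohomologicalDimension_le_iff.{u, v, 0}] at h ⊢
  have : (Rep.resFunctor.{max u v} (k := R)
      (e.symm : G' →* G)).PreservesProjectiveObjects :=
    Functor.preservesProjectiveObjects_of_adjunction_of_preservesEpimorphisms
      (Rep.resMulEquivAdjunction.{u, v, 0} R e)
  exact hasProjectiveDimensionLT_map (Rep.resFunctor.{max u v} (k := R) (e.symm : G' →* G)) _ _ h

end Isomorphism

lemma cohomologicalDimension_lt_top_iff_exists_le (R : Type v) [CommRing R] (G : Type u) [Group G] :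
    cohomologicalDimension R G < ⊤ ↔ ∃ k : ℕ, cohomologicalDimension R G ≤ k := by
  constructor
  · intro h
    obtain ⟨n, hn⟩ := ENat.ne_top_iff_exists.1 h.ne
    exact ⟨n, hn.ge⟩
  · rintro ⟨k, hk⟩
    exact hk.trans_lt (ENat.natCast_lt_top k)

/-! ### Inheritance by subgroups and the induction over the class. -/

section Subgroups

variable {R : Type v} [CommRing R] {G : Type u} [Group G]

lemma IsRTorsionFree.subgroup (h : IsRTorsionFree R G) (K : Subgroup G) :
    IsRTorsionFree R K := by
  intro L hL
  have e := L.equivMapOfInjective K.subtype K.subtype_injective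
  rw [Nat.card_congr e.toEquiv]
  exact h _ (Finite.of_equiv L e.toEquiv)

lemma HasJumpCohomologyOfHeight.subgroup {k : ℕ} (h : HasJumpCohomologyOfHeight R G k)
    (K : Subgroup G) : HasJumpCohomologyOfHeight R K k := by
  intro L hL
  have e := L.equivMapOfInjective K.subtype K.subtype_injective
  obtain ⟨m, hm⟩ := (cohomologicalDimension_lt_top_iff_exists_le R L).1 hL
  exact cohomologicalDimension_le_of_mulEquiv R e.symm
    (h _ ((cohomologicalDimension_le_of_mulEquiv R e hm).trans_lt (ENat.natCast_lt_top m)))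

lemma HasJumpCohomologyOfHeight.cohomologicalDimension_le {k : ℕ}
    (h : HasJumpCohomologyOfHeight R G k) (hG : cohomologicalDimension R G < ⊤) :
    cohomologicalDimension R G ≤ k := by
  obtain ⟨m, hm⟩ := (cohomologicalDimension_lt_top_iff_exists_le R G).1 hG
  exact cohomologicalDimension_le_of_mulEquiv R Subgroup.topEquiv
    (h ⊤ ((cohomologicalDimension_subgroup_le R G ⊤ m hm).trans_lt (ENat.natCast_lt_top m)))

lemma IsRTorsionFree.isUnit_natCard [Finite G] (h : IsRTorsionFree R G) :
    IsUnit ((Nat.card G : ℕ) : R) := by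
  rw [← Subgroup.card_top (G := G)]
  exact h ⊤ inferInstance

end Subgroups

lemma isRTorsionFree_of_charZero (K : Type v) [Field K] [CharZero K] (G : Type u) [Group G] :
    IsRTorsionFree K G := fun _ _ =>
  (Nat.cast_ne_zero.2 Nat.card_pos.ne').isUnit

/-- The same `k` bounds all isotropy groups. This uniformity makes the bound from the
finite-dimensional complex finite, and the jump hypothesis restores the value `k`, so the induction
closes without any growth. -/
theorem IsHFGroup.cohomologicalDimension_le {G : Type u} [Group G] (hG : IsHFGroup.{u, w} G)
    {R : Type v} [CommRing R] {k : ℕ} (ht : IsRTorsionFree R G)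
    (hj : HasJumpCohomologyOfHeight R G k) : cohomologicalDimension R G ≤ k := by
  unfold IsHFGroup at hG
  induction hG with
  | of_mem G hG =>
    exact (cohomologicalDimension_le_zero_of_finite R G ht.isUnit_natCard).trans (by simp)
  | of_action G X hcell hiso ih =>
    exact hj.cohomologicalDimension_le (cohomologicalDimension_lt_top_of_action hcell k
      fun n e => ih n e (ht.subgroup _) (hj.subgroup _))

end

theorem theorem3p2 (G : Type u) [Group G] (hG : IsHFGroup.{u, w} G) (k : ℕ) :
    (∀ (R : Type v) [CommRing R], IsRTorsionFree R G → HasJumpCohomologyOfHeight R G k →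
      cohomologicalDimension R G ≤ k) ∧
    (HasJumpCohomologyOfHeight ℚ G k ↔ cohomologicalDimension ℚ G ≤ k) :=
  ⟨fun _ _ ht hj => hG.cohomologicalDimension_le ht hj,
    fun hj => hG.cohomologicalDimension_le (isRTorsionFree_of_charZero ℚ G) hj,
    fun h H _ => cohomologicalDimension_subgroup_le ℚ G H k h⟩
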